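/- Let $A=\bigoplus_{n\in\mathbb Z}A_n$ be a commutative $\mathbb Z$-graded ring, $\mathrm{Gr}(A)$ the category of $\mathbb Z$-graded $A$-modules with degree-$0$ homomorphisms, $A(i)$ the graded module with $A(i)_n=A_{n+i}$, and $A_{\ge0}=\bigoplus_{n\ge0}A_n$. Put $X^+=\mathrm{Proj}^+(A):=\mathrm{Proj}(A_{\ge 0})$, and for $M\in\mathrm{Gr}(A)$ let $\widetilde M$ be the $\mathcal O_{X^+}$-module associated with $M$, regarded as a module over $A_{\ge0}$; thus $\widetilde M$ has sections $M_{(f)}$ (the degree-$0$ part of $M_f$) on $D(f)$ for $f$ homogeneous of positive degree. Let $d>0$ be an integer. Let $A^{(d)}$ be the graded ring with $(A^{(d)})_n=A_{dn}$, let $I^+_{(d)}=(A^{(d)})_{>0}\cdot A^{(d)}$, and for $M\in\mathrm{Gr}(A)$ let $M^{(d)}$ be the graded $A^{(d)}$-module with $(M^{(d)})_n=M_{dn}$. Let $\mathrm{Tor}^+_{(d)}(A)\subset\mathrm{Gr}(A)$ be the full subcategory of those $M$ such that for every homogeneous $x\in M^{(d)}$ and every $f\in I^+_{(d)}$ there is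 $k>0$ with $f^kx=0$. Let $\mathrm{Gr}(A)/\mathrm{Tor}^+_{(d)}(A)$ be the Serre quotient, that is, the localization of $\mathrm{Gr}(A)$ at the morphisms whose kernel and cokernel lie in $\mathrm{Tor}^+_{(d)}(A)$. Assume that $A_{\ge0}$ is a Noetherian ring and that $A$ is positively $\tfrac1d$-Cartier, i.e. the canonical multiplication map $\widetilde{A(di)}\otimes_{\mathcal O_{X^+}}\widetilde{A(dj)}\to\widetilde{A(di+dj)}$ is an isomorphism for all $i,j\in\mathbb Z$. Then every $\widetilde M$ is quasi-coherent, the functor $M\mapsto\widetilde M$ from $\mathrm{Gr}(A)$ to $\mathrm{QCoh}(X^+)$ sends every morphism with kernel and cokernel in $\mathrm{Tor}^+_{(d)}(A)$ to an isomorphism, hence descends to the Serre quotient, and the resulting functor $$(-)^\sim:\ \mathrm{Gr}(A)/\mathrm{Tor}^+_{(d)}(A)\longrightarrow\mathrm{QCoh}(X^+)$$ and the functor $$\mathrm{QCoh}(X^+)\longrightarrow\mathrm{Gr}(A)/\mathrm{Tor}^+_{(d)}(A),\qquad \mathcal F\longmapsto\bigoplus_{i\in\mathbb Z}H^0(X^+,\mathcal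 F\otimes_{\mathcal O_{X^+}}\widetilde{A(i)}),$$ where $a\in A_j$ acts through the map $\widetilde{A(i)}\to\widetilde{A(i+j)}$ given by multiplication by $a$, are inverse equivalences of categories. -/

import Mathlib

open CategoryTheory TopologicalSpace Opposite AlgebraicGeometry

universe u

noncomputable section

namespace GradedProj

section GradedRings

variable {A : Type u} [CommRing A] (𝒜 : ℤ → AddSubgroup A) [GradedRing 𝒜]

/-- The subring `⨁_{n ∈ S} A_n` of a `ℤ`-graded ring `A`, for a submonoid `S` of `(ℤ, +)`: the
elements all of whose homogeneous components of degree outside `S` vanish. -/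
def supportedSubring (S : AddSubmonoid ℤ) : Subring A where
  carrier := {a | ∀ n : ℤ, n ∉ S → (DirectSum.decompose 𝒜 a n : A) = 0}
  zero_mem' n _ := by simp
  one_mem' n hn := by
    have h0 : (0 : ℤ) ≠ n := fun h => hn (h ▸ S.zero_mem)
    exact DirectSum.decompose_of_mem_ne 𝒜 SetLike.GradedOne.one_mem h0
  add_mem' {a b} ha hb n hn := by simp [DirectSum.decompose_add, ha n hn, hb n hn]
  neg_mem' {a} ha n hn := by
    rw [DirectSum.decompose_neg]
    exact neg_eq_zero.mpr (ha n hn)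
  mul_mem' {a b} ha hb n hn := by
    classical
    rw [DirectSum.decompose_mul, DirectSum.coe_mul_apply]
    refine Finset.sum_eq_zero fun ij hij => ?_
    have hij' : ij.1 + ij.2 = n := (Finset.mem_filter.mp hij).2
    by_cases h1 : ij.1 ∈ S
    · by_cases h2 : ij.2 ∈ S
      · exact absurd (hij' ▸ S.add_mem h1 h2) hn
      · rw [hb _ h2, mul_zero]
    · rw [ha _ h1, zero_mul]

theorem mem_supportedSubring_of_mem {S : AddSubmonoid ℤ} {n : ℤ} (hn : n ∈ S) {a : A}
    (ha : a ∈ 𝒜 n) : a ∈ supportedSubring 𝒜 S := fun _ hm =>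
  DirectSum.decompose_of_mem_ne 𝒜 ha fun h => hm (h ▸ hn)

/-- The subring `A_{≥ 0} = ⨁_{n ≥ 0} A_n` of a `ℤ`-graded ring. -/
abbrev nonneg : Subring A := supportedSubring 𝒜 (AddSubmonoid.nonneg ℤ)

/-- The `ℕ`-grading of `A_{≥ 0}`, whose degree `n` part is `A_n`. -/
def nonnegGrading (n : ℕ) : AddSubgroup (nonneg 𝒜) :=
  (𝒜 (n : ℤ)).comap (nonneg 𝒜).subtype.toAddMonoidHom

theorem mem_nonnegGrading {n : ℕ} {b : nonneg 𝒜} : b ∈ nonnegGrading 𝒜 n ↔ (b : A) ∈ 𝒜 n :=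
  Iff.rfl

instance nonnegGrading_gradedMonoid : SetLike.GradedMonoid (nonnegGrading 𝒜) where
  one_mem := (SetLike.GradedOne.one_mem : (1 : A) ∈ 𝒜 0)
  mul_mem {i j} a b ha hb := by
    rw [mem_nonnegGrading] at *
    push_cast
    exact SetLike.GradedMul.mul_mem ha hb

theorem nonnegGrading_isInternal : DirectSum.IsInternal (nonnegGrading 𝒜) := by
  classical
  constructor
  · rw [injective_iff_map_eq_zero]
    intro x hx
    -- compare with the decomposition in `A`
    have key : ∀ (y : DirectSum ℕ fun i => nonnegGrading 𝒜 i) (n : ℕ),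
        (DirectSum.decompose 𝒜
          ((DirectSum.coeAddMonoidHom (nonnegGrading 𝒜) y : nonneg 𝒜) : A) (n : ℤ) : A) =
          ((y n : nonneg 𝒜) : A) := by
      intro y n
      induction y using DirectSum.induction_on with
      | zero => simp
      | of i b =>
        rw [DirectSum.coeAddMonoidHom_of]
        by_cases h : i = n
        · subst h
          rw [DirectSum.of_eq_same]
          exact DirectSum.decompose_of_mem_same 𝒜 b.2
        · rw [DirectSum.of_eq_of_ne _ _ _ (Ne.symm h)]
          exact DirectSum.decompose_of_mem_ne 𝒜 (b.2 : ((b : nonneg 𝒜) : A) ∈ 𝒜 (i : ℤ))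
            (by exact_mod_cast h)
      | add y z hy hz =>
        simp only [map_add, Subring.coe_add, DirectSum.decompose_add, DirectSum.add_apply,
          AddSubgroup.coe_add, hy, hz]
    refine DFinsupp.ext fun n => Subtype.ext (Subtype.ext ?_)
    have := key x n
    rw [hx] at this
    simpa using this.symm
  · intro b
    have hb : ∀ i : ℤ, i < 0 → (DirectSum.decompose 𝒜 (b : A) i : A) = 0 := fun i hi =>
      b.2 i (by simpa using hi)
    refine ⟨∑ i ∈ (DirectSum.decompose 𝒜 (b : A)).support,
      DirectSum.of (fun n => nonnegGrading 𝒜 n) i.toNat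
        (if h : 0 ≤ i then ⟨⟨(DirectSum.decompose 𝒜 (b : A) i : A),
          mem_supportedSubring_of_mem 𝒜 (by simpa using h) (SetLike.coe_mem _)⟩, by
            rw [mem_nonnegGrading, Int.toNat_of_nonneg h]; exact SetLike.coe_mem _⟩ else 0), ?_⟩
    refine Subtype.ext ?_
    rw [map_sum, AddSubmonoidClass.coe_finsetSum]
    conv_rhs => rw [← DirectSum.sum_support_decompose 𝒜 (b : A)]
    refine Finset.sum_congr rfl fun i _ => ?_
    rw [DirectSum.coeAddMonoidHom_of]
    by_cases h : 0 ≤ i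
    · rw [dif_pos h]
    · rw [dif_neg h, hb i (not_le.mp h)]; rfl

instance nonnegGrading_gradedRing : GradedRing (nonnegGrading 𝒜) where
  __ := nonnegGrading_gradedMonoid 𝒜
  __ := (nonnegGrading_isInternal 𝒜).chooseDecomposition

/-- The scheme `Proj⁺(A) = Proj(A_{≥ 0})`. -/
def projPlus : Scheme.{u} := Proj (nonnegGrading 𝒜)

end GradedRings

section GradedModules

variable {A : Type u} [CommRing A] (𝒜 : ℤ → AddSubgroup A)

/-- A `ℤ`-graded module over the `ℤ`-graded ring `A = ⨁ 𝒜 n`. -/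
structure GrMod where
  /-- the underlying module -/
  carrier : Type u
  [addCommGroup : AddCommGroup carrier]
  [module : Module A carrier]
  /-- the homogeneous components -/
  deg : ℤ → AddSubgroup carrier
  smul_mem : ∀ {i j : ℤ} {a : A} {m : carrier}, a ∈ 𝒜 i → m ∈ deg j → a • m ∈ deg (i + j)
  isInternal : DirectSum.IsInternal deg

attribute [instance] GrMod.addCommGroup GrMod.module

namespace GrMod

variable {𝒜}

/-- Morphisms of graded modules: the `A`-linear maps of degree `0`. -/
@[ext]
structure Hom (M N : GrMod 𝒜) where
  /-- the underlying linear map -/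
  toLin : M.carrier →ₗ[A] N.carrier
  map_deg : ∀ {i : ℤ} {m : M.carrier}, m ∈ M.deg i → toLin m ∈ N.deg i

/-- The category `Gr(A)`. -/
instance : Category.{u} (GrMod 𝒜) where
  Hom := Hom
  id M := ⟨LinearMap.id, fun h => h⟩
  comp f g := ⟨g.toLin ∘ₗ f.toLin, fun h => g.map_deg (f.map_deg h)⟩

@[simp] theorem id_toLin (M : GrMod 𝒜) : Hom.toLin (𝟙 M) = LinearMap.id := rfl

@[simp] theorem comp_toLin {M N P : GrMod 𝒜} (f : M ⟶ N) (g : N ⟶ P) :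
    Hom.toLin (f ≫ g) = g.toLin ∘ₗ f.toLin := rfl

theorem hom_ext {M N : GrMod 𝒜} {f g : M ⟶ N} (h : ∀ m, f.toLin m = g.toLin m) : f = g :=
  Hom.ext (LinearMap.ext h)

variable [GradedRing 𝒜]

variable (𝒜) in
/-- The twist `A(i)` of the graded ring `A`, with `A(i)_n = A_{n + i}`. -/
def twist (i : ℤ) : GrMod 𝒜 where
  carrier := A
  deg n := 𝒜 (n + i)
  smul_mem {j k a m} ha hm := by
    rw [add_assoc]
    exact SetLike.GradedMul.mul_mem ha hm
  isInternal := by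
    let σ := DirectSum.equivCongrLeft (β := fun k => 𝒜 k) (Equiv.subRight i)
    have e : (DirectSum.coeAddMonoidHom fun n => 𝒜 (n + i)).comp σ.toAddMonoidHom =
        DirectSum.coeAddMonoidHom 𝒜 := by
      refine DirectSum.addHom_ext fun n x => ?_
      obtain ⟨k, rfl⟩ := (Equiv.subRight i).symm.surjective n
      have := DirectSum.equivCongrLeft_of (β := fun k => 𝒜 k) (Equiv.subRight i) k x
      refine (congrArg (DirectSum.coeAddMonoidHom fun n => 𝒜 (n + i)) this).trans ?_
      rw [DirectSum.coeAddMonoidHom_of]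
      exact DirectSum.coeAddMonoidHom_of (fun n => 𝒜 (n + i)) k x
    have h := DirectSum.Decomposition.isInternal 𝒜
    rw [DirectSum.IsInternal, ← e] at h
    exact (Function.Bijective.of_comp_iff _ σ.bijective).mp h

/-- Multiplication by a homogeneous element `a ∈ A_j`, as a morphism `A(i) ⟶ A(k)` for
`k = j + i`. -/
def twistMap {i j k : ℤ} (h : j + i = k) (a : 𝒜 j) : twist 𝒜 i ⟶ twist 𝒜 k where
  toLin := LinearMap.mulLeft A (a : A)
  map_deg {n m} hm := by
    have : (a : A) * (show A from m) ∈ 𝒜 (j + (n + i)) := SetLike.GradedMul.mul_mem a.2 hm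
    subst h
    change (a : A) * (show A from m) ∈ 𝒜 (n + (j + i))
    rwa [show n + (j + i) = j + (n + i) by ring]

end GrMod

end GradedModules

section KernelCokernel

variable {A : Type u} [CommRing A] {𝒜 : ℤ → AddSubgroup A}

/-- A criterion for an internal direct sum decomposition, through the projections to the
components. -/
theorem isInternal_of_projections {M : Type u} [AddCommGroup M] {deg : ℤ → AddSubgroup M}
    (p : ℤ → M →+ M) (hp : ∀ i m, p i m ∈ deg i) (hp_same : ∀ i, ∀ m ∈ deg i, p i m = m)
    (hp_ne : ∀ i j, j ≠ i → ∀ m ∈ deg j, p i m = 0)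
    (hp_sum : ∀ m, ∃ s : Finset ℤ, ∑ i ∈ s, p i m = m) : DirectSum.IsInternal deg := by
  constructor
  · rw [injective_iff_map_eq_zero]
    intro x hx
    have key : ∀ (y : DirectSum ℤ fun i => deg i) (n : ℤ),
        p n (DirectSum.coeAddMonoidHom deg y) = y n := by
      intro y n
      induction y using DirectSum.induction_on with
      | zero => simp
      | of i b =>
        rw [DirectSum.coeAddMonoidHom_of]
        by_cases h : i = n
        · subst h
          rw [DirectSum.of_eq_same, hp_same _ _ b.2]
        · rw [DirectSum.of_eq_of_ne _ _ _ (Ne.symm h), hp_ne _ _ h _ b.2]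
          rfl
      | add y z hy hz =>
        rw [map_add, map_add, hy, hz, DirectSum.add_apply, AddSubgroup.coe_add]
    refine DFinsupp.ext fun n => Subtype.ext ?_
    have := key x n
    rw [hx, map_zero] at this
    exact this.symm
  · intro m
    obtain ⟨s, hs⟩ := hp_sum m
    refine ⟨∑ i ∈ s, DirectSum.of (fun i => deg i) i ⟨p i m, hp i m⟩, ?_⟩
    simpa only [map_sum, DirectSum.coeAddMonoidHom_of] using hs

namespace GrMod

/-- The projection of a graded module to its component of degree `i`. -/
def proj (M : GrMod 𝒜) (i : ℤ) : M.carrier →+ M.carrier :=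
  letI := M.isInternal.chooseDecomposition
  (M.deg i).subtype.comp
    ((DFinsupp.evalAddMonoidHom i).comp (DirectSum.decomposeAddEquiv M.deg).toAddMonoidHom)

theorem proj_mem (M : GrMod 𝒜) (i : ℤ) (m : M.carrier) : M.proj i m ∈ M.deg i :=
  SetLike.coe_mem _

theorem proj_same (M : GrMod 𝒜) (i : ℤ) {m : M.carrier} (hm : m ∈ M.deg i) : M.proj i m = m :=
  letI := M.isInternal.chooseDecomposition
  DirectSum.decompose_of_mem_same M.deg hm

theorem proj_ne (M : GrMod 𝒜) {i j : ℤ} (h : j ≠ i) {m : M.carrier} (hm : m ∈ M.deg j) :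
    M.proj i m = 0 :=
  letI := M.isInternal.chooseDecomposition
  DirectSum.decompose_of_mem_ne M.deg hm h

theorem proj_sum (M : GrMod 𝒜) (m : M.carrier) : ∃ s : Finset ℤ, ∑ i ∈ s, M.proj i m = m := by
  classical
  let _ := M.isInternal.chooseDecomposition
  exact ⟨_, DirectSum.sum_support_decompose M.deg m⟩

theorem map_proj {M N : GrMod 𝒜} (φ : M ⟶ N) (i : ℤ) (m : M.carrier) :
    φ.toLin (M.proj i m) = N.proj i (φ.toLin m) := by
  obtain ⟨s, hs⟩ := M.proj_sum m
  have h : ∀ j, φ.toLin (M.proj i (M.proj j m)) = N.proj i (φ.toLin (M.proj j m)) := fun j => by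
    by_cases hj : j = i
    · subst hj
      rw [M.proj_same _ (M.proj_mem _ m), N.proj_same _ (φ.map_deg (M.proj_mem _ m))]
    · rw [M.proj_ne hj (M.proj_mem _ m), N.proj_ne hj (φ.map_deg (M.proj_mem _ m)), map_zero]
  rw [← hs]
  simp only [map_sum, h]

/-- The kernel of a morphism of graded modules, a graded module. -/
def ker {M N : GrMod 𝒜} (φ : M ⟶ N) : GrMod 𝒜 where
  carrier := LinearMap.ker φ.toLin
  deg n := (M.deg n).comap (LinearMap.ker φ.toLin).subtype.toAddMonoidHom
  smul_mem ha hm := M.smul_mem ha hm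
  isInternal := isInternal_of_projections
    (fun i => ((M.proj i).comp (LinearMap.ker φ.toLin).subtype.toAddMonoidHom).codRestrict
      (LinearMap.ker φ.toLin) fun m => by
        change φ.toLin (M.proj i m) = 0
        rw [map_proj, LinearMap.mem_ker.mp m.2, map_zero])
    (fun i m => M.proj_mem i m)
    (fun i m hm => Subtype.ext (M.proj_same i hm))
    (fun i j h m hm => Subtype.ext (M.proj_ne h hm))
    (fun m => by
      obtain ⟨s, hs⟩ := M.proj_sum m.1
      refine ⟨s, Subtype.ext ?_⟩
      rw [AddSubmonoidClass.coe_finsetSum]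
      exact hs)

/-- The cokernel of a morphism of graded modules, a graded module. -/
def coker {M N : GrMod 𝒜} (φ : M ⟶ N) : GrMod 𝒜 where
  carrier := N.carrier ⧸ LinearMap.range φ.toLin
  deg n := (N.deg n).map (LinearMap.range φ.toLin).mkQ.toAddMonoidHom
  smul_mem := by
    rintro i j a _ ha ⟨m, hm, rfl⟩
    exact ⟨a • m, N.smul_mem ha hm, rfl⟩
  isInternal := isInternal_of_projections
    (fun i => QuotientAddGroup.map _ _ (N.proj i) (by
      rintro _ ⟨m, rfl⟩
      exact ⟨M.proj i m, map_proj φ i m⟩))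
    (by
      rintro i ⟨m⟩
      exact ⟨N.proj i m, N.proj_mem i m, rfl⟩)
    (by
      rintro i _ ⟨m, hm, rfl⟩
      exact congrArg (LinearMap.range φ.toLin).mkQ (N.proj_same i hm))
    (by
      rintro i j h _ ⟨m, hm, rfl⟩
      exact congrArg (LinearMap.range φ.toLin).mkQ (N.proj_ne h hm))
    (by
      rintro ⟨m⟩
      obtain ⟨s, hs⟩ := N.proj_sum m
      exact ⟨s, (map_sum (LinearMap.range φ.toLin).mkQ _ s).symm.trans
        (congrArg (LinearMap.range φ.toLin).mkQ hs)⟩)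

end GrMod

end KernelCokernel

section AssociatedSheaf

variable {A : Type u} [CommRing A] {𝒜 : ℤ → AddSubgroup A} [GradedRing 𝒜]

/-- The multiplicative set `A_{≥ 0} ∖ 𝔭` of a point `𝔭` of `Proj⁺(A)`. -/
abbrev compl (x : ProjectiveSpectrum (nonnegGrading 𝒜)) : Submonoid (nonneg 𝒜) :=
  x.asHomogeneousIdeal.toIdeal.primeCompl

/-- The localization `M_𝔭` of the `A_{≥ 0}`-module `M` at a point `𝔭` of `Proj⁺(A)`. -/
abbrev Loc (M : GrMod 𝒜) (x : ProjectiveSpectrum (nonnegGrading 𝒜)) : Type u :=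
  LocalizedModule (compl x) M.carrier

/-- The underlying topological space of `Proj⁺(A)`. -/
abbrev top (𝒜 : ℤ → AddSubgroup A) [GradedRing 𝒜] : TopCat.{u} :=
  ProjectiveSpectrum.top (nonnegGrading 𝒜)

/-- A dependent function on an open `U` of `Proj⁺(A)` is a fraction if there are homogeneous
`m ∈ M` and `s ∈ A_{≥ 0}` of the same degree such that it is `m / s` at all points of `U`. -/
def IsFraction (M : GrMod 𝒜) {U : Opens (top 𝒜)} (f : ∀ x : U, Loc M x.1) : Prop :=
  ∃ (n : ℕ) (m : M.deg n) (s : nonnegGrading 𝒜 n), ∀ x : U, ∃ hs : s.1 ∈ compl x.1,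
    f x = LocalizedModule.mk (S := compl x.1) m.1 ⟨s.1, hs⟩

/-- The predicate `IsFraction` is stable under restriction. -/
def isFractionPrelocal (M : GrMod 𝒜) :
    TopCat.PrelocalPredicate fun x : top 𝒜 => Loc M x where
  pred {_} f := IsFraction M f
  res := by rintro V U i f ⟨n, m, s, w⟩; exact ⟨n, m, s, fun x => w (i x)⟩

/-- The dependent functions which are locally fractions. -/
def isLocallyFraction (M : GrMod 𝒜) : TopCat.LocalPredicate fun x : top 𝒜 => Loc M x :=
  (isFractionPrelocal M).sheafify

/-- The sections of `M̃` over `U`. -/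
def sections (M : GrMod 𝒜) (U : Opens (top 𝒜)) : AddSubgroup (∀ x : U, Loc M x.1) where
  carrier := {f | (isLocallyFraction M).pred f}
  zero_mem' x := ⟨U, x.2, 𝟙 _, 0, 0, ⟨1, SetLike.GradedOne.one_mem⟩, fun y =>
    ⟨one_mem _, (LocalizedModule.zero_mk _).symm⟩⟩
  add_mem' {f g} hf hg x := by
    obtain ⟨V, hxV, i, n, m, s, w⟩ := hf x
    obtain ⟨V', hxV', i', n', m', s', w'⟩ := hg x
    refine ⟨V ⊓ V', ⟨hxV, hxV'⟩, Opens.infLELeft _ _ ≫ i, n + n',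
      ⟨(s' : nonneg 𝒜) • (m : M.carrier) + (s : nonneg 𝒜) • (m' : M.carrier), ?_⟩,
      ⟨s * s', SetLike.GradedMul.mul_mem s.2 s'.2⟩, fun y => ?_⟩
    · push_cast
      refine add_mem ?_ ?_
      · rw [add_comm]
        exact M.smul_mem s'.2 m.2
      · exact M.smul_mem s.2 m'.2
    · obtain ⟨h, e⟩ := w ⟨y.1, y.2.1⟩
      obtain ⟨h', e'⟩ := w' ⟨y.1, y.2.2⟩
      exact ⟨mul_mem h h', congr($e + $e').trans (LocalizedModule.mk_add_mk ..)⟩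
  neg_mem' {f} hf x := by
    obtain ⟨V, hxV, i, n, m, s, w⟩ := hf x
    exact ⟨V, hxV, i, n, -m, s, fun y => ⟨(w y).1, congr(-$((w y).2)).trans
      LocalizedModule.mk_neg.symm⟩⟩

/-- The sections over `U` of the structure sheaf of `Proj⁺(A)`. -/
abbrev structureSections (𝒜 : ℤ → AddSubgroup A) [GradedRing 𝒜] (U : Opens (top 𝒜)) : Type u :=
  ProjectiveSpectrum.StructureSheaf.sectionsSubring (𝒜 := nonnegGrading 𝒜) (op U)

/-- `M̃(U)` is a module over `𝒪(U)`, pointwise. -/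
instance (M : GrMod 𝒜) (U : Opens (top 𝒜)) : Module (structureSections 𝒜 U) (sections M U) where
  smul r f := ⟨fun x => (r.1 x).val • f.1 x, fun x => by
    obtain ⟨V, hxV, i, n, ⟨a, ha⟩, ⟨s, hs⟩, nin, w⟩ := r.2 x
    obtain ⟨V', hxV', i', n', m, s', w'⟩ := f.2 x
    refine ⟨V ⊓ V', ⟨hxV, hxV'⟩, Opens.infLELeft _ _ ≫ i, n + n',
      ⟨a • (m : M.carrier), ?_⟩,
      ⟨s * s', SetLike.GradedMul.mul_mem hs s'.2⟩, fun y => ?_⟩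
    · push_cast
      exact M.smul_mem ha m.2
    · obtain ⟨h', e'⟩ := w' ⟨y.1, y.2.2⟩
      have e := congrArg HomogeneousLocalization.val (w ⟨y.1, y.2.1⟩)
      refine ⟨mul_mem (nin ⟨y.1, y.2.1⟩) h', ?_⟩
      exact (congr($e • $e')).trans (LocalizedModule.mk_smul_mk ..)⟩
  one_smul f := Subtype.ext <| funext fun x =>
    (congrArg (· • f.1 x) HomogeneousLocalization.val_one).trans (one_smul _ _)
  mul_smul r r' f := Subtype.ext <| funext fun x =>
    (congrArg (· • f.1 x) (HomogeneousLocalization.val_mul _ _)).trans (mul_smul _ _ _)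
  smul_zero r := Subtype.ext <| funext fun x => smul_zero _
  smul_add r f g := Subtype.ext <| funext fun x => smul_add _ _ _
  add_smul r r' f := Subtype.ext <| funext fun x =>
    (congrArg (· • f.1 x) (HomogeneousLocalization.val_add _ _)).trans (add_smul _ _ _)
  zero_smul f := Subtype.ext <| funext fun x =>
    (congrArg (· • f.1 x) HomogeneousLocalization.val_zero).trans (zero_smul _ _)

theorem smul_apply {M : GrMod 𝒜} {U : Opens (top 𝒜)} (r : structureSections 𝒜 U)
    (f : sections M U) (x : U) : (r • f).1 x = (r.1 x).val • f.1 x := rfl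

end AssociatedSheaf

section AssociatedSheafFunctor

variable {A : Type u} [CommRing A] {𝒜 : ℤ → AddSubgroup A} [GradedRing 𝒜]

/-- The associated sheaf `M̃`, as a presheaf of abelian groups. -/
def tildePresheafAb (M : GrMod 𝒜) : (Opens (top 𝒜))ᵒᵖ ⥤ Ab.{u} where
  obj U := AddCommGrpCat.of (sections M U.unop)
  map {U V} i := AddCommGrpCat.ofHom
    { toFun := fun f => ⟨fun x => f.1 (i.unop x), (isLocallyFraction M).res i.unop f.1 f.2⟩
      map_zero' := rfl
      map_add' := fun _ _ => rfl }

/-- The structure sheaf of `Proj⁺(A)` as a presheaf of rings. -/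
abbrev structureRings (𝒜 : ℤ → AddSubgroup A) [GradedRing 𝒜] : (Opens (top 𝒜))ᵒᵖ ⥤ RingCat.{u} :=
  (ProjectiveSpectrum.Proj.structureSheaf (nonnegGrading 𝒜)).1 ⋙ forget₂ CommRingCat RingCat

/-- The sections of `M̃` over an open subset form a module over the structure sheaf. -/
instance (M : GrMod 𝒜) (U : (Opens (top 𝒜))ᵒᵖ) :
    Module ((structureRings 𝒜).obj U) ((tildePresheafAb M).obj U) :=
  inferInstanceAs (Module (structureSections 𝒜 U.unop) (sections M U.unop))

/-- The associated sheaf `M̃` as a presheaf of modules. -/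
def tildePresheaf (M : GrMod 𝒜) : PresheafOfModules.{u} (structureRings 𝒜) :=
  PresheafOfModules.ofPresheaf (tildePresheafAb M) fun _ _ _ _ _ => rfl

/-- The `𝒪`-module `M̃` on `Proj⁺(A)` associated with a graded module `M`. -/
def tilde (M : GrMod 𝒜) : (projPlus 𝒜).Modules where
  val := tildePresheaf M
  isSheaf := (TopCat.Presheaf.isSheaf_iff_isSheaf_comp (X := top 𝒜) (forget AddCommGrpCat)
    (tildePresheafAb M)).2 (TopCat.subsheafToTypes (isLocallyFraction M)).2

/-- The map `M_𝔭 → N_𝔭` induced by a morphism `M → N`. -/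
def locMap {M N : GrMod 𝒜} (φ : M ⟶ N) (x : ProjectiveSpectrum (nonnegGrading 𝒜)) :
    Loc M x →ₗ[Localization (compl x)] Loc N x :=
  LocalizedModule.map (compl x) (φ.toLin.restrictScalars (nonneg 𝒜))

theorem locMap_mk {M N : GrMod 𝒜} (φ : M ⟶ N) (x : ProjectiveSpectrum (nonnegGrading 𝒜))
    (m : M.carrier) (s : compl x) :
    locMap φ x (LocalizedModule.mk m s) = LocalizedModule.mk (φ.toLin m) s :=
  LocalizedModule.map_mk ..

/-- The map `M̃(U) → Ñ(U)` induced by a morphism `M → N`. -/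
def sectionsMap {M N : GrMod 𝒜} (φ : M ⟶ N) (U : Opens (top 𝒜)) :
    sections M U →ₗ[structureSections 𝒜 U] sections N U where
  toFun f := ⟨fun x => locMap φ x.1 (f.1 x), fun x => by
    obtain ⟨V, hxV, i, n, m, s, w⟩ := f.2 x
    exact ⟨V, hxV, i, n, ⟨φ.toLin m.1, φ.map_deg m.2⟩, s, fun y =>
      ⟨(w y).1, congr(locMap φ y.1 $((w y).2)).trans (locMap_mk ..)⟩⟩⟩
  map_add' f g := Subtype.ext <| funext fun x => map_add _ _ _
  map_smul' r f := Subtype.ext <| funext fun x => map_smul (locMap φ x.1) _ _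

/-- The morphism of presheaves of modules `M̃ → Ñ` induced by a morphism `M → N`. -/
def tildePresheafMap {M N : GrMod 𝒜} (φ : M ⟶ N) : tildePresheaf M ⟶ tildePresheaf N where
  app U := ModuleCat.ofHom (X := sections M U.unop) (Y := sections N U.unop)
    (R := structureSections 𝒜 U.unop) (sectionsMap φ U.unop)

/-- The morphism `M̃ → Ñ` induced by a morphism `M → N`. -/
def tildeMap {M N : GrMod 𝒜} (φ : M ⟶ N) : tilde M ⟶ tilde N where
  val := tildePresheafMap φ

theorem locMap_id (M : GrMod 𝒜) (x : ProjectiveSpectrum (nonnegGrading 𝒜)) (z : Loc M x) :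
    locMap (𝟙 M) x z = z := by
  induction z using LocalizedModule.induction_on with
  | h m s => rw [locMap_mk]; rfl

theorem locMap_comp {M N P : GrMod 𝒜} (φ : M ⟶ N) (ψ : N ⟶ P)
    (x : ProjectiveSpectrum (nonnegGrading 𝒜)) (z : Loc M x) :
    locMap (φ ≫ ψ) x z = locMap ψ x (locMap φ x z) := by
  induction z using LocalizedModule.induction_on with
  | h m s => simp only [locMap_mk]; rfl

variable (𝒜) in
/-- The functor `M ↦ M̃` from graded modules to `𝒪`-modules on `Proj⁺(A)`. -/
def tildeFunctor : GrMod 𝒜 ⥤ (projPlus 𝒜).Modules where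
  obj := tilde
  map := tildeMap
  map_id M := Scheme.Modules.hom_ext _ _ fun U => by
    ext f
    exact Subtype.ext (funext fun x : (show Opens (top 𝒜) from U) => locMap_id M x.1 _)
  map_comp φ ψ := Scheme.Modules.hom_ext _ _ fun U => by
    ext f
    exact Subtype.ext (funext fun x : (show Opens (top 𝒜) from U) => locMap_comp φ ψ x.1 _)

/-- The property of being a quasi-coherent `𝒪`-module. -/
def isQCoh (X : Scheme.{u}) : ObjectProperty X.Modules :=
  fun F => SheafOfModules.IsQuasicoherent F

/-- The category `QCoh(X)`. -/
abbrev QCoh (X : Scheme.{u}) : Type (u + 1) := (isQCoh X).FullSubcategory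

end AssociatedSheafFunctor

section TensorProduct

variable (X : Scheme.{u})

/-- The underlying presheaf of modules of an `𝒪`-module, over the presheaf of commutative rings
`𝒪`. -/
def toPresheafMod : X.Modules ⥤ PresheafOfModules.{u} (X.presheaf ⋙ forget₂ CommRingCat RingCat) :=
  Scheme.Modules.toPresheafOfModules X

/-- The sheafification of presheaves of modules. -/
def sheafifyMod : PresheafOfModules.{u} (X.presheaf ⋙ forget₂ CommRingCat RingCat) ⥤ X.Modules :=
  (PresheafOfModules.sheafification (𝟙 X.ringCatSheaf.obj) :
    X.PresheafOfModules ⥤ SheafOfModules.{u} X.ringCatSheaf)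

/-- Sheafification is left adjoint to the forgetful functor. -/
def sheafifyModAdj : sheafifyMod X ⊣ toPresheafMod X :=
  (PresheafOfModules.sheafificationAdjunction (𝟙 X.ringCatSheaf.obj) :
    (PresheafOfModules.sheafification (𝟙 X.ringCatSheaf.obj) :
      X.PresheafOfModules ⥤ SheafOfModules.{u} X.ringCatSheaf) ⊣
        SheafOfModules.forget X.ringCatSheaf ⋙
          PresheafOfModules.restrictScalars (𝟙 X.ringCatSheaf.obj))

/-- The tensor product of `𝒪`-modules: the sheafification of the tensor product of presheaves of
modules. -/
def tensorFunctor : X.Modules ⥤ X.Modules ⥤ X.Modules :=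
  toPresheafMod X ⋙ MonoidalCategory.curriedTensor _ ⋙
    (Functor.whiskeringLeft _ _ _).obj (toPresheafMod X) ⋙
    (Functor.whiskeringRight _ _ _).obj (sheafifyMod X)

end TensorProduct

section Additivity

variable {A : Type u} [CommRing A] {𝒜 : ℤ → AddSubgroup A} [GradedRing 𝒜]

instance (X : Scheme.{u}) : (toPresheafMod X).Additive where
  map_add := rfl

instance (X : Scheme.{u}) : (sheafifyMod X).Additive :=
  (sheafifyModAdj X).left_adjoint_additive

theorem tensor_map_add {X : Scheme.{u}} (F : X.Modules) {G H : X.Modules} (f g : G ⟶ H) :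
    ((tensorFunctor X).obj F).map (f + g) =
      ((tensorFunctor X).obj F).map f + ((tensorFunctor X).obj F).map g := by
  have e : ((MonoidalCategory.curriedTensor _).obj ((toPresheafMod X).obj F)).map
      ((toPresheafMod X).map (f + g)) =
      ((MonoidalCategory.curriedTensor _).obj ((toPresheafMod X).obj F)).map
        ((toPresheafMod X).map f) +
      ((MonoidalCategory.curriedTensor _).obj ((toPresheafMod X).obj F)).map
        ((toPresheafMod X).map g) := by
    ext1 U
    exact MonoidalPreadditive.whiskerLeft_add (C := ModuleCat (X.presheaf.obj U)) _ _
  exact (congrArg (sheafifyMod X).map e).trans (Functor.map_add _)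

theorem locMap_add {M N : GrMod 𝒜} (φ ψ χ : M ⟶ N)
    (h : ∀ m, χ.toLin m = φ.toLin m + ψ.toLin m)
    (x : ProjectiveSpectrum (nonnegGrading 𝒜)) (z : Loc M x) :
    locMap χ x z = locMap φ x z + locMap ψ x z := by
  induction z using LocalizedModule.induction_on with
  | h m s =>
    rw [locMap_mk, locMap_mk, locMap_mk, h, LocalizedModule.mk_add_mk, ← smul_add,
      LocalizedModule.mk_cancel_common_left]

theorem tildeMap_add {M N : GrMod 𝒜} (φ ψ χ : M ⟶ N)
    (h : ∀ m, χ.toLin m = φ.toLin m + ψ.toLin m) :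
    tildeMap χ = tildeMap φ + tildeMap ψ :=
  Scheme.Modules.hom_ext _ _ fun U => by
    ext f
    exact Subtype.ext (funext fun x : (show Opens (top 𝒜) from U) =>
      locMap_add φ ψ χ h x.1 _)

end Additivity

section TwistedSections

open DirectSum

variable {A : Type u} [CommRing A] {𝒜 : ℤ → AddSubgroup A} [GradedRing 𝒜]

/-- The global sections functor on `𝒪`-modules. -/
def globalSections (X : Scheme.{u}) : X.Modules ⥤ Ab.{u} :=
  Scheme.Modules.toPresheaf X ⋙ (evaluation _ _).obj (op ⊤)

/-- The group `H⁰(Proj⁺(A), F ⊗ M̃)`, functorially in `F` and in `M`. -/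
def sectionsTensor (𝒜 : ℤ → AddSubgroup A) [GradedRing 𝒜] :
    (projPlus 𝒜).Modules ⥤ GrMod 𝒜 ⥤ Ab.{u} :=
  tensorFunctor (projPlus 𝒜) ⋙ (Functor.whiskeringLeft _ _ _).obj (tildeFunctor 𝒜) ⋙
    (Functor.whiskeringRight _ _ _).obj (globalSections (projPlus 𝒜))

theorem sectionsTensor_map_add (F : (projPlus 𝒜).Modules) {M N : GrMod 𝒜} (φ ψ χ : M ⟶ N)
    (h : ∀ m, χ.toLin m = φ.toLin m + ψ.toLin m) :
    ((sectionsTensor 𝒜).obj F).map χ =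
      ((sectionsTensor 𝒜).obj F).map φ + ((sectionsTensor 𝒜).obj F).map ψ := by
  have e : ((tensorFunctor (projPlus 𝒜)).obj F).map (tildeMap χ) =
      ((tensorFunctor (projPlus 𝒜)).obj F).map (tildeMap φ) +
      ((tensorFunctor (projPlus 𝒜)).obj F).map (tildeMap ψ) := by
    rw [tildeMap_add φ ψ χ h, tensor_map_add]
  exact congrArg (globalSections (projPlus 𝒜)).map e

/-- The group `H⁰(Proj⁺(A), F ⊗ Ã(i))`. -/
def twistedSections (F : (projPlus 𝒜).Modules) (i : ℤ) : Type u :=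
  ((sectionsTensor 𝒜).obj F).obj (GrMod.twist 𝒜 i)

instance (F : (projPlus 𝒜).Modules) (i : ℤ) : AddCommGroup (twistedSections F i) :=
  inferInstanceAs (AddCommGroup (((sectionsTensor 𝒜).obj F).obj (GrMod.twist 𝒜 i)))

/-- Multiplication by `a ∈ A_j`, as a map
`H⁰(Proj⁺(A), F ⊗ Ã(i)) → H⁰(Proj⁺(A), F ⊗ Ã(k))` where `k = j + i`: it is induced by the
multiplication map `a : A(i) → A(k)`. -/
def twistedMul (F : (projPlus 𝒜).Modules) {i j k : ℤ} (h : j + i = k) (a : 𝒜 j) :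
    twistedSections F i →+ twistedSections F k :=
  (((sectionsTensor 𝒜).obj F).map (GrMod.twistMap h a)).hom

theorem twistedMul_add (F : (projPlus 𝒜).Modules) {i j k : ℤ} (h : j + i = k) (a b : 𝒜 j) :
    twistedMul F h (a + b) = twistedMul F h a + twistedMul F h b :=
  congrArg AddCommGrpCat.Hom.hom (sectionsTensor_map_add F _ _ _ fun m : A =>
    (add_mul (a : A) (b : A) m))

theorem twistedMul_zero (F : (projPlus 𝒜).Modules) {i j k : ℤ} (h : j + i = k) :
    twistedMul F h (0 : 𝒜 j) = 0 := by
  have := twistedMul_add F h (0 : 𝒜 j) 0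
  rwa [add_zero, left_eq_add] at this

theorem twistedMul_one (F : (projPlus 𝒜).Modules) {i k : ℤ} (h : 0 + i = k)
    (m : twistedSections F i) :
    (⟨k, twistedMul F h ⟨1, SetLike.GradedOne.one_mem⟩ m⟩ : Σ n, twistedSections F n) =
      ⟨i, m⟩ := by
  obtain rfl : i = k := by omega
  have : GrMod.twistMap h (⟨1, SetLike.GradedOne.one_mem⟩ : 𝒜 0) = 𝟙 (GrMod.twist 𝒜 i) :=
    GrMod.hom_ext fun m : A => one_mul m
  refine congrArg (Sigma.mk i) ?_
  refine (congrArg (fun φ => (((sectionsTensor 𝒜).obj F).map φ).hom m) this).trans ?_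
  exact congrArg (fun φ => AddCommGrpCat.Hom.hom φ m)
    (((sectionsTensor 𝒜).obj F).map_id (GrMod.twist 𝒜 i))

theorem twistedMul_mul (F : (projPlus 𝒜).Modules) {i j j' k k' l : ℤ} (h : j' + i = k')
    (h' : j + k' = k) (h'' : j + j' + i = l) (a : 𝒜 j) (b : 𝒜 j') (m : twistedSections F i) :
    (⟨l, twistedMul F h'' ⟨a * b, SetLike.GradedMul.mul_mem a.2 b.2⟩ m⟩ :
      Σ n, twistedSections F n) = ⟨k, twistedMul F h' a (twistedMul F h b m)⟩ := by
  obtain rfl : k = l := by omega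
  have : GrMod.twistMap h'' (⟨a * b, SetLike.GradedMul.mul_mem a.2 b.2⟩ : 𝒜 (j + j')) =
      GrMod.twistMap h b ≫ GrMod.twistMap h' a :=
    GrMod.hom_ext fun m : A => mul_assoc (a : A) b m
  refine congrArg (Sigma.mk k) ?_
  refine (congrArg (fun φ => (((sectionsTensor 𝒜).obj F).map φ).hom m) this).trans ?_
  exact congrArg (fun φ => AddCommGrpCat.Hom.hom φ m)
    (((sectionsTensor 𝒜).obj F).map_comp (GrMod.twistMap h b) (GrMod.twistMap h' a))

/-- The graded action of `A` on `⨁ᵢ H⁰(Proj⁺(A), F ⊗ Ã(i))`. -/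
instance (F : (projPlus 𝒜).Modules) : Gmodule (fun j => 𝒜 j) (twistedSections F) where
  smul a m := twistedMul F rfl a m
  one_smul := fun ⟨_, m⟩ => twistedMul_one F _ m
  mul_smul := fun ⟨_, a⟩ ⟨_, b⟩ ⟨_, m⟩ => twistedMul_mul F _ _ _ a b m
  smul_add _ m m' := map_add _ m m'
  smul_zero _ := map_zero _
  add_smul a b m := DFunLike.congr_fun (twistedMul_add F _ a b) m
  zero_smul m := DFunLike.congr_fun (twistedMul_zero F _) m

end TwistedSections

section GammaStar

open DirectSum

variable {A : Type u} [CommRing A] {𝒜 : ℤ → AddSubgroup A} [GradedRing 𝒜]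

/-- A direct sum is the internal direct sum of its summands. -/
theorem isInternal_range_of (E : ℤ → Type u) [∀ i, AddCommGroup (E i)] :
    DirectSum.IsInternal fun i => (DirectSum.of E i).range := by
  let σ : (⨁ i, E i) →+ ⨁ i, (DirectSum.of E i).range :=
    DirectSum.map fun i => (DirectSum.of E i).rangeRestrict
  have hσ : Function.Surjective σ :=
    (DirectSum.map_surjective _).mpr fun i => (DirectSum.of E i).rangeRestrict_surjective
  have e : (DirectSum.coeAddMonoidHom fun i => (DirectSum.of E i).range).comp σ =
      AddMonoidHom.id _ := by
    refine DirectSum.addHom_ext fun i x => ?_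
    simp [σ]
  have e' : Function.LeftInverse
      (DirectSum.coeAddMonoidHom fun i => (DirectSum.of E i).range) σ := DFunLike.congr_fun e
  have e'' := e'.rightInverse_of_surjective hσ
  exact ⟨e''.injective, e'.surjective⟩

/-- The `A`-module `⨁ᵢ H⁰(Proj⁺(A), F ⊗ Ã(i))`. -/
def GammaStar (F : (projPlus 𝒜).Modules) : Type u := ⨁ i, twistedSections F i

instance (F : (projPlus 𝒜).Modules) : AddCommGroup (GammaStar F) :=
  inferInstanceAs (AddCommGroup (⨁ i, twistedSections F i))

instance (F : (projPlus 𝒜).Modules) : Module A (GammaStar F) :=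
  letI : Module (⨁ i, 𝒜 i) (GammaStar F) :=
    inferInstanceAs (Module (⨁ i, 𝒜 i) (⨁ i, twistedSections F i))
  Module.compHom _ (DirectSum.decomposeRingEquiv 𝒜).toRingHom

/-- The inclusion of the summand `H⁰(Proj⁺(A), F ⊗ Ã(i))`. -/
def GammaStar.of (F : (projPlus 𝒜).Modules) (i : ℤ) : twistedSections F i →+ GammaStar F :=
  DirectSum.of (twistedSections F) i

theorem GammaStar.smul_of (F : (projPlus 𝒜).Modules) {i j : ℤ} (a : 𝒜 j)
    (m : twistedSections F i) :
    (a : A) • GammaStar.of F i m = GammaStar.of F (j + i) (twistedMul F rfl a m) := by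
  have h : DirectSum.decomposeRingEquiv 𝒜 (a : A) = DirectSum.of (fun i => 𝒜 i) j a :=
    DirectSum.decompose_coe 𝒜 a
  have key := DirectSum.Gmodule.of_smul_of (fun j => 𝒜 j) (twistedSections F) a m
  rw [← h] at key
  exact key

theorem GammaStar.hom_ext {F : (projPlus 𝒜).Modules} {N : Type u} [AddCommGroup N]
    {f g : GammaStar F →+ N} (h : ∀ i m, f (GammaStar.of F i m) = g (GammaStar.of F i m)) :
    f = g :=
  DirectSum.addHom_ext h

/-- The graded `A`-module `⨁ᵢ H⁰(Proj⁺(A), F ⊗ Ã(i))`. -/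
def gammaStar (F : (projPlus 𝒜).Modules) : GrMod 𝒜 where
  carrier := GammaStar F
  deg i := (GammaStar.of F i).range
  smul_mem {i j a m} ha hm := by
    obtain ⟨y, rfl⟩ := hm
    exact ⟨_, (GammaStar.smul_of F ⟨a, ha⟩ y).symm⟩
  isInternal := isInternal_range_of (twistedSections F)

/-- The map `H⁰(Proj⁺(A), F ⊗ Ã(i)) → H⁰(Proj⁺(A), G ⊗ Ã(i))` induced by `φ : F ⟶ G`. -/
def twistedSectionsMap {F G : (projPlus 𝒜).Modules} (φ : F ⟶ G) (i : ℤ) :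
    twistedSections F i →+ twistedSections G i :=
  (((sectionsTensor 𝒜).map φ).app (GrMod.twist 𝒜 i)).hom

theorem twistedSectionsMap_id (F : (projPlus 𝒜).Modules) (i : ℤ) (m : twistedSections F i) :
    twistedSectionsMap (𝟙 F) i m = m :=
  congrArg (fun τ : (sectionsTensor 𝒜).obj F ⟶ (sectionsTensor 𝒜).obj F =>
    (τ.app (GrMod.twist 𝒜 i)).hom m) ((sectionsTensor 𝒜).map_id F)

theorem twistedSectionsMap_comp {F G H : (projPlus 𝒜).Modules} (φ : F ⟶ G) (ψ : G ⟶ H) (i : ℤ)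
    (m : twistedSections F i) : twistedSectionsMap (φ ≫ ψ) i m =
      twistedSectionsMap ψ i (twistedSectionsMap φ i m) :=
  congrArg (fun τ : (sectionsTensor 𝒜).obj F ⟶ (sectionsTensor 𝒜).obj H =>
    (τ.app (GrMod.twist 𝒜 i)).hom m) ((sectionsTensor 𝒜).map_comp φ ψ)

/-- The additive map `⨁ᵢ H⁰(F ⊗ Ã(i)) → ⨁ᵢ H⁰(G ⊗ Ã(i))` induced by a morphism `F ⟶ G`. -/
def gammaStarMapAdd {F G : (projPlus 𝒜).Modules} (φ : F ⟶ G) : GammaStar F →+ GammaStar G :=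
  DirectSum.map fun i => twistedSectionsMap φ i

theorem gammaStarMapAdd_of {F G : (projPlus 𝒜).Modules} (φ : F ⟶ G) (i : ℤ)
    (m : twistedSections F i) : gammaStarMapAdd φ (GammaStar.of F i m) =
      GammaStar.of G i (twistedSectionsMap φ i m) :=
  DirectSum.map_of _ _ _

theorem gammaStarMapAdd_smul {F G : (projPlus 𝒜).Modules} (φ : F ⟶ G) (a : A)
    (x : GammaStar F) : gammaStarMapAdd φ (a • x) = a • gammaStarMapAdd φ x := by
  induction a using DirectSum.Decomposition.inductionOn 𝒜 with
  | zero => rw [zero_smul, zero_smul, map_zero]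
  | add a b ha hb => rw [add_smul, add_smul, map_add, ha, hb]
  | homogeneous a =>
    refine DFunLike.congr_fun (GammaStar.hom_ext
      (f := (gammaStarMapAdd φ).comp (DistribSMul.toAddMonoidHom _ (a : A)))
      (g := (DistribSMul.toAddMonoidHom _ (a : A)).comp (gammaStarMapAdd φ)) fun i m => ?_) x
    change gammaStarMapAdd φ ((a : A) • GammaStar.of F i m) =
      (a : A) • gammaStarMapAdd φ (GammaStar.of F i m)
    rw [GammaStar.smul_of, gammaStarMapAdd_of, gammaStarMapAdd_of, GammaStar.smul_of]
    refine congrArg (GammaStar.of G _) ?_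
    exact ConcreteCategory.congr_hom (((sectionsTensor 𝒜).map φ).naturality
      (GrMod.twistMap rfl a)) m

variable (𝒜) in
/-- The functor `F ↦ ⨁ᵢ H⁰(Proj⁺(A), F ⊗ Ã(i))` from `𝒪`-modules to graded modules. -/
def gammaStarFunctor : (projPlus 𝒜).Modules ⥤ GrMod 𝒜 where
  obj := gammaStar
  map {F G} φ :=
    { toLin := { gammaStarMapAdd φ with map_smul' := gammaStarMapAdd_smul φ }
      map_deg := by
        rintro i _ ⟨m, rfl⟩
        exact ⟨_, (gammaStarMapAdd_of φ i m).symm⟩ }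
  map_id F := GrMod.hom_ext fun m => by
    refine DFunLike.congr_fun (GammaStar.hom_ext (f := gammaStarMapAdd (𝟙 F))
      (g := AddMonoidHom.id _) fun i m => ?_) m
    rw [gammaStarMapAdd_of, twistedSectionsMap_id]
    rfl
  map_comp {F G H} φ ψ := GrMod.hom_ext fun m => by
    refine DFunLike.congr_fun (GammaStar.hom_ext (f := gammaStarMapAdd (φ ≫ ψ))
      (g := (gammaStarMapAdd ψ).comp (gammaStarMapAdd φ)) fun i m => ?_) m
    rw [AddMonoidHom.comp_apply, gammaStarMapAdd_of, gammaStarMapAdd_of, gammaStarMapAdd_of,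
      twistedSectionsMap_comp]

end GammaStar

section Cartier

variable {A : Type u} [CommRing A] (𝒜 : ℤ → AddSubgroup A) [GradedRing 𝒜]

/-- The product of a section of `Ã(i)` and a section of `Ã(j)`, which is a section of
`Ã(i + j)`: it is computed pointwise in the localizations `A_𝔭`. -/
def sectionsMul (i j : ℤ) (U : Opens (top 𝒜)) (f : sections (GrMod.twist 𝒜 i) U)
    (g : sections (GrMod.twist 𝒜 j) U) : sections (GrMod.twist 𝒜 (i + j)) U :=
  ⟨fun x => (show LocalizedModule (compl x.1) A from f.1 x) *
    (show LocalizedModule (compl x.1) A from g.1 x), fun x => by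
    obtain ⟨V, hxV, k, n, m, s, w⟩ := f.2 x
    obtain ⟨V', hxV', k', n', m', s', w'⟩ := g.2 x
    refine ⟨V ⊓ V', ⟨hxV, hxV'⟩, Opens.infLELeft _ _ ≫ k, n + n',
      ⟨(show A from m.1) * (show A from m'.1), ?_⟩,
      ⟨s * s', SetLike.GradedMul.mul_mem s.2 s'.2⟩, fun y => ?_⟩
    · have hm : (show A from m.1) ∈ 𝒜 (n + i) := m.2
      have hm' : (show A from m'.1) ∈ 𝒜 (n' + j) := m'.2
      have := SetLike.GradedMul.mul_mem hm hm'
      rw [show (n + i) + (n' + j) = ((n + n' : ℕ) : ℤ) + (i + j) by push_cast; ring] at this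
      exact this
    · obtain ⟨h, e⟩ := w ⟨y.1, y.2.1⟩
      obtain ⟨h', e'⟩ := w' ⟨y.1, y.2.2⟩
      refine ⟨mul_mem h h', ?_⟩
      exact (congrArg₂ (fun a b : LocalizedModule (compl y.1) A => a * b) e e').trans
        LocalizedModule.mk_mul_mk⟩

theorem loc_smul_mul (x : ProjectiveSpectrum (nonnegGrading 𝒜)) (c : Localization (compl x))
    (a b : LocalizedModule (compl x) A) : (c • a) * b = c • (a * b) := by
  induction c using Localization.induction_on with
  | H c =>
    induction a, b using LocalizedModule.induction_on₂ with
    | h a b s t =>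
      rw [LocalizedModule.mk_smul_mk, LocalizedModule.mk_mul_mk, LocalizedModule.mk_mul_mk,
        LocalizedModule.mk_smul_mk, smul_mul_assoc, mul_assoc]

theorem loc_mul_smul (x : ProjectiveSpectrum (nonnegGrading 𝒜)) (c : Localization (compl x))
    (a b : LocalizedModule (compl x) A) : a * (c • b) = c • (a * b) := by
  rw [mul_comm, loc_smul_mul, mul_comm]

theorem sectionsMul_add_left (i j : ℤ) (U : Opens (top 𝒜)) (f f' : sections (GrMod.twist 𝒜 i) U)
    (g : sections (GrMod.twist 𝒜 j) U) :
    sectionsMul 𝒜 i j U (f + f') g = sectionsMul 𝒜 i j U f g + sectionsMul 𝒜 i j U f' g :=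
  Subtype.ext <| funext fun x =>
    add_mul (show LocalizedModule (compl x.1) A from f.1 x) (f'.1 x) (g.1 x)

theorem sectionsMul_add_right (i j : ℤ) (U : Opens (top 𝒜)) (f : sections (GrMod.twist 𝒜 i) U)
    (g g' : sections (GrMod.twist 𝒜 j) U) :
    sectionsMul 𝒜 i j U f (g + g') = sectionsMul 𝒜 i j U f g + sectionsMul 𝒜 i j U f g' :=
  Subtype.ext <| funext fun x =>
    mul_add (show LocalizedModule (compl x.1) A from f.1 x) (g.1 x) (g'.1 x)

theorem sectionsMul_smul_left (i j : ℤ) (U : Opens (top 𝒜)) (r : structureSections 𝒜 U)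
    (f : sections (GrMod.twist 𝒜 i) U) (g : sections (GrMod.twist 𝒜 j) U) :
    sectionsMul 𝒜 i j U (r • f) g = r • sectionsMul 𝒜 i j U f g :=
  Subtype.ext <| funext fun x => loc_smul_mul 𝒜 x.1 (r.1 x).val (f.1 x) (g.1 x)

theorem sectionsMul_smul_right (i j : ℤ) (U : Opens (top 𝒜)) (r : structureSections 𝒜 U)
    (f : sections (GrMod.twist 𝒜 i) U) (g : sections (GrMod.twist 𝒜 j) U) :
    sectionsMul 𝒜 i j U f (r • g) = r • sectionsMul 𝒜 i j U f g :=
  Subtype.ext <| funext fun x => loc_mul_smul 𝒜 x.1 (r.1 x).val (f.1 x) (g.1 x)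

open MonoidalCategory in
/-- The multiplication `Ã(i)(U) ⊗ Ã(j)(U) → Ã(i + j)(U)`, as a morphism of presheaves. -/
def twistMulPresheaf (i j : ℤ) :
    PresheafOfModules.Monoidal.tensorObj (R := (projPlus 𝒜).presheaf)
      ((toPresheafMod _).obj (tilde (GrMod.twist 𝒜 i)))
      ((toPresheafMod _).obj (tilde (GrMod.twist 𝒜 j))) ⟶
    (toPresheafMod _).obj (tilde (GrMod.twist 𝒜 (i + j))) where
  app U := ModuleCat.MonoidalCategory.tensorLift (R := (projPlus 𝒜).presheaf.obj U)
    (fun f g => sectionsMul 𝒜 i j U.unop f g)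
    (fun f f' g => sectionsMul_add_left 𝒜 i j U.unop f f' g)
    (fun r f g => sectionsMul_smul_left 𝒜 i j U.unop r f g)
    (fun f g g' => sectionsMul_add_right 𝒜 i j U.unop f g g')
    (fun r f g => sectionsMul_smul_right 𝒜 i j U.unop r f g)
  naturality _ := ModuleCat.MonoidalCategory.tensor_ext fun _ _ => rfl

/-- The canonical map `Ã(i) ⊗ Ã(j) ⟶ Ã(i + j)` given by multiplication. -/
def twistMul (i j : ℤ) :
    ((tensorFunctor (projPlus 𝒜)).obj (tilde (GrMod.twist 𝒜 i))).obj (tilde (GrMod.twist 𝒜 j)) ⟶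
      tilde (GrMod.twist 𝒜 (i + j)) :=
  ((sheafifyModAdj (projPlus 𝒜)).homEquiv _ _).symm (twistMulPresheaf 𝒜 i j)

/-- `A` is positively `1/d`-Cartier if the canonical map `Ã(di) ⊗ Ã(dj) ⟶ Ã(di + dj)` of
`𝒪`-modules on `Proj⁺(A)` is an isomorphism for all `i, j ∈ ℤ`. -/
def IsPositivelyCartier (d : ℕ) : Prop :=
  ∀ i j : ℤ, IsIso (twistMul 𝒜 (d * i) (d * j))

end Cartier

section SerreQuotient

variable {A : Type u} [CommRing A] (𝒜 : ℤ → AddSubgroup A) [GradedRing 𝒜]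

/-- The underlying ring of the Veronese ring `A^{(d)} = ⨁ₙ A_{dn}`, as a subring of `A`. -/
abbrev veronese (d : ℕ) : Subring A :=
  supportedSubring 𝒜 (AddSubgroup.zmultiples (d : ℤ)).toAddSubmonoid

/-- The ideal `I⁺_{(d)} = (A^{(d)})_{> 0} · A^{(d)}` of the Veronese ring, whose degree `n` part is
`A_{dn}`. -/
def veroneseIdeal (d : ℕ) : Ideal (veronese 𝒜 d) :=
  Ideal.span {a | ∃ n : ℤ, 0 < n ∧ (a : A) ∈ 𝒜 (d * n)}

/-- The full subcategory `Tor⁺_{(d)}(A)` of `Gr(A)`: the graded modules `M` such that the graded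
module `M^{(d)} = ⨁ₙ M_{dn}` over `A^{(d)}` is positively torsion, i.e. such that for every
homogeneous element `x` of `M^{(d)}` and every `f ∈ I⁺_{(d)}` there is `k > 0` with
`f ^ k • x = 0`. -/
def torPlus (d : ℕ) : ObjectProperty (GrMod 𝒜) := fun M =>
  ∀ (n : ℤ), ∀ x ∈ M.deg (d * n), ∀ f ∈ veroneseIdeal 𝒜 d, ∃ k : ℕ, 0 < k ∧ (f : A) ^ k • x = 0

/-- The morphisms of `Gr(A)` whose kernel and cokernel belong to `Tor⁺_{(d)}(A)`. -/
def torPlusIso (d : ℕ) : MorphismProperty (GrMod 𝒜) := fun _ _ φ =>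
  torPlus 𝒜 d (GrMod.ker φ) ∧ torPlus 𝒜 d (GrMod.coker φ)

/-- The Serre quotient `Q⁺_{(d)}Gr(A) = Gr(A) / Tor⁺_{(d)}(A)`: the localization of `Gr(A)` at the
morphisms whose kernel and cokernel belong to `Tor⁺_{(d)}(A)`. -/
abbrev QGr (d : ℕ) : Type (u + 1) := (torPlusIso 𝒜 d).Localization

/-- The functor `M ↦ M̃` from `Gr(A)` to `QCoh(Proj⁺(A))`, given that the sheaves `M̃` are
quasi-coherent. -/
def tildeQCoh (hq : ∀ M : GrMod 𝒜, isQCoh (projPlus 𝒜) (tilde M)) :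
    GrMod 𝒜 ⥤ QCoh (projPlus 𝒜) :=
  (isQCoh (projPlus 𝒜)).lift (tildeFunctor 𝒜) hq

/-- The functor `QCoh(Proj⁺(A)) ⥤ Gr(A) / Tor⁺_{(d)}(A)` induced by
`F ↦ ⨁ᵢ H⁰(Proj⁺(A), F ⊗ Ã(i))`. -/
def gammaStarQuot (d : ℕ) : QCoh (projPlus 𝒜) ⥤ QGr 𝒜 d :=
  (isQCoh (projPlus 𝒜)).ι ⋙ gammaStarFunctor 𝒜 ⋙ (torPlusIso 𝒜 d).Q

/-- The functor `Gr(A) / Tor⁺_{(d)}(A) ⥤ QCoh(Proj⁺(A))` induced by `M ↦ M̃`. -/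
def tildeQuot (d : ℕ) (hq : ∀ M : GrMod 𝒜, isQCoh (projPlus 𝒜) (tilde M))
    (hT : (torPlusIso 𝒜 d).IsInvertedBy (tildeQCoh 𝒜 hq)) : QGr 𝒜 d ⥤ QCoh (projPlus 𝒜) :=
  Localization.Construction.lift (tildeQCoh 𝒜 hq) hT

end SerreQuotient

end GradedProj

end

/-! The Cartier condition supplies, locally on `Proj⁺(A)`, invertible elements of degree `d`. Since
`Ã(d) ⊗ Ã(-d) → Ã(0)` is surjective, near a point `x` the section `1` is a sum of products of
fractions; one of these products must be a unit at `x`, because the non-units of a local ring are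
closed under addition. Clearing denominators gives `g` of positive degree `dn` with `g(x) ≠ 0`, and
`u ∈ A_{dn+d}`, `v ∈ A_{dn-d}` with `uv = g²` (`exists_isUnitCover`). Over `D(g)`, multiplication by
powers of `u`, `v` and `g` then identifies every `Ã(di)` with `Ã(0) ≅ 𝒪`. As `A_{≥ 0}` is
Noetherian, so is the space `Proj⁺(A)`, and finitely many such `D(g)` cover it.

The usual argument with a finite covering and a combination of denominators shows that sections of
`M̃` over `D(g)` are fractions with denominator a power of `g` (`exists_pow_smul_eq_mk`). This gives
quasi-coherence, by the criterion that sections over `D(r)` are the sections over an affine open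
localized at `r`. A morphism with kernel and cokernel in `Tor⁺_{(d)}` becomes an isomorphism because
`m / t = t^{d-1} m / t^d`: every fraction can be rewritten with numerator in degree divisible by
`d`, where torsion is controlled.

Counit. A section `y / g` of the sheaf associated with `Γ_*(F) = ⨁ᵢ H⁰(F ⊗ Ã(i))` is sent to the
unique section `t` of `F ⊗ Ã(0) ≅ F` with `g t = y`. This is bijective by Serre's extension lemma
for twists by multiples of `d`: a global section vanishing on `D(f)` is killed by a power of `f`
(`exists_powMul_eq_zero`), and a section over `D(f)` extends after multiplication by a power of `f`
(`exists_res_eq_powMul`). Over each `D(g)` of the covering this is the quasi-coherence of `F`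
applied to the function `f^n / g^m`; finiteness of the covering makes the exponents uniform.

Unit. `M` and `Γ_*(M̃)` are compared through the zigzag `M → ⨁ᵢ H⁰(M(i)~) ← Γ_*(M̃)`. The left map
`m ↦ m / 1` has torsion kernel and cokernel, by the same extension argument. The right map comes
from `M̃ ⊗ Ã(i) → M(i)~`, which is an isomorphism when `d` divides `i`, since the local units reduce
it to `i = 0`. The other degrees are invisible to `Tor⁺_{(d)}`, so both maps become invertible in
the Serre quotient. -/

noncomputable section

namespace GradedProj

/-! ### Gluing sections and testing bijectivity locally -/

section SheafGeneralities

variable {X : Scheme.{u}}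

/-- Restriction of sections of an `𝒪`-module. -/
def res (F : X.Modules) {U V : X.Opens} (h : V ≤ U) : Γ(F, U) →+ Γ(F, V) :=
  (F.presheaf.map (homOfLE h).op).hom

theorem res_res (F : X.Modules) {U V W : X.Opens} (h : V ≤ U) (h' : W ≤ V) (s : Γ(F, U)) :
    res F h' (res F h s) = res F (h'.trans h) s :=
  (ConcreteCategory.congr_hom (F.presheaf.map_comp (homOfLE h).op (homOfLE h').op) s).symm

theorem res_self (F : X.Modules) {U : X.Opens} (h : U ≤ U) (s : Γ(F, U)) : res F h s = s :=
  ConcreteCategory.congr_hom (F.presheaf.map_id (op U)) s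

theorem res_app {F G : X.Modules} (φ : F ⟶ G) {U V : X.Opens} (h : V ≤ U) (s : Γ(F, U)) :
    res G h (φ.app U s) = φ.app V (res F h s) :=
  (ConcreteCategory.congr_hom (φ.mapPresheaf.naturality (homOfLE h).op) s).symm

theorem res_smul (F : X.Modules) {U V : X.Opens} (h : V ≤ U) (r : Γ(X, U)) (s : Γ(F, U)) :
    res F h (r • s) = X.presheaf.map (homOfLE h).op r • res F h s :=
  F.map_smul (homOfLE h) r s

theorem section_ext (F : X.Modules) {U : X.Opens} {s t : Γ(F, U)}
    (H : ∀ x ∈ U, ∃ (V : X.Opens) (h : V ≤ U), x ∈ V ∧ res F h s = res F h t) : s = t := by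
  refine TopCat.Presheaf.IsSheaf.section_ext (F := F.presheaf) F.isSheaf fun x hx => ?_
  obtain ⟨V, h, hxV, e⟩ := H x hx
  exact ⟨V, h, hxV, e⟩

theorem exists_glue (F : X.Modules) {ι : Type u} (V : ι → X.Opens) (U : X.Opens)
    (hV : ∀ i, V i ≤ U) (hU : ∀ x ∈ U, ∃ i, x ∈ V i) (s : ∀ i, Γ(F, V i))
    (hs : ∀ i j, res F (inf_le_left : V i ⊓ V j ≤ V i) (s i) =
      res F (inf_le_right : V i ⊓ V j ≤ V j) (s j)) :
    ∃ t : Γ(F, U), ∀ i, res F (hV i) t = s i := by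
  obtain ⟨t, ht, -⟩ := TopCat.Sheaf.existsUnique_gluing' ⟨F.presheaf, F.isSheaf⟩ V U
    (fun i => homOfLE (hV i)) (fun x hx => by
      obtain ⟨i, hi⟩ := hU x hx
      exact Opens.mem_iSup.mpr ⟨i, hi⟩) s (fun i j => hs i j)
  exact ⟨t, ht⟩

/-- A local description of sections which is unique on small open subsets defines a section. -/
theorem exists_of_locally (F : X.Modules) (U : X.Opens)
    (p : ∀ V : X.Opens, V ≤ U → Γ(F, V) → Prop)
    (hres : ∀ (V W : X.Opens) (hV : V ≤ U) (h : W ≤ V) (s : Γ(F, V)), p V hV s →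
      p W (h.trans hV) (res F h s))
    (huniq : ∀ (V : X.Opens) (hV : V ≤ U) (s t : Γ(F, V)), p V hV s → p V hV t → s = t)
    (hex : ∀ x ∈ U, ∃ (V : X.Opens) (hV : V ≤ U) (s : Γ(F, V)), x ∈ V ∧ p V hV s) :
    ∃ t : Γ(F, U), ∀ x ∈ U, ∃ (V : X.Opens) (hV : V ≤ U), x ∈ V ∧ p V hV (res F hV t) := by
  choose V hV s hx hp using fun x : U => hex x.1 x.2
  obtain ⟨t, ht⟩ := exists_glue F V U hV (fun x hx' => ⟨⟨x, hx'⟩, hx _⟩) s (fun i j =>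
    huniq _ (inf_le_left.trans (hV i)) _ _ (hres _ _ (hV i) _ _ (hp i))
      (hres _ _ (hV j) _ _ (hp j)))
  exact ⟨t, fun x hx' => ⟨V ⟨x, hx'⟩, hV _, hx _, by rw [ht]; exact hp _⟩⟩

/-- Injectivity over every smaller open set makes local preimages unique, so they agree on overlaps
and glue. -/
theorem exists_preimage_of_locally {F G : X.Modules} (φ : F ⟶ G) (U : X.Opens)
    (hinj : ∀ V ≤ U, Function.Injective (φ.app V)) (t : Γ(G, U))
    (hsurj : ∀ x ∈ U, ∃ (V : X.Opens) (h : V ≤ U) (s : Γ(F, V)), x ∈ V ∧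
      φ.app V s = res G h t) : ∃ s, φ.app U s = t := by
  obtain ⟨s, hs⟩ := exists_of_locally F U (fun V hV s => φ.app V s = res G hV t)
    (fun V W hV h s e => by rw [← res_app, e, res_res])
    (fun V hV s s' e e' => hinj V hV (e.trans e'.symm)) (fun x hx => by
      obtain ⟨V, h, s, hxV, e⟩ := hsurj x hx
      exact ⟨V, h, s, hxV, e⟩)
  refine ⟨s, section_ext G fun x hx => ?_⟩
  obtain ⟨V, hV, hxV, e⟩ := hs x hx
  exact ⟨V, hV, hxV, by rw [res_app, e]⟩

/-- Local injectivity has to be treated first, on all opens below `W`: gluing the local preimages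
uses it. The bound `W` is kept because most maps here are isomorphisms only over some `D(g)`. -/
theorem bijective_of_locally {F G : X.Modules} (φ : F ⟶ G) (W : X.Opens)
    (hinj : ∀ U ≤ W, ∀ s : Γ(F, U), φ.app U s = 0 → ∀ x ∈ U,
      ∃ (V : X.Opens) (h : V ≤ U), x ∈ V ∧ res F h s = 0)
    (hsurj : ∀ U ≤ W, ∀ t : Γ(G, U), ∀ x ∈ U, ∃ (V : X.Opens) (h : V ≤ U) (s : Γ(F, V)), x ∈ V ∧
      φ.app V s = res G h t) : ∀ U ≤ W, Function.Bijective (φ.app U) := by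
  have h1 : ∀ U ≤ W, Function.Injective (φ.app U) := fun U hU => by
    refine (injective_iff_map_eq_zero (φ.app U).hom).mpr fun s hs => section_ext F fun x hx => ?_
    obtain ⟨V, h, hxV, e⟩ := hinj U hU s hs x hx
    exact ⟨V, h, hxV, by rw [e, map_zero]⟩
  exact fun U hU => ⟨h1 U hU, fun t =>
    exists_preimage_of_locally φ U (fun V hV => h1 V (hV.trans hU)) t (hsurj U hU t)⟩

theorem isIso_of_bijective {F G : X.Modules} (φ : F ⟶ G)
    (h : ∀ U, Function.Bijective (φ.app U)) : IsIso φ :=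
  Scheme.Modules.Hom.isIso_iff_isIso_app.mpr fun U =>
    (ConcreteCategory.isIso_iff_bijective (φ.app U)).mpr (h U)

theorem bijective_of_isIso {F G : X.Modules} (φ : F ⟶ G) [IsIso φ] (U : X.Opens) :
    Function.Bijective (φ.app U) :=
  (ConcreteCategory.isIso_iff_bijective (φ.app U)).mp inferInstance

end SheafGeneralities

/-! ### Sheafification of presheaves of modules, on sections -/

section Sheafification

variable {X : Scheme.{u}}

/-- Presheaves of modules over the structure sheaf. -/
abbrev PMod (X : Scheme.{u}) := PresheafOfModules.{u} (X.presheaf ⋙ forget₂ CommRingCat RingCat)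

/-- Restriction of sections of a presheaf of modules. -/
def pres (P : PMod X) {U V : X.Opens} (h : V ≤ U) : P.obj (op U) →+ P.obj (op V) :=
  (P.presheaf.map (homOfLE h).op).hom

theorem pres_app {P Q : PMod X} (φ : P ⟶ Q) {U V : X.Opens} (h : V ≤ U) (s : P.obj (op U)) :
    pres Q h ((φ.app (op U)).hom s) = (φ.app (op V)).hom (pres P h s) :=
  (PresheafOfModules.naturality_apply φ (homOfLE h).op s).symm

/-- The canonical map from a presheaf of modules to its sheafification, on sections. -/
def toSheafified (P : PMod X) (U : X.Opens) : P.obj (op U) →ₗ[Γ(X, U)] Γ((sheafifyMod X).obj P, U) :=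
  (((sheafifyModAdj X).unit.app P).app (op U)).hom

theorem res_toSheafified (P : PMod X) {U V : X.Opens} (h : V ≤ U) (s : P.obj (op U)) :
    res _ h (toSheafified P U s) = toSheafified P V (pres P h s) :=
  pres_app ((sheafifyModAdj X).unit.app P) h s

/-- Together with local surjectivity below, this is the only access needed to sections of a
sheafified tensor product. -/
theorem toSheafified_locally_injective (P : PMod X) (U : X.Opens) (s : P.obj (op U))
    (hs : toSheafified P U s = 0) (x : X) (hx : x ∈ U) :
    ∃ (V : X.Opens) (h : V ≤ U), x ∈ V ∧ pres P h s = 0 := by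
  have h1 : Presheaf.equalizerSieve (D := Ab.{u}) (F := P.presheaf) (X := op U) s (0 : P.obj (op U)) ∈
      Opens.grothendieckTopology X U :=
    Presheaf.equalizerSieve_mem (Opens.grothendieckTopology X)
      (CategoryTheory.toSheafify (Opens.grothendieckTopology X) P.presheaf) (X := op U) s (0 : P.obj (op U)) (by
      refine Eq.trans ?_ (map_zero _).symm
      exact hs)
  obtain ⟨V, f, hf, hxV⟩ := h1 x hx
  exact ⟨V, leOfHom f, hxV, Eq.trans hf (map_zero _)⟩

theorem toSheafified_locally_surjective (P : PMod X) (U : X.Opens)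
    (t : Γ((sheafifyMod X).obj P, U)) (x : X) (hx : x ∈ U) :
    ∃ (V : X.Opens) (h : V ≤ U) (s : P.obj (op V)), x ∈ V ∧ toSheafified P V s = res _ h t := by
  have h1 := Presheaf.imageSieve_mem (Opens.grothendieckTopology X)
    (CategoryTheory.toSheafify (Opens.grothendieckTopology X) P.presheaf) (U := op U) t
  obtain ⟨V, f, ⟨s, hs⟩, hxV⟩ := h1 x hx
  exact ⟨V, leOfHom f, s, hxV, hs⟩

theorem sheafifyMod_map_app {P Q : PMod X} (φ : P ⟶ Q) (U : X.Opens) (s : P.obj (op U)) :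
    ((sheafifyMod X).map φ).app U (toSheafified P U s) =
      toSheafified Q U ((φ.app (op U)).hom s) := by
  have := (sheafifyModAdj X).unit.naturality φ
  exact (congrArg (fun ψ : P ⟶ (toPresheafMod X).obj ((sheafifyMod X).obj Q) =>
    (ψ.app (op U)).hom s) this).symm

theorem homEquiv_symm_app {P : PMod X} {G : X.Modules} (φ : P ⟶ (toPresheafMod X).obj G)
    (U : X.Opens) (s : P.obj (op U)) :
    (((sheafifyModAdj X).homEquiv P G).symm φ).app U (toSheafified P U s) =
      (φ.app (op U)).hom s := by
  have := ((sheafifyModAdj X).homEquiv P G).apply_symm_apply φ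
  rw [Adjunction.homEquiv_unit] at this
  exact (congrArg (fun ψ : P ⟶ (toPresheafMod X).obj G => (ψ.app (op U)).hom s) this)

/-- A section of the sheafification is locally the image of a presheaf section, and such an image
vanishes only if the presheaf section vanishes locally; so both halves of bijectivity pass from the
presheaf map to its sheafification, even when they are known only below `W`. -/
theorem sheafifyMod_map_bijective {P Q : PMod X} (φ : P ⟶ Q) (W : X.Opens)
    (h : ∀ V ≤ W, Function.Bijective (φ.app (op V)).hom) :
    ∀ V ≤ W, Function.Bijective (((sheafifyMod X).map φ).app V) := by
  refine bijective_of_locally _ W (fun U hU t ht x hx => ?_) (fun U hU t x hx => ?_)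
  · obtain ⟨V, hV, s, hxV, e⟩ := toSheafified_locally_surjective P U t x hx
    have h1 : toSheafified Q V ((φ.app (op V)).hom s) = 0 := by
      rw [← sheafifyMod_map_app, e, ← res_app, ht, map_zero]
    obtain ⟨V', hV', hxV', e'⟩ := toSheafified_locally_injective Q V _ h1 x hxV
    refine ⟨V', hV'.trans hV, hxV', ?_⟩
    rw [pres_app] at e'
    have := (h V' (hV'.trans (hV.trans hU))).1 (e'.trans (map_zero _).symm)
    rw [← res_res _ hV hV', ← e, res_toSheafified, this, map_zero]
  · obtain ⟨V, hV, s, hxV, e⟩ := toSheafified_locally_surjective Q U t x hx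
    obtain ⟨s', rfl⟩ := (h V (hV.trans hU)).2 s
    exact ⟨V, hV, toSheafified P V s', hxV, by rw [sheafifyMod_map_app, e]⟩

theorem homEquiv_symm_bijective {P : PMod X} {G : X.Modules} (φ : P ⟶ (toPresheafMod X).obj G)
    (W : X.Opens) (h : ∀ V ≤ W, Function.Bijective (φ.app (op V)).hom) :
    ∀ V ≤ W, Function.Bijective ((((sheafifyModAdj X).homEquiv P G).symm φ).app V) := by
  refine bijective_of_locally _ W (fun U hU t ht x hx => ?_) (fun U hU t x hx => ?_)
  · obtain ⟨V, hV, s, hxV, e⟩ := toSheafified_locally_surjective P U t x hx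
    have h1 : (φ.app (op V)).hom s = 0 := by
      rw [← homEquiv_symm_app, e, ← res_app, ht]
      exact map_zero _
    have := (h V (hV.trans hU)).1 (h1.trans (map_zero _).symm)
    exact ⟨V, hV, hxV, by rw [← e, this, map_zero]⟩
  · obtain ⟨s, hs⟩ := (h U hU).2 t
    exact ⟨U, le_rfl, toSheafified P U s, hx, by rw [homEquiv_symm_app, res_self, hs]⟩

end Sheafification

/-! ### Homogeneous components and basic open sets -/

section HomogeneousElements

variable {A : Type u} [CommRing A] {𝒜 : ℤ → AddSubgroup A}

theorem proj_smul_of_mem [GradedRing 𝒜] (M : GrMod 𝒜) {k : ℤ} {m : M.carrier} (hm : m ∈ M.deg k)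
    (a : A) (i : ℤ) :
    M.proj (i + k) (a • m) = (DirectSum.decompose 𝒜 a i : A) • m := by
  classical
  conv_lhs => rw [← DirectSum.sum_support_decompose 𝒜 a, Finset.sum_smul, map_sum]
  rw [Finset.sum_eq_single i]
  · exact M.proj_same _ (M.smul_mem (SetLike.coe_mem _) hm)
  · intro j _ hj
    exact M.proj_ne (fun h => hj (by omega)) (M.smul_mem (SetLike.coe_mem _) hm)
  · intro hi
    rw [DFinsupp.notMem_support_iff.mp hi]
    simp

variable [GradedRing 𝒜]

theorem coe_decompose_nonnegGrading (b : nonneg 𝒜) (n : ℕ) :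
    ((DirectSum.decompose (nonnegGrading 𝒜) b n : nonneg 𝒜) : A) =
      DirectSum.decompose 𝒜 (b : A) (n : ℤ) := by
  classical
  conv_rhs => rw [← DirectSum.sum_support_decompose (nonnegGrading 𝒜) b]
  rw [AddSubmonoidClass.coe_finsetSum, DirectSum.decompose_sum, DFinsupp.finsetSum_apply,
    AddSubmonoidClass.coe_finsetSum]
  rw [Finset.sum_eq_single n]
  · exact (DirectSum.decompose_of_mem_same 𝒜 (SetLike.coe_mem
      (DirectSum.decompose (nonnegGrading 𝒜) b n) :)).symm
  · intro j _ hj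
    exact DirectSum.decompose_of_mem_ne 𝒜 (SetLike.coe_mem
      (DirectSum.decompose (nonnegGrading 𝒜) b j) :) (by exact_mod_cast hj)
  · intro hn
    rw [DFinsupp.notMem_support_iff.mp hn]
    simp

/-- Annihilators of homogeneous elements are homogeneous ideals: the component of `b • m` in degree
`n + k` is `b_n • m`. -/
theorem decompose_smul_eq_zero (M : GrMod 𝒜) {k : ℤ} {m : M.carrier} (hm : m ∈ M.deg k)
    {b : nonneg 𝒜} (hb : b • m = 0) (n : ℕ) :
    (DirectSum.decompose (nonnegGrading 𝒜) b n : nonneg 𝒜) • m = 0 := by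
  change ((DirectSum.decompose (nonnegGrading 𝒜) b n : nonneg 𝒜) : A) • m = 0
  rw [coe_decompose_nonnegGrading, ← proj_smul_of_mem M hm (b : A) n]
  exact (congrArg _ hb).trans (map_zero _)

theorem smul_mem_deg (M : GrMod 𝒜) {n : ℕ} {k l : ℤ} {b : nonneg 𝒜} {m : M.carrier}
    (hb : b ∈ nonnegGrading 𝒜 n) (hm : m ∈ M.deg k) (h : n + k = l) : b • m ∈ M.deg l :=
  h ▸ M.smul_mem hb hm

theorem mul_mem_nonnegGrading {m n k : ℕ} {a b : nonneg 𝒜} (ha : a ∈ nonnegGrading 𝒜 m)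
    (hb : b ∈ nonnegGrading 𝒜 n) (h : m + n = k) : a * b ∈ nonnegGrading 𝒜 k :=
  h ▸ SetLike.GradedMul.mul_mem ha hb

theorem pow_mem_nonnegGrading {m k : ℕ} {a : nonneg 𝒜} (ha : a ∈ nonnegGrading 𝒜 m) (n : ℕ)
    (h : n * m = k) : a ^ n ∈ nonnegGrading 𝒜 k := by
  rw [← h]
  exact SetLike.pow_mem_graded n ha

/-- The basic open subset `D(g)` of `Proj⁺(A)`. -/
abbrev basicOpen (g : nonneg 𝒜) : Opens (top 𝒜) :=
  ProjectiveSpectrum.basicOpen (nonnegGrading 𝒜) g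

theorem mem_basicOpen {g : nonneg 𝒜} {x : top 𝒜} : x ∈ basicOpen g ↔ g ∈ compl x := Iff.rfl

theorem exists_homogeneous_notMem {x : top 𝒜} {b : nonneg 𝒜} (hb : b ∈ compl x) :
    ∃ n : ℕ, (DirectSum.decompose (nonnegGrading 𝒜) b n : nonneg 𝒜) ∈ compl x := by
  classical
  by_contra! h
  refine hb ?_
  rw [← DirectSum.sum_support_decompose (nonnegGrading 𝒜) b]
  exact Ideal.sum_mem _ fun n _ => not_not.mp (h n)

/-- A point of `Proj` does not contain the irrelevant ideal, so some homogeneous element of positive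
degree is nonzero at it; its `d`-th power has degree divisible by `d`. -/
theorem exists_pos_degree_notMem (x : top 𝒜) (d : ℕ) :
    ∃ (n : ℕ) (h : nonneg 𝒜), 0 < n ∧ h ∈ nonnegGrading 𝒜 (d * n) ∧ h ∈ compl x := by
  classical
  obtain ⟨b, hb, hbx⟩ := SetLike.not_le_iff_exists.mp x.not_irrelevant_le
  obtain ⟨n, hn⟩ := exists_homogeneous_notMem (x := x) hbx
  have hn0 : 0 < n := by
    refine Nat.pos_of_ne_zero fun h => hn ?_
    subst h
    have : (DirectSum.decompose (nonnegGrading 𝒜) b 0 : nonneg 𝒜) = 0 :=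
      (HomogeneousIdeal.mem_irrelevant_iff _ _).mp hb
    rw [this]
    exact zero_mem _
  exact ⟨n, _, hn0, pow_mem_nonnegGrading (SetLike.coe_mem _) d rfl, pow_mem hn d⟩

/-- Start from any `D(b)` inside `U` and a component `b_k` nonzero at `x`. In `b_k ^ d * h` the
power makes the degree a multiple of `d`, and the factor `h` makes it positive. -/
theorem exists_basicOpen_le {d : ℕ} (hd : 0 < d) {U : Opens (top 𝒜)} {x : top 𝒜} (hx : x ∈ U) :
    ∃ (n : ℕ) (g : nonneg 𝒜), 0 < n ∧ g ∈ nonnegGrading 𝒜 (d * n) ∧ x ∈ basicOpen g ∧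
      basicOpen g ≤ U := by
  obtain ⟨_, ⟨b, rfl⟩, hxb, hbU⟩ :=
    (ProjectiveSpectrum.isTopologicalBasis_basic_opens (nonnegGrading 𝒜)).exists_subset_of_mem_open
      hx U.2
  obtain ⟨k, hk⟩ := exists_homogeneous_notMem (x := x) hxb
  obtain ⟨n, h, hn, hh, hhx⟩ := exists_pos_degree_notMem x d
  refine ⟨k + n, (DirectSum.decompose (nonnegGrading 𝒜) b k : nonneg 𝒜) ^ d * h, by omega,
    mul_mem_nonnegGrading (pow_mem_nonnegGrading (SetLike.coe_mem _) d rfl) hh (by ring),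
    mem_basicOpen.mpr (mul_mem (pow_mem hk d) hhx), fun y hy => hbU ?_⟩
  change b ∈ compl y
  have hy' : (DirectSum.decompose (nonnegGrading 𝒜) b k : nonneg 𝒜) ^ d * h ∈ compl y := hy
  intro hby
  refine hy' (Ideal.mul_mem_right _ _ (Ideal.pow_mem_of_mem _ ?_ d hd))
  exact y.asHomogeneousIdeal.isHomogeneous k hby

end HomogeneousElements

/-! ### Local fractions and maps with locally torsion kernel and cokernel -/

section Fractions

variable {A : Type u} [CommRing A] {𝒜 : ℤ → AddSubgroup A} [GradedRing 𝒜]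

theorem exists_homogeneous_smul_eq_zero {M : GrMod 𝒜} {x : top 𝒜} {k : ℤ} {m : M.carrier}
    (hm : m ∈ M.deg k) {b : nonneg 𝒜} (hb : b ∈ compl x) (h : b • m = 0) :
    ∃ (n : ℕ) (c : nonneg 𝒜), c ∈ nonnegGrading 𝒜 n ∧ c ∈ compl x ∧ c • m = 0 := by
  obtain ⟨n, hn⟩ := exists_homogeneous_notMem hb
  exact ⟨n, _, SetLike.coe_mem _, hn, decompose_smul_eq_zero M hm h n⟩

theorem loc_mk_eq_zero {M : GrMod 𝒜} {x : top 𝒜} {m : M.carrier} {s : compl x} :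
    (LocalizedModule.mk m s : Loc M x) = 0 ↔ ∃ b ∈ compl x, b • m = 0 := by
  rw [← LocalizedModule.zero_mk 1, LocalizedModule.mk_eq]
  constructor
  · rintro ⟨u, hu⟩
    refine ⟨u, u.2, ?_⟩
    simpa [Submonoid.smul_def] using hu
  · rintro ⟨b, hb, h⟩
    refine ⟨⟨b, hb⟩, ?_⟩
    simpa [Submonoid.smul_def] using h

/-- The section `m / s` of `M̃` over an open subset on which `s` does not vanish. -/
def fracSection (M : GrMod 𝒜) {n : ℕ} {m : M.carrier} (hm : m ∈ M.deg n) {s : nonneg 𝒜}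
    (hs : s ∈ nonnegGrading 𝒜 n) (V : Opens (top 𝒜)) (hV : V ≤ basicOpen s) : sections M V :=
  ⟨fun x => LocalizedModule.mk m ⟨s, hV x.2⟩, fun x => ⟨V, x.2, 𝟙 _, n, ⟨m, hm⟩, ⟨s, hs⟩,
    fun y => ⟨hV y.2, rfl⟩⟩⟩

/-- Restriction of sections of `M̃`. -/
def sectionsRes (M : GrMod 𝒜) {U V : Opens (top 𝒜)} (h : V ≤ U) (f : sections M U) :
    sections M V :=
  ⟨fun x => f.1 ⟨x.1, h x.2⟩, (isLocallyFraction M).res (homOfLE h) f.1 f.2⟩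

theorem exists_eq_fracSection (M : GrMod 𝒜) {U : Opens (top 𝒜)} (f : sections M U) (x : top 𝒜)
    (hx : x ∈ U) : ∃ (n : ℕ) (m : M.carrier) (hm : m ∈ M.deg n) (s : nonneg 𝒜)
      (hs : s ∈ nonnegGrading 𝒜 n) (V : Opens (top 𝒜)) (hV : V ≤ basicOpen s) (hVU : V ≤ U),
      x ∈ V ∧ sectionsRes M hVU f = fracSection M hm hs V hV := by
  obtain ⟨V, hxV, i, n, m, s, w⟩ := f.2 ⟨x, hx⟩
  refine ⟨n, m.1, m.2, s.1, s.2, V, fun y hy => (w ⟨y, hy⟩).1, leOfHom i, hxV,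
    Subtype.ext (funext fun y => (w y).2)⟩

/-- Locally, a section of `M̃` is a fraction with denominator of positive degree divisible by
`d`. -/
theorem exists_eq_fracSection_of_pos (M : GrMod 𝒜) {d : ℕ} (hd : 0 < d) {U : Opens (top 𝒜)}
    (f : sections M U) (x : top 𝒜) (hx : x ∈ U) : ∃ (n : ℕ) (_ : 0 < n) (m : M.carrier)
      (hm : m ∈ M.deg (d * n : ℕ)) (s : nonneg 𝒜) (hs : s ∈ nonnegGrading 𝒜 (d * n))
      (hsU : basicOpen s ≤ U),
      x ∈ basicOpen s ∧ sectionsRes M hsU f = fracSection M hm hs (basicOpen s) le_rfl := by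
  obtain ⟨n, m, hm, s, hs, V, hV, hVU, hxV, e⟩ := exists_eq_fracSection M f x hx
  obtain ⟨k, h, hk, hh, hxh, hhV⟩ := exists_basicOpen_le hd hxV
  have hle : basicOpen (s ^ d * h) ≤ V := fun y hy => hhV fun hy' =>
    hy (Ideal.mul_mem_left _ _ hy')
  have hd1 : d = d - 1 + 1 := by omega
  -- The fraction `m / s` is expanded by `s ^ (d - 1) * h`; the new denominator has degree `dn +
  -- dk`, positive since `k` is.
  refine ⟨n + k, by omega, (s ^ (d - 1) * h) • m, ?_, s ^ d * h,
    mul_mem_nonnegGrading (pow_mem_nonnegGrading hs d rfl) hh (by ring), hle.trans hVU,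
    mem_basicOpen.mpr (mul_mem (pow_mem (mem_basicOpen.mp (hV hxV)) d) hxh), Subtype.ext (funext fun y => ?_)⟩
  · refine smul_mem_deg M (mul_mem_nonnegGrading (pow_mem_nonnegGrading hs (d - 1) rfl) hh rfl) hm ?_
    rw [← Nat.cast_add, Nat.cast_inj]
    conv_rhs => rw [hd1]
    conv_lhs => rw [hd1, Nat.add_sub_cancel]
    ring
  · refine (congrFun (congrArg Subtype.val e) ⟨y.1, hle y.2⟩).trans ?_
    refine LocalizedModule.mk_eq.mpr ⟨1, ?_⟩
    simp only [one_smul, Submonoid.smul_def, smul_smul]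
    congr 1
    conv_lhs => rw [hd1]
    ring

theorem fracSection_eq_zero (M : GrMod 𝒜) {n : ℕ} {m : M.carrier} (hm : m ∈ M.deg n)
    {s : nonneg 𝒜} (hs : s ∈ nonnegGrading 𝒜 n) (V : Opens (top 𝒜)) (hV : V ≤ basicOpen s)
    {c : nonneg 𝒜} (hc : V ≤ basicOpen c) (h : c • m = 0) : fracSection M hm hs V hV = 0 :=
  Subtype.ext (funext fun x => loc_mk_eq_zero.mpr ⟨c, hc x.2, h⟩)

/-- The kernel is tested only on homogeneous `m` whose degree is also the degree of some `t` not
vanishing at `x`. This weak form is what torsion in degrees divisible by `d` can provide. -/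
theorem eq_zero_of_locMap_eq_zero {M N : GrMod 𝒜} (φ : M ⟶ N) {U : Opens (top 𝒜)}
    (s : sections M U) (x : U)
    (hker : ∀ (n : ℕ), ∀ m ∈ M.deg n, ∀ t ∈ nonnegGrading 𝒜 n, t ∈ compl x.1 →
      φ.toLin m = 0 → ∃ c ∈ compl x.1, c • m = 0)
    (hs : locMap φ x.1 (s.1 x) = 0) : s.1 x = 0 := by
  obtain ⟨n, m, hm, t, ht, V, hV, hVU, hyV, e⟩ := exists_eq_fracSection M s x.1 x.2
  have e1 : s.1 x = LocalizedModule.mk m ⟨t, hV hyV⟩ :=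
    congrFun (congrArg Subtype.val e) ⟨x.1, hyV⟩
  obtain ⟨b, hb, hbm⟩ := loc_mk_eq_zero.mp ((locMap_mk φ x.1 m ⟨t, hV hyV⟩).symm.trans
    ((congrArg (locMap φ x.1) e1).symm.trans hs))
  obtain ⟨k, c, hc, hcy, hcm⟩ := exists_homogeneous_smul_eq_zero (φ.map_deg hm) hb hbm
  -- `φ m` vanishes only after multiplication by `c`, so `m / t` is replaced by `c m / c t`, whose
  -- numerator is killed by `φ` and still has the degree of its denominator.
  obtain ⟨c', hc', hcm'⟩ := hker (k + n) (c • m) (smul_mem_deg M hc hm (by simp))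
    (c * t) (mul_mem_nonnegGrading hc ht rfl) (mul_mem hcy (hV hyV))
    ((φ.toLin.map_smul (c : A) m).trans hcm)
  refine e1.trans (loc_mk_eq_zero.mpr ⟨c' * c, mul_mem hc' hcy, ?_⟩)
  rw [mul_smul, hcm']

/-- A morphism of graded modules whose kernel and cokernel are locally torsion induces bijections
on the sections of the associated sheaves. -/
theorem tildeMap_bijective {M N : GrMod 𝒜} (φ : M ⟶ N) (W : Opens (top 𝒜))
    (hker : ∀ x ∈ W, ∀ (n : ℕ), ∀ m ∈ M.deg n, ∀ t ∈ nonnegGrading 𝒜 n, t ∈ compl x →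
      φ.toLin m = 0 → ∃ c ∈ compl x, c • m = 0)
    (hcoker : ∀ x ∈ W, ∀ (n : ℕ), ∀ m ∈ N.deg n, ∀ t ∈ nonnegGrading 𝒜 n, t ∈ compl x →
      ∃ (k : ℕ) (c : nonneg 𝒜) (m' : M.carrier), c ∈ nonnegGrading 𝒜 k ∧ c ∈ compl x ∧
        φ.toLin m' = c • m) :
    ∀ U ≤ W, Function.Bijective ((tildeMap φ).app U) := by
  refine bijective_of_locally (X := projPlus 𝒜) _ W (fun U hU s hs x hx => ?_)
    (fun U hU t x hx => ?_)
  · refine ⟨U, le_rfl, hx, ?_⟩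
    rw [res_self]
    exact Subtype.ext (funext fun y => eq_zero_of_locMap_eq_zero φ (show sections M U from s) y
      (hker y.1 (hU y.2)) (congrFun (congrArg Subtype.val hs) y))
  · obtain ⟨n, m, hm, s, hs, V, hV, hVU, hxV, e⟩ :=
      exists_eq_fracSection N (show sections N U from t) x hx
    obtain ⟨k, c, m', hc, hcx, h⟩ := hcoker x (hU hx) n m hm s hs (hV hxV)
    -- The preimage `m'` need not be homogeneous; since `c • m` is, of degree `k + n`, the component
    -- of `m'` in that degree is a preimage too.
    have h' : φ.toLin (M.proj (k + n : ℕ) m') = c • m := by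
      rw [GrMod.map_proj, h]
      exact N.proj_same _ (smul_mem_deg N hc hm (by simp))
    refine ⟨V ⊓ basicOpen c, inf_le_left.trans hVU, fracSection M (M.proj_mem (k + n : ℕ) m')
      (mul_mem_nonnegGrading hc hs rfl) _ (fun y hy => mul_mem (mem_basicOpen.mp hy.2) (hV hy.1)),
      ⟨hxV, hcx⟩, Subtype.ext (funext fun y => ?_)⟩
    refine Eq.trans ?_ (congrFun (congrArg Subtype.val e) ⟨y.1, y.2.1⟩).symm
    refine (locMap_mk φ y.1 _ _).trans ?_
    rw [h']
    refine LocalizedModule.mk_eq.mpr ⟨1, ?_⟩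
    simp only [one_smul, Submonoid.smul_def, smul_smul]
    congr 1
    ring

end Fractions

/-! ### Sections of the associated sheaf over `D(g)` -/

section BasicOpenSections

variable {A : Type u} [CommRing A] {𝒜 : ℤ → AddSubgroup A} [GradedRing 𝒜]

/-- `Proj` carries the topology induced from the Noetherian space `Spec A_{≥ 0}`. -/
theorem noetherianSpace_top [IsNoetherianRing (nonneg 𝒜)] : NoetherianSpace (top 𝒜) := by
  have h : Topology.IsInducing (fun x : ProjectiveSpectrum (nonnegGrading 𝒜) =>
      (⟨x.asHomogeneousIdeal.toIdeal, x.isPrime⟩ : PrimeSpectrum (nonneg 𝒜))) := by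
    refine ⟨TopologicalSpace.ext_iff_isClosed.mpr fun Z => ?_⟩
    rw [isClosed_induced_iff]
    constructor
    · intro hZ
      obtain ⟨s, rfl⟩ := (ProjectiveSpectrum.isClosed_iff_zeroLocus _ _).mp hZ
      exact ⟨_, PrimeSpectrum.isClosed_zeroLocus s, rfl⟩
    · rintro ⟨Z, hZ, rfl⟩
      obtain ⟨s, rfl⟩ := (PrimeSpectrum.isClosed_iff_zeroLocus _).mp hZ
      exact ProjectiveSpectrum.isClosed_zeroLocus _ s
  exact h.noetherianSpace

/-- A projective Nullstellensatz. The radical of a homogeneous ideal is the intersection of the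
homogeneous primes above it. Such a prime not containing `g` does not contain the irrelevant ideal,
as `g` has positive degree, so it is a point of `D(g)`. -/
theorem mem_radical_of_forall_exists {I : Ideal (nonneg 𝒜)}
    (hI : I.IsHomogeneous (nonnegGrading 𝒜)) {n : ℕ} (hn : 0 < n) {g : nonneg 𝒜}
    (hg : g ∈ nonnegGrading 𝒜 n) (h : ∀ x ∈ basicOpen g, ∃ b ∈ I, b ∈ compl x) :
    g ∈ I.radical := by
  rw [hI.radical_eq]
  refine (Submodule.mem_sInf).mpr fun J hJ => ?_
  obtain ⟨hJh, hIJ, hJp⟩ := hJ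
  by_contra hgJ
  have hg' : g ∈ HomogeneousIdeal.irrelevant (nonnegGrading 𝒜) := by
    rw [HomogeneousIdeal.mem_irrelevant_iff]
    exact DirectSum.decompose_of_mem_ne _ hg hn.ne'
  obtain ⟨b, hb, hbJ⟩ := h ⟨⟨J, hJh⟩, hJp, fun hle => hgJ (hle hg')⟩ hgJ
  exact hbJ (hIJ hb)

/-- The annihilator in `A_{≥ 0}` of an element of a graded module. -/
def annihilatorIdeal {M : GrMod 𝒜} (m : M.carrier) : Ideal (nonneg 𝒜) :=
  LinearMap.ker (LinearMap.toSpanSingleton (nonneg 𝒜) M.carrier m)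

/-- The Nullstellensatz applied to the annihilator of `m`, which is homogeneous: an element that is
torsion at every point of `D(g)` is killed by one power of `g`. -/
theorem exists_pow_smul_eq_zero {M : GrMod 𝒜} {k : ℤ} {m : M.carrier} (hm : m ∈ M.deg k) {n : ℕ}
    (hn : 0 < n) {g : nonneg 𝒜} (hg : g ∈ nonnegGrading 𝒜 n)
    (h : ∀ x ∈ basicOpen g, ∃ b ∈ compl x, b • m = 0) : ∃ l : ℕ, g ^ l • m = 0 := by
  have hI : (annihilatorIdeal m).IsHomogeneous (nonnegGrading 𝒜) := fun i b hb =>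
    decompose_smul_eq_zero M hm hb i
  exact mem_radical_of_forall_exists hI hn hg fun x hx => by
    obtain ⟨b, hb, hbm⟩ := h x hx
    exact ⟨b, hbm, hb⟩

theorem loc_smul_mk {M : GrMod 𝒜} {x : top 𝒜} (b : nonneg 𝒜) (m : M.carrier) (s : compl x) :
    b • (LocalizedModule.mk m s : Loc M x) = LocalizedModule.mk (b • m) s := by
  exact LocalizedModule.smul'_mk (S := compl x) b m s

/-- Sections of `M̃` over `D(g)`, for `g` homogeneous of positive degree, are fractions
with denominator a power of `g`. -/
theorem exists_pow_smul_eq_mk [IsNoetherianRing (nonneg 𝒜)] (M : GrMod 𝒜) {n : ℕ} (hn : 0 < n)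
    {g : nonneg 𝒜} (hg : g ∈ nonnegGrading 𝒜 n) {U : Opens (top 𝒜)} (hU : basicOpen g = U)
    (s : sections M U) :
    ∃ (k : ℕ) (m : M.carrier), m ∈ M.deg (k * n : ℕ) ∧
      ∀ x : U, g ^ k • s.1 x = (LocalizedModule.mk m 1 : Loc M x.1) := by
  classical
  subst hU
  have hnoeth : NoetherianSpace (top 𝒜) := noetherianSpace_top
  -- local expressions of `s` on a finite covering
  choose deg hdeg num hnum den hden hle hmem hs using fun x : basicOpen g =>
    exists_eq_fracSection_of_pos M one_pos s x.1 x.2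
  obtain ⟨T, hT⟩ := (NoetherianSpace.isCompact (basicOpen g : Set (top 𝒜))).elim_finite_subcover
    (fun x => (basicOpen (den x) : Set (top 𝒜))) (fun x => (basicOpen (den x)).2)
    (fun x hx => Set.mem_iUnion.mpr ⟨⟨x, hx⟩, hmem ⟨x, hx⟩⟩)
  have hT' : ∀ y ∈ basicOpen g, ∃ i ∈ T, y ∈ basicOpen (den i) := fun y hy => by
    simpa using hT hy
  have hval : ∀ i (y : basicOpen g) (hy : y.1 ∈ basicOpen (den i)),
      s.1 y = LocalizedModule.mk (num i) ⟨den i, hy⟩ := fun i y hy =>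
    congrFun (congrArg Subtype.val (hs i)) ⟨y.1, hy⟩
  -- compatibility of the local expressions
  have hcomp : ∀ i j, ∃ K : ℕ,
      (den i * den j) ^ K • (den j • num i - den i • num j) = 0 := fun i j => by
    refine exists_pow_smul_eq_zero (k := ((1 * deg j + 1 * deg i : ℕ) : ℤ)) (sub_mem
      (smul_mem_deg M (hden j) (hnum i) (by push_cast; ring))
      (smul_mem_deg M (hden i) (hnum j) (by push_cast; ring)))
      (n := 1 * deg i + 1 * deg j) (by have := hdeg i; omega)
      (mul_mem_nonnegGrading (hden i) (hden j) rfl) fun y hy => ?_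
    have hyi : y ∈ basicOpen (den i) := fun h => hy (Ideal.mul_mem_right _ _ h)
    have hyj : y ∈ basicOpen (den j) := fun h => hy (Ideal.mul_mem_left _ _ h)
    obtain ⟨u, hu⟩ := LocalizedModule.mk_eq.mp
      ((hval i ⟨y, hle i hyi⟩ hyi).symm.trans (hval j ⟨y, hle i hyi⟩ hyj))
    refine ⟨u, u.2, ?_⟩
    rw [smul_sub, sub_eq_zero]
    exact hu
  choose K hK using hcomp
  obtain ⟨N, hN⟩ : ∃ N, ∀ i ∈ T, ∀ j ∈ T, K i j ≤ N :=
    ⟨T.sup fun i => T.sup fun j => K i j, fun i hi j hj =>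
      (Finset.le_sup (f := fun j => K i j) hj).trans
        (Finset.le_sup (f := fun i => T.sup fun j => K i j) hi)⟩
  -- With a uniform `N`, the fractions rewritten as `den ^ N num / den ^ (N + 1)` cross-multiply to
  -- exact equalities, without an auxiliary factor.
  have hcomp' : ∀ i ∈ T, ∀ j ∈ T,
      den j ^ (N + 1) • den i ^ N • num i = den i ^ (N + 1) • den j ^ N • num j := by
    intro i hi j hj
    have h1 : (den i * den j) ^ N • (den j • num i - den i • num j) = 0 := by
      rw [← Nat.sub_add_cancel (hN i hi j hj), pow_add, mul_smul, hK, smul_zero]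
    rw [smul_sub, sub_eq_zero, smul_smul, smul_smul] at h1
    rw [smul_smul, smul_smul]
    convert h1 using 2 <;> ring
  -- This holds on all of `D(g)` and not only on `D(den j)`: at a point of `D(den i)` it is the
  -- exact compatibility of the `i`-th and `j`-th fractions.
  have hden' : ∀ j ∈ T, ∀ y : basicOpen g, den j ^ (N + 1) • s.1 y =
      (LocalizedModule.mk (den j ^ N • num j) 1 : Loc M y.1) := by
    intro j hj y
    obtain ⟨i, hi, hyi⟩ := hT' y.1 y.2
    refine (congrArg (den j ^ (N + 1) • ·) (hval i y hyi)).trans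
      ((loc_smul_mk _ _ _).trans (LocalizedModule.mk_eq.mpr ⟨⟨den i, hyi⟩ ^ N, ?_⟩))
    have := hcomp' i hi j hj
    simp only [Submonoid.smul_def, SubmonoidClass.coe_pow, one_smul]
    rw [smul_comm, this]
    simp only [smul_smul, pow_succ, mul_assoc]
  -- a power of `g` is a combination of the denominators
  have hrad : g ∈ (Ideal.span (Set.range fun i : T => den i.1 ^ (N + 1))).radical := by
    refine mem_radical_of_forall_exists (Ideal.homogeneous_span _ _ ?_) hn hg fun y hy => ?_
    · rintro _ ⟨i, rfl⟩
      exact ⟨_, pow_mem_nonnegGrading (hden i.1) (N + 1) rfl⟩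
    · obtain ⟨i, hi, hyi⟩ := hT' y hy
      exact ⟨_, Ideal.subset_span ⟨⟨i, hi⟩, rfl⟩, pow_mem (mem_basicOpen.mp hyi) _⟩
  obtain ⟨k, hk⟩ := hrad
  obtain ⟨c, hc⟩ := Ideal.mem_span_range_iff_exists_fun.mp hk
  -- Only the component of `c i` complementary to the degree of `den i ^ (N + 1)` contributes in
  -- degree `k * n`. If the complementary degree would be negative the coefficient is `0`; the test
  -- is needed because subtraction in `ℕ` truncates.
  let c' : T → nonneg 𝒜 := fun i => if (N + 1) * (1 * deg i.1) ≤ k * n then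
    (DirectSum.decompose (nonnegGrading 𝒜) (c i) (k * n - (N + 1) * (1 * deg i.1)) : nonneg 𝒜)
    else 0
  have hc' : ∑ i, c' i * den i.1 ^ (N + 1) = g ^ k := by
    have h1 := congrArg (fun b => (DirectSum.decompose (nonnegGrading 𝒜) b (k * n) : nonneg 𝒜)) hc
    dsimp only at h1
    rw [DirectSum.decompose_sum, DFinsupp.finsetSum_apply, AddSubmonoidClass.coe_finsetSum,
      DirectSum.decompose_of_mem_same _ (pow_mem_nonnegGrading hg k rfl)] at h1
    rw [← h1]
    refine Finset.sum_congr rfl fun i _ => ?_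
    rw [DirectSum.coe_decompose_mul_of_right_mem _ _ (pow_mem_nonnegGrading (hden i.1) (N + 1) rfl)]
    simp only [c']
    split_ifs <;> simp
  refine ⟨k, ∑ i, c' i • den i.1 ^ N • num i.1, sum_mem fun i _ => ?_, fun y => ?_⟩
  · simp only [c']
    split_ifs with h
    · refine smul_mem_deg M (SetLike.coe_mem _) (smul_mem_deg M
        (pow_mem_nonnegGrading (hden i.1) N rfl) (hnum i.1) rfl) ?_
      rw [← Nat.cast_add, ← Nat.cast_add, Nat.cast_inj]
      have : (N + 1) * (1 * deg i.1) = N * (1 * deg i.1) + 1 * deg i.1 := by ring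
      omega
    · simp
  · rw [← hc', Finset.sum_smul]
    have h2 : ∀ i : T, (c' i * den i.1 ^ (N + 1)) • s.1 y =
        LocalizedModule.mkLinearMap (compl y.1) M.carrier (c' i • den i.1 ^ N • num i.1) :=
      fun i => by
        rw [mul_smul, hden' i.1 i.2 y]
        exact loc_smul_mk _ _ _
    rw [Finset.sum_congr rfl fun i _ => h2 i, ← map_sum]
    rfl

end BasicOpenSections

/-! ### A localization criterion for quasi-coherence -/

section QuasiCoherence

variable {X : Scheme.{u}}

/-- Restriction of functions. -/
abbrev rres {U V : X.Opens} (h : V ≤ U) (r : Γ(X, U)) : Γ(X, V) :=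
  X.presheaf.map (homOfLE h).op r

/-- Sections of `F` over `W` are the sections over `V` localized at the function `r` on a larger
open subset `U`. -/
structure IsLocalizingOn (F : X.Modules) {U V W : X.Opens} (hVU : V ≤ U) (hWV : W ≤ V)
    (r : Γ(X, U)) : Prop where
  exists_extension : ∀ s : Γ(F, W), ∃ (n : ℕ) (t : Γ(F, V)),
    res F hWV t = rres (hWV.trans hVU) r ^ n • s
  exists_pow_smul_eq_zero : ∀ t : Γ(F, V), res F hWV t = 0 → ∃ n : ℕ, rres hVU r ^ n • t = 0

theorem appIso_inv_ΓSpecIso_inv {U : X.Opens} (hU : IsAffineOpen U)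
    (V : (Spec Γ(X, U)).Opens) (h : hU.fromSpec ''ᵁ V ≤ U) (r : Γ(X, U)) :
    (hU.fromSpec.appIso V).inv ((Spec Γ(X, U)).presheaf.map V.leTop.op
      ((Scheme.ΓSpecIso Γ(X, U)).inv r)) = rres h r := by
  have h1 : X.presheaf.map (homOfLE h).op ≫ (hU.fromSpec.appIso V).hom =
      (Scheme.ΓSpecIso Γ(X, U)).inv ≫ (Spec Γ(X, U)).presheaf.map V.leTop.op := by
    rw [Scheme.Hom.appIso_hom', Scheme.Hom.map_appLE, Scheme.Hom.appLE, hU.fromSpec_app_self,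
      Category.assoc, ← Functor.map_comp]
    rfl
  have h2 : (hU.fromSpec.appIso V).hom (rres h r) = (Spec Γ(X, U)).presheaf.map V.leTop.op
      ((Scheme.ΓSpecIso Γ(X, U)).inv r) := ConcreteCategory.congr_hom h1 r
  rw [← h2]
  exact ConcreteCategory.congr_hom (hU.fromSpec.appIso V).hom_inv_id _

theorem smul_restrict_fromSpec (F : X.Modules) {U : X.Opens} (hU : IsAffineOpen U)
    (V : (Spec Γ(X, U)).Opens) (h : hU.fromSpec ''ᵁ V ≤ U) (r : Γ(X, U))
    (s : Γ(F.restrict hU.fromSpec, V)) :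
    (F.restrictAppIso hU.fromSpec V).hom (r • s) =
      rres h r • (F.restrictAppIso hU.fromSpec V).hom s := by
  rw [Scheme.Modules.smul_Spec_def, ← appIso_inv_ΓSpecIso_inv hU V h r]
  rfl

theorem isLocalizingOn_congr {F : X.Modules} {U V W V' W' : X.Opens} {hVU : V ≤ U} {hWV : W ≤ V}
    {r : Γ(X, U)} (H : IsLocalizingOn F hVU hWV r) (hV : V = V') (hW : W = W')
    (hVU' : V' ≤ U) (hWV' : W' ≤ V') : IsLocalizingOn F hVU' hWV' r := by
  subst hV hW
  exact H

theorem fromSpec_image_le {U : X.Opens} (hU : IsAffineOpen U) (V : (Spec Γ(X, U)).Opens) :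
    hU.fromSpec ''ᵁ V ≤ U :=
  (Scheme.Hom.image_mono _ le_top).trans (by
    rw [Scheme.Hom.image_top_eq_opensRange, hU.opensRange_fromSpec])

/-- After transport to `Spec Γ(X, U)`, the two conditions are the surjectivity and injectivity parts
of being a localization at the powers of `r`. The third part, that `r` acts invertibly over `D(r)`,
is automatic. -/
theorem isLocalizingOn_iff (F : X.Modules) {U : X.Opens} (hU : IsAffineOpen U) (r : Γ(X, U)) :
    IsLocalizingOn F le_rfl (X.basicOpen_le r) r ↔
      IsLocalizedModule (.powers r) ((modulesSpecToSheaf.obj (F.restrict hU.fromSpec)).obj.map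
        (PrimeSpectrum.basicOpen r).leTop.op).hom := by
  have e1 : hU.fromSpec ''ᵁ ⊤ = U := by
    rw [Scheme.Hom.image_top_eq_opensRange, hU.opensRange_fromSpec]
  have e2 : hU.fromSpec ''ᵁ (PrimeSpectrum.basicOpen r) = X.basicOpen r :=
    hU.fromSpec_image_basicOpen r
  have hle : hU.fromSpec ''ᵁ (PrimeSpectrum.basicOpen r) ≤ hU.fromSpec ''ᵁ ⊤ :=
    Scheme.Hom.image_mono _ le_top
  have hsmul : ∀ (V : (Spec Γ(X, U)).Opens) (n : ℕ) (s : Γ(F.restrict hU.fromSpec, V)),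
      (r ^ n • s : Γ(F.restrict hU.fromSpec, V)) =
        (show Γ(F, hU.fromSpec ''ᵁ V) from rres (fromSpec_image_le hU V) r ^ n •
          (show Γ(F, hU.fromSpec ''ᵁ V) from s)) := fun V n s =>
    (smul_restrict_fromSpec F hU V (fromSpec_image_le hU V) (r ^ n) s).trans
      (congrArg (· • (F.restrictAppIso hU.fromSpec V).hom s)
        (map_pow (X.presheaf.map (homOfLE (fromSpec_image_le hU V)).op).hom r n))
  constructor
  · intro H
    have H' := isLocalizingOn_congr H e1.symm e2.symm e1.le hle
    refine IsLocalizedModule.Away.mk_of_addCommGroup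
      (Scheme.Modules.isUnit_algebraMap_end_of_le_basicOpen r le_rfl) (fun s => ?_) (fun t ht => ?_)
    · obtain ⟨n, t, ht⟩ := H'.exists_extension s
      exact ⟨n, t, (hsmul _ n s).trans ht.symm⟩
    · obtain ⟨n, hn⟩ := H'.exists_pow_smul_eq_zero t ht
      exact ⟨n, (hsmul _ n t).trans hn⟩
  · intro H
    refine isLocalizingOn_congr (F := F) (hVU := e1.le) (hWV := hle) ⟨fun s => ?_, fun t ht => ?_⟩
      e1 e2 _ _
    · obtain ⟨⟨t, _, n, rfl⟩, e⟩ := H.surj s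
      exact ⟨n, t, e.symm.trans (hsmul _ n s)⟩
    · obtain ⟨⟨_, n, rfl⟩, hn⟩ := (IsLocalizedModule.eq_zero_iff (.powers r)
        ((modulesSpecToSheaf.obj (F.restrict hU.fromSpec)).obj.map
          (PrimeSpectrum.basicOpen r).leTop.op).hom).mp ht
      exact ⟨n, (hsmul _ n t).symm.trans hn⟩

theorem isLocalizingOn_of_isQuasicoherent (F : X.Modules) (hF : isQCoh X F) {U : X.Opens}
    (hU : IsAffineOpen U) (r : Γ(X, U)) : IsLocalizingOn F le_rfl (X.basicOpen_le r) r := by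
  have : F.IsQuasicoherent := hF
  exact (isLocalizingOn_iff F hU r).mpr
    ((isIso_fromTildeΓ_iff_isLocalizing (F.restrict hU.fromSpec)).mp inferInstance r)

/-- If sections localize correctly for all `r`, the restriction of `F` to `Spec Γ(X, U)` is the
sheaf associated with its global sections, hence has a presentation. The presentation is then
carried along `U ≅ Spec Γ(X, U)` and to the site of opens over `U`. -/
theorem exists_presentation_over (F : X.Modules) {U : X.Opens} (hU : IsAffineOpen U)
    (H : ∀ r : Γ(X, U), IsLocalizingOn F le_rfl (X.basicOpen_le r) r) :
    Nonempty (SheafOfModules.Presentation (SheafOfModules.over F U)) := by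
  have h1 : IsIso (F.restrict hU.fromSpec).fromTildeΓ :=
    (isIso_fromTildeΓ_iff_isLocalizing _).mpr fun r => (isLocalizingOn_iff F hU r).mp (H r)
  let p1 : SheafOfModules.Presentation (F.restrict hU.fromSpec) :=
    @SheafOfModules.Presentation.ofIsIso.{u, u, u} _ _ _ _ _ _ _ _
      (F.restrict hU.fromSpec).fromTildeΓ h1
      (presentationTilde.{u} _ .univ (by simp) _ (Submodule.span_eq _))
  let p2 : SheafOfModules.Presentation ((F.restrict hU.fromSpec).restrict hU.isoSpec.hom) :=
    Scheme.Modules.presentationRestrict hU.isoSpec.hom p1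
  let iso : Scheme.Modules.restrictFunctor hU.fromSpec ⋙
      Scheme.Modules.restrictFunctor hU.isoSpec.hom ≅ Scheme.Modules.restrictFunctor U.ι :=
    (Scheme.Modules.restrictFunctorComp _ _).symm ≪≫
      Scheme.Modules.restrictFunctorCongr hU.isoSpec_hom_fromSpec
  let p3 : SheafOfModules.Presentation (F.restrict U.ι) :=
    @SheafOfModules.Presentation.ofIsIso.{u, u, u} _ _ _ _ _ _ _ _ (iso.app F).hom
      (iso.app F).isIso_hom p2
  let e := U.sheafOfModulesEquivOver X.ringCatSheaf
  have hp : Limits.PreservesColimitsOfSize.{u, u} e.inverse :=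
    e.symm.toAdjunction.leftAdjoint_preservesColimits
  let p4 : SheafOfModules.Presentation (e.inverse.obj (F.restrict U.ι)) :=
    @SheafOfModules.Presentation.map.{u, u, u, u, u} _ _ _ _ _ _ _ _ _ _ _ _ _ p3 e.inverse hp
      (U.sheafOfModulesEquivOverInverseUnit X.ringCatSheaf).symm
  let j : e.inverse.obj (F.restrict U.ι) ≅ SheafOfModules.over F U :=
    e.inverse.mapIso ((Scheme.Modules.overFunctorEquiv U).symm.app F) ≪≫
      (e.unitIso.app _).symm
  exact ⟨SheafOfModules.Presentation.ofIsIso j.hom p4⟩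

theorem isQuasicoherent_of_isLocalizingOn (F : X.Modules)
    (H : ∀ x : X, ∃ U : X.Opens, x ∈ U ∧ IsAffineOpen U ∧
      ∀ r : Γ(X, U), IsLocalizingOn F le_rfl (X.basicOpen_le r) r) : isQCoh X F := by
  choose U hxU hU hr using H
  have hcov : (Opens.grothendieckTopology X).CoversTop U := by
    rw [Opens.coversTop_iff]
    exact top_unique fun x _ => Opens.mem_iSup.mpr ⟨x, hxU x⟩
  let q : SheafOfModules.QuasicoherentData.{u, u, u, u} (show SheafOfModules.{u} X.ringCatSheaf from F) :=
    { I := (X : Type u)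
      X := U
      coversTop := hcov
      presentation := fun x => (exists_presentation_over F (hU x) (hr x)).some }
  exact q.isQuasicoherent

end QuasiCoherence

/-! ### Functions on `Proj⁺(A)` as sections of `Ã(0)` -/

section StructureSheaf

variable {A : Type u} [CommRing A] {𝒜 : ℤ → AddSubgroup A} [GradedRing 𝒜]

theorem loc_smul_cancel {M : GrMod 𝒜} {x : top 𝒜} {b : nonneg 𝒜} (hb : b ∈ compl x)
    {z z' : Loc M x} (h : b • z = b • z') : z = z' := by
  have hu : IsUnit (algebraMap (nonneg 𝒜) (Localization (compl x)) b) :=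
    IsLocalization.map_units (Localization (compl x)) (⟨b, hb⟩ : compl x)
  rw [← algebraMap_smul (Localization (compl x)) b z,
    ← algebraMap_smul (Localization (compl x)) b z'] at h
  exact hu.smul_left_cancel.mp h

theorem loc_mk_smul {M : GrMod 𝒜} {x : top 𝒜} {b : nonneg 𝒜} (hb : b ∈ compl x) (m : M.carrier) :
    b • (LocalizedModule.mk m ⟨b, hb⟩ : Loc M x) = LocalizedModule.mk m 1 := by
  rw [loc_smul_mk]
  exact LocalizedModule.mk_cancel (S := compl x) ⟨b, hb⟩ m

/-- An element of `A`, as an element of `A(i)`. -/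
def GrMod.toTwist (𝒜 : ℤ → AddSubgroup A) [GradedRing 𝒜] (i : ℤ) (a : A) :
    (GrMod.twist 𝒜 i).carrier := a

theorem GrMod.smul_toTwist (i : ℤ) (b : nonneg 𝒜) (a : A) :
    b • GrMod.toTwist 𝒜 i a = GrMod.toTwist 𝒜 i (b * a) := rfl

/-- The unit section of `Ã(0)`. -/
def oneSection (𝒜 : ℤ → AddSubgroup A) [GradedRing 𝒜] (U : Opens (top 𝒜)) :
    sections (GrMod.twist 𝒜 0) U :=
  fracSection (GrMod.twist 𝒜 0) (n := 0) (m := GrMod.toTwist 𝒜 0 1)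
    (SetLike.GradedOne.one_mem : (1 : A) ∈ 𝒜 0) (SetLike.GradedOne.one_mem : 1 ∈ nonnegGrading 𝒜 0) U
    fun _ _ => one_mem (compl _)

/-- `A_{≥ 0}` is a subring of `A`, so an equality of fractions witnessed in `A` is already an
equality in the localization of `A_{≥ 0}`. -/
theorem loc_smul_one_injective (x : ProjectiveSpectrum (nonnegGrading 𝒜)) {c c' : Localization (compl x)}
    (h : c • (LocalizedModule.mk (GrMod.toTwist 𝒜 0 1) 1 : Loc (GrMod.twist 𝒜 0) x) =
      c' • (LocalizedModule.mk (GrMod.toTwist 𝒜 0 1) 1 : Loc (GrMod.twist 𝒜 0) x)) : c = c' := by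
  induction c using Localization.induction_on with
  | H c =>
    induction c' using Localization.induction_on with
    | H c' =>
      rw [LocalizedModule.mk_smul_mk, LocalizedModule.mk_smul_mk, LocalizedModule.mk_eq] at h
      obtain ⟨u, hu⟩ := h
      refine Localization.mk_eq_mk_iff.mpr (Localization.r_iff_exists.mpr ⟨u, Subtype.ext ?_⟩)
      have hu' : (u.1 : A) * ((c'.2.1 * 1 : nonneg 𝒜) * (((c.1 : nonneg 𝒜) : A) * 1)) =
        u.1 * ((c.2.1 * 1 : nonneg 𝒜) * (((c'.1 : nonneg 𝒜) : A) * 1)) := hu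
      simpa using hu'

/-- The identification of functions with sections of `Ã(0)`. -/
theorem smul_oneSection_bijective (U : Opens (top 𝒜)) :
    Function.Bijective fun r : structureSections 𝒜 U => r • oneSection 𝒜 U := by
  have hinj : ∀ x : ProjectiveSpectrum (nonnegGrading 𝒜), Function.Injective
      fun z : HomogeneousLocalization.AtPrime (nonnegGrading 𝒜) x.asHomogeneousIdeal.toIdeal =>
        z.val • (LocalizedModule.mk (GrMod.toTwist 𝒜 0 1) 1 : Loc (GrMod.twist 𝒜 0) x) := fun x z z' h =>
    HomogeneousLocalization.val_injective _ (loc_smul_one_injective x h)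
  have hfrac : ∀ (x : ProjectiveSpectrum (nonnegGrading 𝒜)) (n : ℕ) (m s : nonneg 𝒜) (hm : m ∈ nonnegGrading 𝒜 n)
      (hs : s ∈ nonnegGrading 𝒜 n) (hsx : s ∈ compl x),
      (HomogeneousLocalization.mk ⟨n, ⟨m, hm⟩, ⟨s, hs⟩, hsx⟩ : HomogeneousLocalization.AtPrime
        (nonnegGrading 𝒜) x.asHomogeneousIdeal.toIdeal).val •
        (LocalizedModule.mk (GrMod.toTwist 𝒜 0 1) 1 : Loc (GrMod.twist 𝒜 0) x) =
      LocalizedModule.mk (GrMod.toTwist 𝒜 0 m) ⟨s, hsx⟩ := fun x n m s hm hs hsx => by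
    rw [HomogeneousLocalization.val_mk, LocalizedModule.mk_smul_mk, mul_one,
      GrMod.smul_toTwist, mul_one]
  refine ⟨fun r r' h => Subtype.ext (funext fun x => hinj x.1
    (congrFun (congrArg Subtype.val h) x)), fun f => ?_⟩
  have hloc : ∀ x : U, ∃ (V : Opens (top 𝒜)) (_ : x.1 ∈ V) (hVU : V ≤ U) (n : ℕ)
      (a s : nonnegGrading 𝒜 n), ∀ (y : ProjectiveSpectrum (nonnegGrading 𝒜)) (hy : y ∈ V),
        ∃ hs : s.1 ∈ compl y,
        (HomogeneousLocalization.mk ⟨n, a, s, hs⟩ : HomogeneousLocalization.AtPrime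
          (nonnegGrading 𝒜) y.asHomogeneousIdeal.toIdeal).val •
          (LocalizedModule.mk (GrMod.toTwist 𝒜 0 1) 1 : Loc (GrMod.twist 𝒜 0) y) = f.1 ⟨y, hVU hy⟩ := by
    intro x
    obtain ⟨n, m, hm, s, hs, V, hV, hVU, hxV, e⟩ := exists_eq_fracSection _ f x.1 x.2
    -- The numerator has the degree `n ≥ 0` of its denominator, so it lies in `A_{≥ 0}` and the
    -- fraction is a function.
    have hm' : (m : A) ∈ 𝒜 n := by
      have : (m : A) ∈ 𝒜 (n + 0) := hm
      rwa [add_zero] at this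
    refine ⟨V, hxV, hVU, n, ⟨⟨m, mem_supportedSubring_of_mem 𝒜 (n := (n : ℤ)) (by simp) hm'⟩, hm'⟩,
      ⟨s, hs⟩, fun y hy => ⟨hV hy, ?_⟩⟩
    exact (hfrac _ _ _ _ _ _ _).trans (congrFun (congrArg Subtype.val e) ⟨y, hy⟩).symm
  have hex : ∀ (x : ProjectiveSpectrum (nonnegGrading 𝒜)) (hx : x ∈ U),
      ∃ z : HomogeneousLocalization.AtPrime (nonnegGrading 𝒜) x.asHomogeneousIdeal.toIdeal,
      z.val • (LocalizedModule.mk (GrMod.toTwist 𝒜 0 1) 1 : Loc (GrMod.twist 𝒜 0) x) = f.1 ⟨x, hx⟩ :=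
    fun x hxU => by
      obtain ⟨V, hx, hVU, n, a, s, h⟩ := hloc ⟨x, hxU⟩
      obtain ⟨hs, e⟩ := h x hx
      exact ⟨_, e⟩
  -- The values chosen pointwise are unique by `hinj`, hence agree near each point with the local
  -- fraction and form a section of the structure sheaf.
  choose z hz using hex
  refine ⟨⟨fun x => z x.1 x.2, fun x => ?_⟩, Subtype.ext (funext fun x => hz x.1 x.2)⟩
  obtain ⟨V, hx, hVU, n, a, s, h⟩ := hloc x
  refine ⟨V, hx, homOfLE hVU, n, a, s, fun y => (h y.1 y.2).1, fun y => ?_⟩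
  exact hinj y.1 ((hz _ _).trans (h y.1 y.2).2.symm)

/-- Functions on `D(g)` are fractions `a / g ^ k`: the description of sections over `D(g)` is
applied to the section `r • 1` of `Ã(0)`. -/
theorem exists_pow_smul_val_eq [IsNoetherianRing (nonneg 𝒜)] {n : ℕ} (hn : 0 < n)
    {g : nonneg 𝒜} (hg : g ∈ nonnegGrading 𝒜 n) (r : structureSections 𝒜 (basicOpen g)) :
    ∃ (k : ℕ) (a : nonneg 𝒜), a ∈ nonnegGrading 𝒜 (k * n) ∧ ∀ x : basicOpen g,
      algebraMap (nonneg 𝒜) (Localization (compl x.1)) g ^ k * (r.1 x).val =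
        algebraMap (nonneg 𝒜) (Localization (compl x.1)) a := by
  obtain ⟨k, a, ha, h⟩ := exists_pow_smul_eq_mk (GrMod.twist 𝒜 0) hn hg rfl
    (r • oneSection 𝒜 (basicOpen g))
  have ha' : (a : A) ∈ 𝒜 (k * n : ℕ) := by
    have : (a : A) ∈ 𝒜 ((k * n : ℕ) + 0) := ha
    rwa [add_zero] at this
  refine ⟨k, ⟨a, mem_supportedSubring_of_mem 𝒜 (n := ((k * n : ℕ) : ℤ))
    (Int.natCast_nonneg _) ha'⟩, ha', fun x => ?_⟩
  refine loc_smul_one_injective x.1 (Eq.trans ?_ ((h x).trans ?_))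
  · rw [mul_smul, ← map_pow]
    exact algebraMap_smul (Localization (compl x.1)) (g ^ k) _
  · refine Eq.trans ?_ (algebraMap_smul (Localization (compl x.1)) _ _).symm
    refine Eq.trans ?_ (loc_smul_mk _ _ _).symm
    exact congrArg (fun a : A => (LocalizedModule.mk (GrMod.toTwist 𝒜 0 a) 1 :
      Loc (GrMod.twist 𝒜 0) x.1)) (mul_one (show A from a)).symm

theorem mem_scheme_basicOpen {U : Opens (top 𝒜)} (r : structureSections 𝒜 U)
    (x : ProjectiveSpectrum (nonnegGrading 𝒜)) :
    (show projPlus 𝒜 from x) ∈ (projPlus 𝒜).basicOpen (U := U) r ↔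
      ∃ hx : x ∈ U, IsUnit (r.1 ⟨x, hx⟩).val := by
  refine (Scheme.mem_basicOpen'' (X := projPlus 𝒜) (U := U) r x).trans
    (exists_congr fun hx => ?_)
  refine (MulEquiv.isUnit_map (Proj.stalkIso' (nonnegGrading 𝒜) x)).symm.trans
    (Iff.trans ?_ (HomogeneousLocalization.isUnit_iff_isUnit_val (𝒜 := nonnegGrading 𝒜)
      (𝔭 := x.asHomogeneousIdeal.toIdeal) _).symm)
  exact iff_of_eq (congrArg IsUnit (Proj.stalkIso'_germ (nonnegGrading 𝒜) U x hx r))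

theorem isUnit_algebraMap_iff (x : ProjectiveSpectrum (nonnegGrading 𝒜)) (b : nonneg 𝒜) :
    IsUnit (algebraMap (nonneg 𝒜) (Localization (compl x)) b) ↔ b ∈ compl x :=
  IsLocalization.AtPrime.isUnit_to_map_iff (Localization (compl x))
    x.asHomogeneousIdeal.toIdeal b

/-- Here `ρ = a / g ^ k`, so `g ^ (k + 1) ρ = g a`. The extra factor `g` is included because the
open set where `ρ` is invertible will be `D(g a)`. -/
theorem pow_smul_val_pow_smul {M : GrMod 𝒜} {x : ProjectiveSpectrum (nonnegGrading 𝒜)}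
    {g a : nonneg 𝒜} {k : ℕ} {ρ : Localization (compl x)}
    (h : algebraMap (nonneg 𝒜) (Localization (compl x)) g ^ k * ρ = algebraMap (nonneg 𝒜) _ a)
    (l : ℕ) (z : Loc M x) : g ^ ((k + 1) * l) • (ρ ^ l • z) = (g * a) ^ l • z := by
  rw [← algebraMap_smul (Localization (compl x)) (g ^ ((k + 1) * l)),
    ← algebraMap_smul (Localization (compl x)) ((g * a) ^ l), smul_smul, map_pow, map_pow,
    map_mul, ← h]
  congr 1
  ring

end StructureSheaf

/-! ### Quasi-coherence of the sheaves `M̃` -/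

section QuasiCoherence

variable {A : Type u} [CommRing A] {𝒜 : ℤ → AddSubgroup A} [GradedRing 𝒜]

theorem val_pow_apply {U : Opens (top 𝒜)} (r : structureSections 𝒜 U) (l : ℕ)
    (x : ProjectiveSpectrum (nonnegGrading 𝒜)) (hx : x ∈ U) :
    ((r ^ l).1 ⟨x, hx⟩).val = (r.1 ⟨x, hx⟩).val ^ l :=
  HomogeneousLocalization.val_pow _ l

theorem scheme_basicOpen_eq {g a : nonneg 𝒜} {k : ℕ}
    (r : structureSections 𝒜 (basicOpen g)) (h : ∀ x : basicOpen g,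
      algebraMap (nonneg 𝒜) (Localization (compl x.1)) g ^ k * (r.1 x).val =
        algebraMap (nonneg 𝒜) (Localization (compl x.1)) a) :
    basicOpen (g * a) = (projPlus 𝒜).basicOpen (U := basicOpen g) r := by
  refine TopologicalSpace.Opens.ext (Set.ext fun x => ?_)
  refine Iff.trans ?_ (mem_scheme_basicOpen r x).symm
  refine ⟨fun hx => ?_, fun ⟨hx, hu⟩ => ?_⟩
  · have hx' : g * a ∈ compl (𝒜 := 𝒜) x := mem_basicOpen.mp hx
    have hg : g ∈ compl (𝒜 := 𝒜) x := fun h' => hx' (Ideal.mul_mem_right _ _ h')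
    have ha : a ∈ compl (𝒜 := 𝒜) x := fun h' => hx' (Ideal.mul_mem_left _ _ h')
    refine ⟨mem_basicOpen.mpr hg, ?_⟩
    have hu := (isUnit_algebraMap_iff _ _).mpr ha
    rw [← h ⟨x, mem_basicOpen.mpr hg⟩] at hu
    exact isUnit_of_mul_isUnit_right hu
  · have hg : g ∈ compl (𝒜 := 𝒜) x := mem_basicOpen.mp hx
    refine mem_basicOpen.mpr (mul_mem hg ((isUnit_algebraMap_iff _ _).mp ?_))
    have := (((isUnit_algebraMap_iff _ _).mpr hg).pow k).mul hu
    exact (h ⟨x, hx⟩) ▸ this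

/-- With `r = a / g ^ k` one has `D(r) = D(g a)`. Sections over `D(g)` and `D(g a)` are both known
to be fractions, and inverting `g a` after `g` is the same as inverting `r`. -/
theorem isLocalizingOn_tilde [IsNoetherianRing (nonneg 𝒜)] (M : GrMod 𝒜) {n : ℕ} (hn : 0 < n)
    {g : nonneg 𝒜} (hg : g ∈ nonnegGrading 𝒜 n) (r : structureSections 𝒜 (basicOpen g)) :
    IsLocalizingOn (X := projPlus 𝒜) (U := basicOpen g) (V := basicOpen g) (tilde M) le_rfl
      ((projPlus 𝒜).basicOpen_le r) r := by
  obtain ⟨k, a, ha, h⟩ := exists_pow_smul_val_eq hn hg r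
  have hW := scheme_basicOpen_eq r h
  have hga : g * a ∈ nonnegGrading 𝒜 ((k + 1) * n) :=
    mul_mem_nonnegGrading hg ha (by ring)
  have hn' : 0 < (k + 1) * n := by positivity
  constructor
  · intro s
    obtain ⟨l, m, hm, hs⟩ := exists_pow_smul_eq_mk M hn' hga hW s
    -- Over `D(g a)` one has `(g a) ^ l s = m`, and `(g a) ^ l = g ^ ((k + 1) l) r ^ l`; so `r ^ l
    -- s` is the restriction of `m / g ^ ((k + 1) l)`.
    refine ⟨l, fracSection M hm (pow_mem_nonnegGrading hg ((k + 1) * l) (by ring))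
      (basicOpen g) fun x hx => mem_basicOpen.mpr (pow_mem (mem_basicOpen.mp hx) _), ?_⟩
    refine Subtype.ext (funext fun x => ?_)
    have hxg : x.1 ∈ basicOpen g := (projPlus 𝒜).basicOpen_le r x.2
    refine loc_smul_cancel (pow_mem (mem_basicOpen.mp hxg) ((k + 1) * l))
      ((loc_mk_smul _ m).trans ?_)
    refine (hs x).symm.trans ((pow_smul_val_pow_smul (h ⟨x.1, hxg⟩) l _).symm.trans ?_)
    exact congrArg (fun ρ => g ^ ((k + 1) * l) • (ρ • s.1 x))
      (val_pow_apply r l x.1 hxg).symm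
  · intro t ht
    obtain ⟨l, m, hm, hs⟩ := exists_pow_smul_eq_mk M hn hg rfl t
    obtain ⟨j, hj⟩ := exists_pow_smul_eq_zero hm hn' hga fun x hx => by
      have hxg : x ∈ basicOpen g :=
        (projPlus 𝒜).basicOpen_le r (hW.le hx)
      have h0 : t.1 ⟨x, hxg⟩ = 0 := congrFun (congrArg Subtype.val ht) ⟨x, hW.le hx⟩
      obtain ⟨b, hb, hbm⟩ := loc_mk_eq_zero.mp
        ((hs ⟨x, hxg⟩).symm.trans ((congrArg (g ^ l • ·) h0).trans (smul_zero _)))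
      exact ⟨b, hb, hbm⟩
    refine ⟨j, Subtype.ext (funext fun x => ?_)⟩
    have hxg : g ∈ compl (𝒜 := 𝒜) x.1 := mem_basicOpen.mp x.2
    -- Multiplied by these two powers of `g`, the claim `r ^ j t = 0` turns into `(g a) ^ j m = 0`.
    refine loc_smul_cancel (pow_mem hxg ((k + 1) * j)) (loc_smul_cancel (pow_mem hxg l) ?_)
    have e1 : g ^ ((k + 1) * j) • ((r ^ j • (show sections M (basicOpen g) from t)).1 x) =
        (g * a) ^ j • t.1 x :=
      (congrArg (fun ρ => g ^ ((k + 1) * j) • (ρ • t.1 x)) (val_pow_apply r j x.1 x.2)).trans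
        (pow_smul_val_pow_smul (h x) j _)
    refine (congrArg (g ^ l • ·) e1).trans ?_
    refine (smul_comm (g ^ l) ((g * a) ^ j) (t.1 x)).trans ?_
    refine (congrArg ((g * a) ^ j • ·) (hs x)).trans ((loc_smul_mk _ _ _).trans ?_)
    refine (congrArg (fun m => (LocalizedModule.mk m 1 : Loc M x.1)) hj).trans ?_
    refine (LocalizedModule.zero_mk _).trans ?_
    symm
    refine (congrArg (g ^ l • ·) (smul_zero _)).trans (smul_zero _)

theorem isQCoh_tilde [IsNoetherianRing (nonneg 𝒜)] (M : GrMod 𝒜) :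
    isQCoh (projPlus 𝒜) (tilde M) :=
  isQuasicoherent_of_isLocalizingOn _ fun x => by
    obtain ⟨n, g, hn, hg, hx⟩ := exists_pos_degree_notMem (𝒜 := 𝒜) x 1
    rw [one_mul] at hg
    exact ⟨basicOpen g, mem_basicOpen.mpr hx,
      Proj.isAffineOpen_basicOpen (nonnegGrading 𝒜) g hg hn, isLocalizingOn_tilde M hn hg⟩

end QuasiCoherence

/-! ### Torsion modules and inverted morphisms -/

section Torsion

variable {A : Type u} [CommRing A] {𝒜 : ℤ → AddSubgroup A} [GradedRing 𝒜]

theorem mem_veronese {d : ℕ} {n : ℤ} {a : A} (ha : a ∈ 𝒜 (d * n)) : a ∈ veronese 𝒜 d :=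
  mem_supportedSubring_of_mem 𝒜 (n := d * n)
    (AddSubgroup.mem_zmultiples_iff.mpr ⟨n, by simp [mul_comm]⟩) ha

/-- The elements with a power killing `x` form the radical of the annihilator of `x`; being an
ideal, it contains `I⁺_{(d)}` as soon as it contains the homogeneous generators. -/
theorem torPlus_of_homogeneous {d : ℕ} {M : GrMod 𝒜} (h : ∀ (n : ℤ), ∀ x ∈ M.deg (d * n),
    ∀ m : ℤ, 0 < m → ∀ f ∈ 𝒜 (d * m), ∃ k : ℕ, f ^ k • x = 0) : torPlus 𝒜 d M := by
  intro n x hx f hf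
  let I : Ideal (veronese 𝒜 d) :=
    LinearMap.ker (LinearMap.toSpanSingleton (veronese 𝒜 d) M.carrier x)
  have hI : veroneseIdeal 𝒜 d ≤ I.radical := Ideal.span_le.mpr fun a ⟨m, hm, ha⟩ => by
    obtain ⟨k, hk⟩ := h n x hx m hm a ha
    refine ⟨k, ?_⟩
    exact hk
  obtain ⟨k, hk⟩ := hI hf
  have hk' : (f : A) ^ k • x = 0 := hk
  exact ⟨k + 1, k.succ_pos, by rw [pow_succ', mul_smul, hk', smul_zero]⟩

theorem torPlus.exists_pow_smul_eq_zero {d : ℕ} {M : GrMod 𝒜} (h : torPlus 𝒜 d M) {n : ℤ}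
    {x : M.carrier} (hx : x ∈ M.deg (d * n)) {m : ℤ} (hm : 0 < m) {f : A} (hf : f ∈ 𝒜 (d * m)) :
    ∃ k : ℕ, f ^ k • x = 0 := by
  obtain ⟨k, -, hk⟩ := h n x hx ⟨f, mem_veronese hf⟩ (Ideal.subset_span ⟨m, hm, hf⟩)
  exact ⟨k, hk⟩

theorem torPlusIso_of_homogeneous {d : ℕ} {M N : GrMod 𝒜} (φ : M ⟶ N)
    (hker : ∀ (n : ℤ), ∀ x ∈ M.deg (d * n), φ.toLin x = 0 → ∀ m : ℤ, 0 < m → ∀ f ∈ 𝒜 (d * m),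
      ∃ k : ℕ, f ^ k • x = 0)
    (hcoker : ∀ (n : ℤ), ∀ y ∈ N.deg (d * n), ∀ m : ℤ, 0 < m → ∀ f ∈ 𝒜 (d * m),
      ∃ (k : ℕ) (x : M.carrier), φ.toLin x = f ^ k • y) : torPlusIso 𝒜 d φ := by
  refine ⟨torPlus_of_homogeneous fun n x hx m hm f hf => ?_,
    torPlus_of_homogeneous fun n y hy m hm f hf => ?_⟩
  · obtain ⟨k, hk⟩ := hker n x.1 hx (LinearMap.mem_ker.mp x.2) m hm f hf
    exact ⟨k, Subtype.ext hk⟩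
  · obtain ⟨y, hy, rfl⟩ := hy
    obtain ⟨k, x, hx⟩ := hcoker n y hy m hm f hf
    exact ⟨k, (Submodule.Quotient.mk_eq_zero _).mpr ⟨x, hx⟩⟩

theorem torPlusIso.exists_pow_smul_eq_zero {d : ℕ} {M N : GrMod 𝒜} {φ : M ⟶ N}
    (h : torPlusIso 𝒜 d φ) {n : ℤ} {x : M.carrier} (hx : x ∈ M.deg (d * n)) (h0 : φ.toLin x = 0)
    {m : ℤ} (hm : 0 < m) {f : A} (hf : f ∈ 𝒜 (d * m)) : ∃ k : ℕ, f ^ k • x = 0 := by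
  obtain ⟨k, hk⟩ := h.1.exists_pow_smul_eq_zero
    (x := (⟨x, LinearMap.mem_ker.mpr h0⟩ : LinearMap.ker φ.toLin)) hx hm hf
  exact ⟨k, congrArg Subtype.val hk⟩

theorem torPlusIso.exists_pow_smul_mem {d : ℕ} {M N : GrMod 𝒜} {φ : M ⟶ N}
    (h : torPlusIso 𝒜 d φ) {n : ℤ} {y : N.carrier} (hy : y ∈ N.deg (d * n))
    {m : ℤ} (hm : 0 < m) {f : A} (hf : f ∈ 𝒜 (d * m)) :
    ∃ (k : ℕ) (x : M.carrier), φ.toLin x = f ^ k • y := by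
  obtain ⟨k, hk⟩ := h.2.exists_pow_smul_eq_zero
    (x := (LinearMap.range φ.toLin).mkQ y) ⟨y, hy, rfl⟩ hm hf
  obtain ⟨x, hx⟩ := (Submodule.Quotient.mk_eq_zero (LinearMap.range φ.toLin)).mp hk
  exact ⟨k, x, hx⟩

/-- Torsion is controlled only in degrees divisible by `d`. If `m` and `t` have degree `n`, then `t
^ (d - 1) • m` has degree `dn`, so a power of some `g` of positive degree divisible by `d`, nonzero
at `x`, moves it to `0` or into the image. -/
theorem tildeMap_bijective_of_torPlusIso {d : ℕ} (hd : 0 < d) {M N : GrMod 𝒜} {φ : M ⟶ N}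
    (h : torPlusIso 𝒜 d φ) (U : Opens (top 𝒜)) : Function.Bijective ((tildeMap φ).app U) := by
  have hdeg : ∀ (P : GrMod 𝒜) (n : ℕ), ∀ m ∈ P.deg n, ∀ t ∈ nonnegGrading 𝒜 n,
      t ^ (d - 1) • m ∈ P.deg (d * n) := fun P n m hm t ht => by
    refine smul_mem_deg P (pow_mem_nonnegGrading ht _ rfl) hm ?_
    obtain ⟨e, rfl⟩ : ∃ e, d = e + 1 := ⟨d - 1, by omega⟩
    push_cast [Nat.add_sub_cancel]
    ring
  refine tildeMap_bijective φ ⊤ (fun x _ n m hm t ht htx h0 => ?_)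
    (fun x _ n m hm t ht htx => ?_) U le_top
  · obtain ⟨e, g, he, hg, hgx⟩ := exists_pos_degree_notMem x d
    obtain ⟨k, hk⟩ := h.exists_pow_smul_eq_zero (hdeg M n m hm t ht) (f := g) (m := e)
      ((map_smul φ.toLin (t ^ (d - 1) : nonneg 𝒜).1 m).trans
        ((congrArg _ h0).trans (smul_zero _))) (by exact_mod_cast he)
      (by have := mem_nonnegGrading 𝒜 |>.mp hg; exact_mod_cast this)
    refine ⟨g ^ k * t ^ (d - 1), mul_mem (pow_mem hgx _) (pow_mem htx _), ?_⟩
    rw [mul_smul]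
    exact hk
  · obtain ⟨e, g, he, hg, hgx⟩ := exists_pos_degree_notMem x d
    obtain ⟨k, z, hz⟩ := h.exists_pow_smul_mem (hdeg N n m hm t ht) (f := g) (m := e)
      (by exact_mod_cast he)
      (by have := mem_nonnegGrading 𝒜 |>.mp hg; exact_mod_cast this)
    refine ⟨_, g ^ k * t ^ (d - 1), z, mul_mem_nonnegGrading (pow_mem_nonnegGrading hg _ rfl)
      (pow_mem_nonnegGrading ht _ rfl) rfl, mul_mem (pow_mem hgx _) (pow_mem htx _), ?_⟩
    rw [mul_smul]
    exact hz

theorem isIso_tildeMap_of_torPlusIso {d : ℕ} (hd : 0 < d) {M N : GrMod 𝒜} {φ : M ⟶ N}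
    (h : torPlusIso 𝒜 d φ) : IsIso (tildeMap φ) :=
  isIso_of_bijective _ (tildeMap_bijective_of_torPlusIso hd h)

theorem tildeQCoh_isInvertedBy [IsNoetherianRing (nonneg 𝒜)] {d : ℕ} (hd : 0 < d)
    (hq : ∀ M : GrMod 𝒜, isQCoh (projPlus 𝒜) (tilde M)) :
    (torPlusIso 𝒜 d).IsInvertedBy (tildeQCoh 𝒜 hq) := fun M N φ h => by
  have h1 : IsIso ((isQCoh (projPlus 𝒜)).ι.map ((tildeQCoh 𝒜 hq).map φ)) :=
    isIso_tildeMap_of_torPlusIso hd h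
  exact isIso_of_reflects_iso ((tildeQCoh 𝒜 hq).map φ) (isQCoh (projPlus 𝒜)).ι

end Torsion

/-! ### Local units of degree `d` from the Cartier condition -/

section CartierUnits

variable {A : Type u} [CommRing A] {𝒜 : ℤ → AddSubgroup A} [GradedRing 𝒜]

/-- An element of a localization which lies in the maximal ideal. -/
def IsSmallAt (x : ProjectiveSpectrum (nonnegGrading 𝒜)) {i : ℤ}
    (z : Loc (GrMod.twist 𝒜 i) x) : Prop :=
  ∃ c ∈ x.asHomogeneousIdeal.toIdeal, ∃ t ∈ compl x,
    t • z = LocalizedModule.mk (GrMod.toTwist 𝒜 i c) 1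

theorem IsSmallAt.add {x : ProjectiveSpectrum (nonnegGrading 𝒜)} {i : ℤ}
    {z z' : Loc (GrMod.twist 𝒜 i) x} (h : IsSmallAt x z) (h' : IsSmallAt x z') :
    IsSmallAt x (z + z') := by
  obtain ⟨c, hc, t, ht, e⟩ := h
  obtain ⟨c', hc', t', ht', e'⟩ := h'
  refine ⟨t' * c + t * c', add_mem (Ideal.mul_mem_left _ _ hc) (Ideal.mul_mem_left _ _ hc'),
    t * t', mul_mem ht ht', ?_⟩
  have e1 : (t * t') • z = t' • t • z := by rw [mul_comm, mul_smul]
  rw [smul_add, e1, e, mul_smul t t' z', e']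
  refine (congrArg₂ (· + ·) (loc_smul_mk _ _ _) (loc_smul_mk _ _ _)).trans ?_
  rw [LocalizedModule.mk_add_mk, one_smul, one_smul, one_mul]
  rfl

theorem isSmallAt_one {x : ProjectiveSpectrum (nonnegGrading 𝒜)} {i : ℤ} :
    ¬ IsSmallAt x (LocalizedModule.mk (GrMod.toTwist 𝒜 i 1) 1) := by
  rintro ⟨c, hc, t, ht, e⟩
  have e' := (loc_smul_mk t (GrMod.toTwist 𝒜 i 1) (1 : compl x)).symm.trans e
  obtain ⟨w, hw⟩ := LocalizedModule.mk_eq.mp e'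
  have hw' : (w.1 : A) * ((1 : nonneg 𝒜) * ((t : A) * 1)) =
    (w.1 : A) * ((1 : nonneg 𝒜) * (c : A)) := hw
  have h2 : w.1 * t = w.1 * c := Subtype.ext (by simpa using hw')
  have h3 : w.1 * t ∈ compl x := mul_mem w.2 ht
  exact h3 (h2 ▸ Ideal.mul_mem_left _ _ hc)

/-- Small elements are closed under addition, so if all products of numerators vanish at `x`, every
value of the multiplication map is small there. This is used for a contradiction, the section `1`
not being small. -/
theorem isSmallAt_twistMulPresheaf {i j : ℤ} {x : ProjectiveSpectrum (nonnegGrading 𝒜)}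
    (H : ∀ (k l : ℕ) (s : nonneg 𝒜) (m m' : A), s ∈ nonnegGrading 𝒜 k → s ∈ compl x →
      m ∈ 𝒜 (k + i) → m' ∈ 𝒜 (l + j) → ∀ σ : nonneg 𝒜, (σ : A) ∈ 𝒜 ((k + l : ℕ) : ℤ) → σ = m * m' →
        σ ∈ x.asHomogeneousIdeal.toIdeal)
    (hij : i + j = 0)
    {V : Opens (top 𝒜)} (hxV : x ∈ V)
    (s : TensorProduct (structureSections 𝒜 V) (sections (GrMod.twist 𝒜 i) V)
      (sections (GrMod.twist 𝒜 j) V)) :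
    IsSmallAt x ((show sections (GrMod.twist 𝒜 (i + j)) V from
      ((twistMulPresheaf 𝒜 i j).app (op V)).hom s).1 ⟨x, hxV⟩) := by
  induction s using TensorProduct.induction_on with
  | zero =>
    have : (show sections (GrMod.twist 𝒜 (i + j)) V from
      ((twistMulPresheaf 𝒜 i j).app (op V)).hom 0) = 0 := map_zero _
    refine ⟨0, zero_mem _, 1, one_mem _, ?_⟩
    refine (one_smul _ _).trans ((congrArg (fun f => f.1 ⟨x, hxV⟩) this).trans ?_)
    exact (LocalizedModule.zero_mk _).symm
  | add s s' hs hs' =>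
    have : (show sections (GrMod.twist 𝒜 (i + j)) V from
      ((twistMulPresheaf 𝒜 i j).app (op V)).hom (s + s')) =
      ((twistMulPresheaf 𝒜 i j).app (op V)).hom s +
      ((twistMulPresheaf 𝒜 i j).app (op V)).hom s' := map_add _ _ _
    rw [this]
    exact hs.add hs'
  | tmul f f' =>
    obtain ⟨k, m, hm, s, hs, W, hW, hWV, hxW, e⟩ := exists_eq_fracSection _ f x hxV
    obtain ⟨l, m', hm', s', hs', W', hW', hWV', hxW', e'⟩ := exists_eq_fracSection _ f' x hxV
    have hmm : (show A from m) * (show A from m') ∈ 𝒜 ((k + l : ℕ) : ℤ) := by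
      have h := SetLike.GradedMul.mul_mem (show (show A from m) ∈ 𝒜 (k + i) from hm)
        (show (show A from m') ∈ 𝒜 (l + j) from hm')
      rwa [show (k + i) + (l + j) = ((k + l : ℕ) : ℤ) by
        push_cast; linear_combination hij] at h
    have hnn := mem_supportedSubring_of_mem 𝒜 (S := AddSubmonoid.nonneg ℤ)
      (n := ((k + l : ℕ) : ℤ)) (Int.natCast_nonneg _) hmm
    refine ⟨⟨_, hnn⟩, H k l s m m' hs (hW hxW) hm hm' _ hmm rfl, s * s',
      mul_mem (hW hxW) (hW' hxW'), ?_⟩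
    have e1 : f.1 ⟨x, hxV⟩ = LocalizedModule.mk m ⟨s, hW hxW⟩ :=
      congrFun (congrArg Subtype.val e) ⟨x, hxW⟩
    have e2 : f'.1 ⟨x, hxV⟩ = LocalizedModule.mk m' ⟨s', hW' hxW'⟩ :=
      congrFun (congrArg Subtype.val e') ⟨x, hxW'⟩
    have e3 : (show LocalizedModule (compl x) A from f.1 ⟨x, hxV⟩) *
        (show LocalizedModule (compl x) A from f'.1 ⟨x, hxV⟩) =
        LocalizedModule.mk ((show A from m) * (show A from m'))
          (⟨s, hW hxW⟩ * ⟨s', hW' hxW'⟩ : compl x) :=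
      (congrArg₂ (fun a b : LocalizedModule (compl x) A => a * b) e1 e2).trans
        LocalizedModule.mk_mul_mk
    refine (congrArg (fun z : Loc (GrMod.twist 𝒜 (i + j)) x => (s * s') • z) e3).trans
      ?_
    exact loc_mk_smul (M := GrMod.twist 𝒜 (i + j)) (mul_mem (hW hxW) (hW' hxW')) _

/-- The section `1` lies in the image of `Ã(d) ⊗ Ã(-d)`. Near `x` its preimage comes from the
presheaf tensor product, and if every product `m m'` vanished at `x`, then `1` would lie in the
maximal ideal there. -/
theorem exists_mul_notMem_of_isPositivelyCartier {d : ℕ} (hC : IsPositivelyCartier 𝒜 d)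
    (x : ProjectiveSpectrum (nonnegGrading 𝒜)) :
    ∃ (k l : ℕ) (s : nonneg 𝒜) (σ : nonneg 𝒜) (m m' : A), s ∈ nonnegGrading 𝒜 k ∧ s ∈ compl x ∧
      m ∈ 𝒜 (k + d) ∧ m' ∈ 𝒜 (l - d) ∧ σ ∈ nonnegGrading 𝒜 (k + l) ∧ σ ∈ compl x ∧
      m * m' = σ := by
  by_contra! H
  have hiso := hC 1 (-1)
  have hone : GrMod.toTwist 𝒜 (d * 1 + d * (-1)) 1 ∈
      (GrMod.twist 𝒜 (d * 1 + d * (-1))).deg (0 : ℕ) := by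
    change (1 : A) ∈ 𝒜 (((0 : ℕ) : ℤ) + (d * 1 + d * (-1)))
    rw [show ((0 : ℕ) : ℤ) + (d * 1 + d * (-1)) = 0 by push_cast; ring]
    exact SetLike.GradedOne.one_mem
  let e := fracSection (GrMod.twist 𝒜 (d * 1 + d * (-1))) hone
    (SetLike.GradedOne.one_mem : 1 ∈ nonnegGrading 𝒜 0) ⊤ fun _ _ => one_mem (compl _)
  obtain ⟨t, ht⟩ := (bijective_of_isIso (twistMul 𝒜 (d * 1) (d * (-1))) ⊤).2 e
  obtain ⟨V, hV, s, hxV, es⟩ := toSheafified_locally_surjective _ _ t x trivial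
  have h1 : ((twistMulPresheaf 𝒜 (d * 1) (d * (-1))).app (op V)).hom s =
      sectionsRes _ hV e := by
    refine (homEquiv_symm_app (X := projPlus 𝒜) (twistMulPresheaf 𝒜 (d * 1) (d * (-1))) V s).symm.trans ?_
    refine (congrArg (fun z => (twistMul 𝒜 (d * 1) (d * (-1))).app V z) es).trans ?_
    refine (res_app (twistMul 𝒜 (d * 1) (d * (-1))) hV t).symm.trans ?_
    exact congrArg (res _ hV) ht
  have key := isSmallAt_twistMulPresheaf (i := d * 1) (j := d * (-1))
    (fun k l s m m' hs hsx hm hm' σ hσ hσe => by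
      by_contra hc
      rw [mul_one] at hm
      rw [mul_neg_one, ← sub_eq_add_neg] at hm'
      exact H k l s σ m m' hs hsx hm hm' hσ hc hσe.symm) (by ring) hxV s
  refine isSmallAt_one (x := x) (i := d * 1 + d * (-1)) ?_
  have h2 : (show sections (GrMod.twist 𝒜 (d * 1 + d * (-1))) V from
      ((twistMulPresheaf 𝒜 (d * 1) (d * (-1))).app (op V)).hom s).1 ⟨x, hxV⟩ =
      LocalizedModule.mk (GrMod.toTwist 𝒜 (d * 1 + d * (-1)) 1) 1 :=
    congrFun (congrArg Subtype.val h1) (⟨x, hxV⟩ : (show Opens (top 𝒜) from V))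
  exact h2 ▸ key

/-- `D(g)` is an open subset over which `A` has a unit of degree `d`. -/
structure IsUnitCover (d n : ℕ) (g : nonneg 𝒜) (u v : A) : Prop where
  pos : 0 < n
  mem : g ∈ nonnegGrading 𝒜 (d * n)
  mem_left : u ∈ 𝒜 (d * n + d)
  mem_right : v ∈ 𝒜 (d * n - d)
  mul_eq : u * v = (g : A) ^ 2

theorem exists_isUnitCover {d : ℕ} (hd : 0 < d) (hC : IsPositivelyCartier 𝒜 d)
    (x : ProjectiveSpectrum (nonnegGrading 𝒜)) :
    ∃ n g u v, g ∈ compl x ∧ IsUnitCover (𝒜 := 𝒜) d n g u v := by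
  obtain ⟨k, l, s, σ, m, m', hs, hsx, hm, hm', hσ, hσx, e⟩ :=
    exists_mul_notMem_of_isPositivelyCartier hC x
  obtain ⟨n, h, hn, hh, hhx⟩ := exists_pos_degree_notMem x d
  obtain ⟨c, rfl⟩ : ∃ c, d = c + 1 := ⟨d - 1, by omega⟩
  -- Chosen so that `u / g = m / s` and `v / g = m' s / σ`, which are inverse to each other as `m m'
  -- = σ`. The `d`-th powers (`d = c + 1`) make the degree of `g` a multiple of `d`, and `h` makes
  -- it positive.
  refine ⟨2 * k + l + n, s ^ (c + 1) * σ ^ (c + 1) * h, m * (s : A) ^ c * (σ : A) ^ (c + 1) * h,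
    m' * (σ : A) ^ c * (s : A) ^ (c + 2) * h,
    mul_mem (mul_mem (pow_mem hsx _) (pow_mem hσx _)) hhx, by omega, ?_, ?_, ?_, ?_⟩
  · refine mul_mem_nonnegGrading (mul_mem_nonnegGrading (pow_mem_nonnegGrading hs _ rfl)
      (pow_mem_nonnegGrading hσ _ rfl) rfl) hh ?_
    ring
  · have := SetLike.GradedMul.mul_mem (SetLike.GradedMul.mul_mem (SetLike.GradedMul.mul_mem hm
      (SetLike.pow_mem_graded c ((mem_nonnegGrading 𝒜).mp hs)))
      (SetLike.pow_mem_graded (c + 1) ((mem_nonnegGrading 𝒜).mp hσ)))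
      ((mem_nonnegGrading 𝒜).mp hh)
    convert! this using 2
    push_cast [nsmul_eq_mul]
    ring
  · have := SetLike.GradedMul.mul_mem (SetLike.GradedMul.mul_mem (SetLike.GradedMul.mul_mem hm'
      (SetLike.pow_mem_graded c ((mem_nonnegGrading 𝒜).mp hσ)))
      (SetLike.pow_mem_graded (c + 2) ((mem_nonnegGrading 𝒜).mp hs)))
      ((mem_nonnegGrading 𝒜).mp hh)
    convert! this using 2
    push_cast [nsmul_eq_mul]
    ring
  · push_cast
    linear_combination ((s : A) ^ c * (σ : A) ^ (c + 1) * h) * ((σ : A) ^ c * (s : A) ^ (c + 2) * h) * e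

/-- With `l = |i|`, take `w = u ^ l` or `w = v ^ l` according to the sign of `i`: then `w / g ^ l`
is a unit of degree `di` over `D(g)`. -/
theorem IsUnitCover.exists_mul_eq {d n : ℕ} {g : nonneg 𝒜} {u v : A}
    (H : IsUnitCover (𝒜 := 𝒜) d n g u v) (i : ℤ) :
    ∃ (l : ℕ) (w w' : A), w ∈ 𝒜 (d * (n * l + i)) ∧ w' ∈ 𝒜 (d * (n * l - i)) ∧
      w * w' = (g : A) ^ (2 * l) := by
  have hu : ∀ l : ℕ, u ^ l ∈ 𝒜 (d * (n * l + l)) := fun l => by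
    convert! SetLike.pow_mem_graded l H.mem_left using 2
    rw [nsmul_eq_mul]
    ring
  have hv : ∀ l : ℕ, v ^ l ∈ 𝒜 (d * (n * l - l)) := fun l => by
    convert! SetLike.pow_mem_graded l H.mem_right using 2
    rw [nsmul_eq_mul]
    ring
  obtain ⟨l, rfl | rfl⟩ := i.eq_nat_or_neg
  · exact ⟨l, u ^ l, v ^ l, hu l, hv l, by rw [← mul_pow, H.mul_eq, pow_mul]⟩
  · refine ⟨l, v ^ l, u ^ l, ?_, ?_, by rw [← mul_pow, mul_comm v u, H.mul_eq, pow_mul]⟩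
    · simpa [sub_eq_add_neg] using hv l
    · simpa using hu l

end CartierUnits

/-! ### Tensor products of `𝒪`-modules, on sections -/

section TensorSections

open TensorProduct

variable {X : Scheme.{u}}

/-- The tensor product of two `𝒪`-modules. -/
abbrev tens (F G : X.Modules) : X.Modules := ((tensorFunctor X).obj F).obj G

/-- The tensor product of two `𝒪`-modules, as a presheaf. -/
abbrev preTens (F G : X.Modules) : PMod X :=
  PresheafOfModules.Monoidal.tensorObj (R := X.presheaf) ((toPresheafMod X).obj F)
    ((toPresheafMod X).obj G)

/-- The section `m ⊗ e` of a tensor product. -/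
def tmulSection {F G : X.Modules} {U : X.Opens} (m : Γ(F, U)) (e : Γ(G, U)) : Γ(tens F G, U) :=
  toSheafified (preTens F G) U (m ⊗ₜ[Γ(X, U)] e)

variable {F G H : X.Modules} {U V : X.Opens}

theorem tmulSection_smul (r : Γ(X, U)) (m : Γ(F, U)) (e : Γ(G, U)) :
    tmulSection m (r • e) = r • tmulSection m e :=
  (congrArg (toSheafified (preTens F G) U) (TensorProduct.tmul_smul (R := Γ(X, U)) r m e)).trans
    ((toSheafified (preTens F G) U).map_smul r (m ⊗ₜ[Γ(X, U)] e))

theorem tens_map_tmulSection (φ : G ⟶ H) (m : Γ(F, U)) (e : Γ(G, U)) :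
    (((tensorFunctor X).obj F).map φ).app U (tmulSection m e) = tmulSection m (φ.app U e) :=
  sheafifyMod_map_app (P := preTens F G) (Q := preTens F H)
    (PresheafOfModules.Monoidal.tensorHom (𝟙 _) ((toPresheafMod X).map φ)) U (m ⊗ₜ[Γ(X, U)] e)

theorem tens_map_tmulSection_left (φ : F ⟶ H) (m : Γ(F, U)) (e : Γ(G, U)) :
    (((tensorFunctor X).map φ).app G).app U (tmulSection m e) = tmulSection (φ.app U m) e :=
  sheafifyMod_map_app (P := preTens F G) (Q := preTens H G)
    (PresheafOfModules.Monoidal.tensorHom ((toPresheafMod X).map φ) (𝟙 _)) U (m ⊗ₜ[Γ(X, U)] e)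

/-- Sections of a tensor product are locally sums of pure tensors. -/
theorem tens_induction (p : ∀ V : X.Opens, V ≤ U → Γ(tens F G, V) → Prop)
    (hloc : ∀ (V : X.Opens) (hV : V ≤ U) (t : Γ(tens F G, V)),
      (∀ x ∈ V, ∃ (W : X.Opens) (h : W ≤ V), x ∈ W ∧ p W (h.trans hV) (res _ h t)) → p V hV t)
    (hadd : ∀ (V : X.Opens) (hV : V ≤ U) (s t : Γ(tens F G, V)), p V hV s → p V hV t →
      p V hV (s + t))
    (htmul : ∀ (V : X.Opens) (hV : V ≤ U) (m : Γ(F, V)) (e : Γ(G, V)), p V hV (tmulSection m e))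
    (t : Γ(tens F G, U)) : p U le_rfl t := by
  refine hloc U le_rfl t fun x hx => ?_
  obtain ⟨V, hV, s, hxV, e⟩ := toSheafified_locally_surjective (preTens F G) U t x hx
  refine ⟨V, hV, hxV, e ▸ ?_⟩
  have key : ∀ s : TensorProduct Γ(X, V) Γ(F, V) Γ(G, V),
      p V hV (toSheafified (preTens F G) V s) := fun s => by
    induction s using TensorProduct.induction_on with
    | zero =>
      have h0 : tmulSection (0 : Γ(F, V)) (0 : Γ(G, V)) = toSheafified (preTens F G) V 0 :=
        congrArg (toSheafified (preTens F G) V) (TensorProduct.zero_tmul (R := Γ(X, V)) _ 0)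
      exact h0 ▸ htmul V hV 0 0
    | tmul m e => exact htmul V hV m e
    | add s s' hs hs' =>
      have h0 : toSheafified (preTens F G) V (s + s') =
        toSheafified (preTens F G) V s + toSheafified (preTens F G) V s' := map_add _ _ _
      exact h0 ▸ hadd V hV _ _ hs hs'
  exact key s

/-- Two natural additive operations on sections of a tensor product which agree on pure tensors
are equal. -/
theorem tens_ext (φ ψ : ∀ V : X.Opens, V ≤ U → Γ(tens F G, V) → Γ(H, V))
    (hφ : ∀ (V W : X.Opens) (hV : V ≤ U) (h : W ≤ V) t,
      res H h (φ V hV t) = φ W (h.trans hV) (res _ h t))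
    (hψ : ∀ (V W : X.Opens) (hV : V ≤ U) (h : W ≤ V) t,
      res H h (ψ V hV t) = ψ W (h.trans hV) (res _ h t))
    (hφa : ∀ V hV s t, φ V hV (s + t) = φ V hV s + φ V hV t)
    (hψa : ∀ V hV s t, ψ V hV (s + t) = ψ V hV s + ψ V hV t)
    (h : ∀ V hV m e, φ V hV (tmulSection m e) = ψ V hV (tmulSection m e))
    (t : Γ(tens F G, U)) : φ U le_rfl t = ψ U le_rfl t :=
  tens_induction (fun V hV t => φ V hV t = ψ V hV t)
    (fun V hV t ht => section_ext H fun x hx => by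
      obtain ⟨W, h, hxW, e⟩ := ht x hx
      exact ⟨W, h, hxW, by rw [hφ, hψ, e]⟩)
    (fun V hV s t hs ht => by rw [hφa, hψa, hs, ht]) (fun V hV m e => h V hV m e) t

/-- Morphisms from a tensor product are equal if they agree on pure tensors. -/
theorem tens_hom_ext {φ ψ : tens F G ⟶ H} (h : ∀ (V : X.Opens) (m : Γ(F, V)) (e : Γ(G, V)),
    φ.app V (tmulSection m e) = ψ.app V (tmulSection m e)) : φ = ψ :=
  Scheme.Modules.hom_ext _ _ fun U => by
    ext t
    exact tens_ext (U := U) (fun V _ t => φ.app V t) (fun V _ t => ψ.app V t)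
      (fun V W _ h t => res_app _ _ _) (fun V W _ h t => res_app _ _ _)
      (fun V _ s t => map_add _ _ _) (fun V _ s t => map_add _ _ _) (fun V _ m e => h V m e) t

/-- Applied when `φ` and `ψ` are multiplications by `a` and `b` and `r` is the function `b / a`; it
suffices to check pure tensors, where `r` can be moved to the factor `G`. -/
theorem tens_map_smul_eq {φ ψ : G ⟶ H} (r : Γ(X, U))
    (h : ∀ (V : X.Opens) (hV : V ≤ U) (e : Γ(G, V)), φ.app V (rres hV r • e) = ψ.app V e)
    (t : Γ(tens F G, U)) : (((tensorFunctor X).obj F).map φ).app U (r • t) =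
      (((tensorFunctor X).obj F).map ψ).app U t := by
  have := tens_ext (U := U)
    (fun V hV t => (((tensorFunctor X).obj F).map φ).app V (rres hV r • t))
    (fun V hV t => (((tensorFunctor X).obj F).map ψ).app V t)
    (fun V W hV h t => ?_) (fun V W hV h t => res_app _ _ _)
    (fun V hV s t => ?_) (fun V hV s t => map_add _ _ _)
    (fun V hV m e => ?_) t
  · have e : rres le_rfl r = r := ConcreteCategory.congr_hom (X.presheaf.map_id (op U)) r
    rwa [e] at this
  · rw [res_app, res_smul]
    congr 2
    exact (ConcreteCategory.congr_hom (X.presheaf.map_comp (homOfLE hV).op (homOfLE h).op) r).symm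
  · rw [smul_add, map_add]
  · rw [← tmulSection_smul, tens_map_tmulSection, tens_map_tmulSection, h]

/-- A linear bijection on sections over each `V ≤ W` stays one after tensoring over `Γ(X, V)`, so no
flatness is involved. -/
theorem tens_map_bijective (φ : G ⟶ H) (W : X.Opens)
    (h : ∀ V ≤ W, Function.Bijective (φ.app V)) :
    ∀ V ≤ W, Function.Bijective ((((tensorFunctor X).obj F).map φ).app V) := by
  refine sheafifyMod_map_bijective (P := preTens F G) (Q := preTens F H)
    (PresheafOfModules.Monoidal.tensorHom (𝟙 _) ((toPresheafMod X).map φ)) W fun V hV => ?_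
  let e : Γ(G, V) ≃ₗ[Γ(X, V)] Γ(H, V) := LinearEquiv.ofBijective
    { toFun := φ.app V
      map_add' := map_add _
      map_smul' := φ.app_smul } (h V hV)
  exact (TensorProduct.congr (LinearEquiv.refl Γ(X, V) Γ(F, V)) e).bijective

open MonoidalCategory in
/-- The morphism of presheaves defined by compatible bilinear maps on sections. -/
def preTensDesc (b : ∀ U : X.Opens, Γ(F, U) →ₗ[Γ(X, U)] Γ(G, U) →ₗ[Γ(X, U)] Γ(H, U))
    (hb : ∀ (U V : X.Opens) (h : V ≤ U) m e, res H h (b U m e) = b V (res F h m) (res G h e)) :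
    preTens F G ⟶ (toPresheafMod X).obj H where
  app U := ModuleCat.ofHom (X := TensorProduct Γ(X, U.unop) Γ(F, U.unop) Γ(G, U.unop))
    (Y := Γ(H, U.unop)) (R := Γ(X, U.unop)) (TensorProduct.lift (b U.unop))
  naturality {U V} f := ModuleCat.MonoidalCategory.tensor_ext fun m e =>
    (hb U.unop V.unop (leOfHom f.unop) m e).symm

/-- The morphism from a tensor product defined by compatible bilinear maps on sections. -/
def tensDesc (b : ∀ U : X.Opens, Γ(F, U) →ₗ[Γ(X, U)] Γ(G, U) →ₗ[Γ(X, U)] Γ(H, U))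
    (hb : ∀ (U V : X.Opens) (h : V ≤ U) m e, res H h (b U m e) = b V (res F h m) (res G h e)) :
    tens F G ⟶ H :=
  ((sheafifyModAdj X).homEquiv (preTens F G) H).symm (preTensDesc b hb)

theorem tensDesc_tmulSection
    (b : ∀ U : X.Opens, Γ(F, U) →ₗ[Γ(X, U)] Γ(G, U) →ₗ[Γ(X, U)] Γ(H, U))
    (hb : ∀ (U V : X.Opens) (h : V ≤ U) m e, res H h (b U m e) = b V (res F h m) (res G h e))
    (m : Γ(F, U)) (e : Γ(G, U)) : (tensDesc b hb).app U (tmulSection m e) = b U m e :=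
  (homEquiv_symm_app (preTensDesc b hb) U (m ⊗ₜ[Γ(X, U)] e)).trans
    (TensorProduct.lift.tmul (f' := b U) m e)

theorem tensDesc_bijective
    (b : ∀ U : X.Opens, Γ(F, U) →ₗ[Γ(X, U)] Γ(G, U) →ₗ[Γ(X, U)] Γ(H, U))
    (hb : ∀ (U V : X.Opens) (h : V ≤ U) m e, res H h (b U m e) = b V (res F h m) (res G h e))
    (W : X.Opens) (hW : ∀ V ≤ W, Function.Bijective (TensorProduct.lift (b V))) :
    ∀ V ≤ W, Function.Bijective ((tensDesc b hb).app V) :=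
  homEquiv_symm_bijective (preTensDesc b hb) W hW

/-- If every section of `G` is uniquely a multiple of `e`, then `m ↦ m ⊗ e` identifies a module
with its tensor product with `G`. -/
theorem bijective_lift_of_generator {R M N P : Type*} [CommRing R] [AddCommGroup M]
    [AddCommGroup N] [AddCommGroup P] [Module R M] [Module R N] [Module R P] {e : N}
    (he : Function.Bijective fun r : R => r • e) (b : M →ₗ[R] N →ₗ[R] P)
    (hb : Function.Bijective fun m => b m e) : Function.Bijective (TensorProduct.lift b) := by
  let ε : R ≃ₗ[R] N := LinearEquiv.ofBijective (LinearMap.toSpanSingleton R N e) he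
  let τ : M ≃ₗ[R] M ⊗[R] N := (TensorProduct.rid R M).symm ≪≫ₗ
    TensorProduct.congr (LinearEquiv.refl R M) ε
  have h : (TensorProduct.lift b) ∘ τ = fun m => b m e := by
    funext m
    have h1 : ε 1 = e := one_smul R e
    simp [τ, h1]
  exact (Function.Bijective.of_comp_iff _ τ.bijective).mp (h ▸ hb)

end TensorSections

/-! ### Twists of an `𝒪`-module and multiplication between them -/

section Twists

open TensorProduct

variable {A : Type u} [CommRing A] {𝒜 : ℤ → AddSubgroup A} [GradedRing 𝒜]

/-- `φ` and `ψ` are inverse to each other up to `s`, which is invertible on `D(s)`. No grading is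
asked of `ψ`: only the appropriate component of `ψ m` is used. -/
theorem tildeMap_bijective_of_mul {M N : GrMod 𝒜} (φ : M ⟶ N) (ψ : N.carrier →ₗ[A] M.carrier)
    {n : ℕ} {s : nonneg 𝒜} (hs : s ∈ nonnegGrading 𝒜 n) (h1 : ∀ m, ψ (φ.toLin m) = s • m)
    (h2 : ∀ m, φ.toLin (ψ m) = s • m) :
    ∀ U ≤ basicOpen s, Function.Bijective ((tildeMap φ).app U) :=
  tildeMap_bijective φ _
    (fun x hx _ m _ _ _ _ h0 => ⟨s, hx, by rw [← h1, h0, map_zero]⟩)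
    (fun x hx _ m _ _ _ _ => ⟨n, s, ψ m, hs, hx, h2 m⟩)

theorem twistMap_bijective {i j k : ℤ} (h : j + i = k) (a : 𝒜 j) {b : A} {n : ℕ} {s : nonneg 𝒜}
    (hs : s ∈ nonnegGrading 𝒜 n) (hab : (a : A) * b = s) :
    ∀ U ≤ basicOpen s, Function.Bijective ((tildeMap (GrMod.twistMap h a)).app U) :=
  tildeMap_bijective_of_mul _ (LinearMap.mulLeft A b) hs
    (fun m : A => by
      change b * (a * m) = s * m
      rw [← mul_assoc, mul_comm b, hab])
    (fun m : A => by
      change a * (b * m) = s * m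
      rw [← mul_assoc, hab])

/-- The twist `F ⊗ Ã(i)` of an `𝒪`-module. -/
abbrev tw (F : (projPlus 𝒜).Modules) (i : ℤ) : (projPlus 𝒜).Modules :=
  tens F (tilde (GrMod.twist 𝒜 i))

/-- Multiplication by a homogeneous element on the twists of an `𝒪`-module. -/
def twMul (F : (projPlus 𝒜).Modules) {i j k : ℤ} {a : A} (ha : a ∈ 𝒜 j) (h : j + i = k) :
    tw F i ⟶ tw F k :=
  ((tensorFunctor (projPlus 𝒜)).obj F).map (tildeMap (GrMod.twistMap h ⟨a, ha⟩))

theorem twMul_comp (F : (projPlus 𝒜).Modules) {i j j' j'' k l : ℤ} {a b c : A} (ha : a ∈ 𝒜 j)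
    (h : j + i = k) (hb : b ∈ 𝒜 j') (h' : j' + k = l) (hc : c ∈ 𝒜 j'') (h'' : j'' + i = l)
    (e : b * a = c) : twMul F ha h ≫ twMul F hb h' = twMul F hc h'' := by
  have : GrMod.twistMap h (⟨a, ha⟩ : 𝒜 j) ≫ GrMod.twistMap h' ⟨b, hb⟩ =
      GrMod.twistMap h'' ⟨c, hc⟩ := GrMod.hom_ext fun m : A => by
    change b * (a * m) = c * m
    rw [← mul_assoc, e]
  rw [twMul, twMul, twMul, ← this, ← Functor.map_comp]
  exact congrArg _ ((tildeFunctor 𝒜).map_comp _ _).symm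

theorem twMul_twMul (F : (projPlus 𝒜).Modules) {i j j' j'' k l : ℤ} {a b c : A} (ha : a ∈ 𝒜 j)
    (h : j + i = k) (hb : b ∈ 𝒜 j') (h' : j' + k = l) (hc : c ∈ 𝒜 j'') (h'' : j'' + i = l)
    (e : b * a = c) {U : (projPlus 𝒜).Opens} (t : Γ(tw F i, U)) :
    (twMul F hb h').app U ((twMul F ha h).app U t) = (twMul F hc h'').app U t :=
  congrArg (fun φ : tw F i ⟶ tw F l => φ.app U t) (twMul_comp F ha h hb h' hc h'' e)

theorem twMul_bijective (F : (projPlus 𝒜).Modules) {i j k : ℤ} {a b : A} (ha : a ∈ 𝒜 j)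
    (h : j + i = k) {n : ℕ} {s : nonneg 𝒜} (hs : s ∈ nonnegGrading 𝒜 n) (hab : a * b = s) :
    ∀ U ≤ basicOpen s, Function.Bijective ((twMul F ha h).app U) :=
  tens_map_bijective (X := projPlus 𝒜) (F := F) (tildeMap (GrMod.twistMap h ⟨a, ha⟩))
    (basicOpen s) (twistMap_bijective h ⟨a, ha⟩ hs hab)

theorem locMap_twistMap_smul {x : ProjectiveSpectrum (nonnegGrading 𝒜)} {i j k : ℤ}
    {a b : nonneg 𝒜} (ha : (a : A) ∈ 𝒜 j) (hb : (b : A) ∈ 𝒜 j) (h : j + i = k)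
    {ρ : Localization (compl x)}
    (hρ : algebraMap (nonneg 𝒜) (Localization (compl x)) a * ρ = algebraMap (nonneg 𝒜) _ b)
    (z : Loc (GrMod.twist 𝒜 i) x) : locMap (GrMod.twistMap h (⟨a, ha⟩ : 𝒜 j)) x (ρ • z) =
      locMap (GrMod.twistMap h (⟨b, hb⟩ : 𝒜 j)) x z := by
  induction ρ using Localization.induction_on with
  | H c =>
    induction z using LocalizedModule.induction_on with
    | h m s =>
      rw [LocalizedModule.mk_smul_mk, locMap_mk, locMap_mk]
      rw [← Localization.mk_one_eq_algebraMap, ← Localization.mk_one_eq_algebraMap,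
        Localization.mk_mul, Localization.mk_eq_mk_iff, Localization.r_iff_exists] at hρ
      obtain ⟨w, hw⟩ := hρ
      refine LocalizedModule.mk_eq.mpr ⟨w, ?_⟩
      have hw' : (w.1 : A) * (1 * (a * c.1)) = w.1 * ((1 * c.2.1 : nonneg 𝒜) * (b : A)) :=
        congrArg Subtype.val hw
      rw [one_mul, one_mul] at hw'
      obtain ⟨m, rfl⟩ : ∃ m' : A, GrMod.toTwist 𝒜 i m' = m := ⟨m, rfl⟩
      change (w.1 : A) * (s.1 * (a * (c.1 * m))) = w.1 * ((c.2.1 * s.1 : nonneg 𝒜) * (b * m))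
      push_cast at hw' ⊢
      linear_combination ((s.1 : A) * m) * hw'

theorem twMul_smul_eq (F : (projPlus 𝒜).Modules) {i j k : ℤ} {a b : nonneg 𝒜}
    (ha : (a : A) ∈ 𝒜 j) (hb : (b : A) ∈ 𝒜 j) (h : j + i = k) {U : (projPlus 𝒜).Opens}
    (r : Γ(projPlus 𝒜, U))
    (hr : ∀ (x : ProjectiveSpectrum (nonnegGrading 𝒜)) (hx : x ∈ U),
      algebraMap (nonneg 𝒜) (Localization (compl x)) a *
        ((show structureSections 𝒜 U from r).1 ⟨x, hx⟩).val =
      algebraMap (nonneg 𝒜) (Localization (compl x)) b) (t : Γ(tw F i, U)) :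
    (twMul F ha h).app U (r • t) = (twMul F hb h).app U t :=
  tens_map_smul_eq (X := projPlus 𝒜) (U := U) r (fun _ hV _ => Subtype.ext (funext fun x =>
    locMap_twistMap_smul ha hb h (hr x.1 (hV x.2)) _)) t

/-- The linear map `Ã(0)(U) → 𝒪(U)`, inverse to the multiplication of the unit section. -/
def coeffMap (U : Opens (top 𝒜)) : sections (GrMod.twist 𝒜 0) U ≃ₗ[structureSections 𝒜 U]
    structureSections 𝒜 U :=
  (LinearEquiv.ofBijective (LinearMap.toSpanSingleton (structureSections 𝒜 U) _ (oneSection 𝒜 U))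
    (smul_oneSection_bijective U)).symm

theorem coeffMap_smul_oneSection {U : Opens (top 𝒜)} (r : structureSections 𝒜 U) :
    coeffMap U (r • oneSection 𝒜 U) = r :=
  LinearEquiv.symm_apply_apply _ r

theorem coeffMap_smul (U : Opens (top 𝒜)) (e : sections (GrMod.twist 𝒜 0) U) :
    coeffMap U e • oneSection 𝒜 U = e :=
  (LinearEquiv.ofBijective (LinearMap.toSpanSingleton (structureSections 𝒜 U) _ (oneSection 𝒜 U))
    (smul_oneSection_bijective U)).apply_symm_apply e

/-- The coefficient of a section of `Ã(0)` with respect to the unit section. -/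
def coeff (U : (projPlus 𝒜).Opens) :
    Γ(tilde (GrMod.twist 𝒜 0), U) →ₗ[Γ(projPlus 𝒜, U)] Γ(projPlus 𝒜, U) :=
  let f := (coeffMap (show Opens (top 𝒜) from U)).toLinearMap
  f

/-- The unit section of `Ã(0)`. -/
def unitSection (U : (projPlus 𝒜).Opens) : Γ(tilde (GrMod.twist 𝒜 0), U) := oneSection 𝒜 U

theorem coeff_smul_unitSection (U : (projPlus 𝒜).Opens) (e : Γ(tilde (GrMod.twist 𝒜 0), U)) :
    coeff U e • unitSection U = e :=
  coeffMap_smul (show Opens (top 𝒜) from U) e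

theorem coeff_unitSection (U : (projPlus 𝒜).Opens) : coeff (𝒜 := 𝒜) U (unitSection U) = 1 :=
  (congrArg (coeffMap (show Opens (top 𝒜) from U)) (one_smul _ _).symm).trans
    (coeffMap_smul_oneSection 1)

theorem smul_unitSection_bijective (U : (projPlus 𝒜).Opens) :
    Function.Bijective fun r : Γ(projPlus 𝒜, U) => r • unitSection (𝒜 := 𝒜) U :=
  smul_oneSection_bijective (show Opens (top 𝒜) from U)

theorem res_unitSection {U V : (projPlus 𝒜).Opens} (h : V ≤ U) :
    res (tilde (GrMod.twist 𝒜 0)) h (unitSection U) = unitSection V := rfl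

theorem rres_coeff {U V : (projPlus 𝒜).Opens} (h : V ≤ U) (e : Γ(tilde (GrMod.twist 𝒜 0), U)) :
    rres h (coeff U e) = coeff V (res _ h e) := by
  conv_rhs => rw [← coeff_smul_unitSection U e, res_smul, res_unitSection, map_smul,
    coeff_unitSection]
  exact (mul_one _).symm

/-- The isomorphism `F ⊗ Ã(0) ⟶ F`. -/
def rightUnit (F : (projPlus 𝒜).Modules) : tw F 0 ⟶ F :=
  tensDesc (fun U => LinearMap.mk₂ Γ(projPlus 𝒜, U) (fun m e => coeff U e • m)
    (fun m m' e => smul_add _ _ _) (fun r m e => smul_comm _ _ _)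
    (fun m e e' => by rw [map_add, add_smul])
    (fun r m e => by rw [map_smul, smul_assoc])) fun U V h m e => by
      rw [LinearMap.mk₂_apply, LinearMap.mk₂_apply, res_smul, ← rres_coeff h]

theorem rightUnit_tmulSection (F : (projPlus 𝒜).Modules) {U : (projPlus 𝒜).Opens} (m : Γ(F, U))
    (e : Γ(tilde (GrMod.twist 𝒜 0), U)) :
    (rightUnit F).app U (tmulSection m e) = coeff U e • m :=
  tensDesc_tmulSection _ _ _ _

theorem rightUnit_bijective (F : (projPlus 𝒜).Modules) (U : (projPlus 𝒜).Opens) :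
    Function.Bijective ((rightUnit F).app U) :=
  tensDesc_bijective _ _ ⊤ (fun V _ => bijective_lift_of_generator (smul_unitSection_bijective V) _ (by
    simp only [LinearMap.mk₂_apply, coeff_unitSection, one_smul]
    exact Function.bijective_id)) U le_top

theorem rightUnit_naturality {F G : (projPlus 𝒜).Modules} (φ : F ⟶ G) :
    ((tensorFunctor (projPlus 𝒜)).map φ).app (tilde (GrMod.twist 𝒜 0)) ≫ rightUnit G =
      rightUnit F ≫ φ :=
  tens_hom_ext fun V m e => by
    refine (congrArg ((rightUnit G).app V) (tens_map_tmulSection_left φ m e)).trans ?_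
    refine (rightUnit_tmulSection G _ e).trans ?_
    refine Eq.trans ?_ (congrArg (φ.app V) (rightUnit_tmulSection F m e)).symm
    exact (φ.app_smul _ _).symm

end Twists

/-! ### Transport of the localization property -/

section Localizing

variable {X : Scheme.{u}}

theorem isLocalizingOn_iff_of_bijective {F G : X.Modules} (φ : F ⟶ G) {U V W : X.Opens}
    {hVU : V ≤ U} {hWV : W ≤ V} {r : Γ(X, U)} (hV : Function.Bijective (φ.app V))
    (hW : Function.Bijective (φ.app W)) :
    IsLocalizingOn F hVU hWV r ↔ IsLocalizingOn G hVU hWV r := by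
  constructor
  · intro H
    constructor
    · intro s
      obtain ⟨s, rfl⟩ := hW.2 s
      obtain ⟨n, t, ht⟩ := H.exists_extension s
      exact ⟨n, φ.app V t, by rw [res_app, ht, φ.app_smul]⟩
    · intro t ht
      obtain ⟨t, rfl⟩ := hV.2 t
      rw [res_app] at ht
      obtain ⟨n, hn⟩ := H.exists_pow_smul_eq_zero t (hW.1 (ht.trans (map_zero _).symm))
      exact ⟨n, by rw [← φ.app_smul, hn, map_zero]⟩
  · intro H
    constructor
    · intro s
      obtain ⟨n, t, ht⟩ := H.exists_extension (φ.app W s)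
      obtain ⟨t, rfl⟩ := hV.2 t
      exact ⟨n, t, hW.1 (by rw [← res_app, ht, φ.app_smul])⟩
    · intro t ht
      obtain ⟨n, hn⟩ := H.exists_pow_smul_eq_zero (φ.app V t) (by rw [res_app, ht, map_zero])
      exact ⟨n, hV.1 (by rw [φ.app_smul, hn, map_zero])⟩

end Localizing

/-! ### Serre's extension lemma for twists by multiples of `d` -/

section Extension

variable {A : Type u} [CommRing A] {𝒜 : ℤ → AddSubgroup A} [GradedRing 𝒜]

variable (𝒜) in
/-- The basic open subset `D(g)` of the scheme `Proj⁺(A)`. -/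
def dOpen (g : nonneg 𝒜) : (projPlus 𝒜).Opens := basicOpen g

theorem basicOpen_le_pow (g : nonneg 𝒜) (n : ℕ) : basicOpen g ≤ basicOpen (g ^ n) :=
  fun _ hx => mem_basicOpen.mpr (pow_mem (mem_basicOpen.mp hx) n)

theorem basicOpen_mul (f g : nonneg 𝒜) : basicOpen (f * g) = basicOpen f ⊓ basicOpen g :=
  ProjectiveSpectrum.basicOpen_mul _ f g

/-- Over `D(g)` the property is carried from the quasi-coherent sheaf `F` along `F ← F ⊗ Ã(0) → F ⊗
Ã(d(nl + i)) ← F ⊗ Ã(di)`. The last two arrows are multiplication by `w` and by `g ^ l`, invertible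
on `D(g)`. -/
theorem isLocalizingOn_tw {F : (projPlus 𝒜).Modules} (hF : isQCoh (projPlus 𝒜) F) {d n : ℕ}
    (hd : 0 < d) {g : nonneg 𝒜} {u v : A} (H : IsUnitCover (𝒜 := 𝒜) d n g u v) (i : ℤ)
    (r : Γ(projPlus 𝒜, basicOpen g)) : IsLocalizingOn (tw F (d * i)) (U := basicOpen g)
      (V := basicOpen g) le_rfl ((projPlus 𝒜).basicOpen_le r) r := by
  have hr := (projPlus 𝒜).basicOpen_le r
  have h0 : IsLocalizingOn F (U := basicOpen g) (V := basicOpen g) le_rfl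
      ((projPlus 𝒜).basicOpen_le r) r := isLocalizingOn_of_isQuasicoherent F hF
    (Proj.isAffineOpen_basicOpen (nonnegGrading 𝒜) g H.mem (Nat.mul_pos hd H.pos)) r
  obtain ⟨l, w, w', hw, hw', e⟩ := H.exists_mul_eq i
  have h1 := (isLocalizingOn_iff_of_bijective (rightUnit F) (rightUnit_bijective F _)
    (rightUnit_bijective F _)).mpr h0
  have b1 := twMul_bijective F hw (add_zero _) (pow_mem_nonnegGrading H.mem (2 * l) rfl)
    (e.trans (by push_cast; rfl))
  have h2 := (isLocalizingOn_iff_of_bijective _ (b1 _ (basicOpen_le_pow g _))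
    (b1 _ (hr.trans (basicOpen_le_pow g _)))).mp h1
  have hgl := pow_mem_nonnegGrading H.mem l rfl
  have b2 := twMul_bijective F (i := d * i) (k := d * (n * l + i)) (b := 1)
    ((mem_nonnegGrading 𝒜).mp hgl) (by push_cast; ring) hgl (mul_one _)
  exact (isLocalizingOn_iff_of_bijective _ (b2 _ (basicOpen_le_pow g _))
    (b2 _ (hr.trans (basicOpen_le_pow g _)))).mpr h2

/-- The function `a / s` on an open subset of `D(s)`. -/
def fracFun {N : ℕ} {a s : nonneg 𝒜} (ha : a ∈ nonnegGrading 𝒜 N) (hs : s ∈ nonnegGrading 𝒜 N)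
    (V : Opens (top 𝒜)) (hV : V ≤ basicOpen s) : structureSections 𝒜 V :=
  ⟨fun x => HomogeneousLocalization.mk ⟨N, ⟨a, ha⟩, ⟨s, hs⟩, hV x.2⟩, fun x =>
    ⟨V, x.2, 𝟙 _, N, ⟨a, ha⟩, ⟨s, hs⟩, fun y => hV y.2, fun _ => rfl⟩⟩

theorem mul_fracFun_val {N : ℕ} {a s : nonneg 𝒜} (ha : a ∈ nonnegGrading 𝒜 N)
    (hs : s ∈ nonnegGrading 𝒜 N) (V : Opens (top 𝒜)) (hV : V ≤ basicOpen s)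
    (x : ProjectiveSpectrum (nonnegGrading 𝒜)) (hx : x ∈ V) :
    algebraMap (nonneg 𝒜) (Localization (compl x)) s * ((fracFun ha hs V hV).1 ⟨x, hx⟩).val =
      algebraMap (nonneg 𝒜) (Localization (compl x)) a := by
  have : ((fracFun ha hs V hV).1 ⟨x, hx⟩).val = Localization.mk a (⟨s, hV hx⟩ : compl x) :=
    HomogeneousLocalization.val_mk _
  rw [this, ← Localization.mk_one_eq_algebraMap, ← Localization.mk_one_eq_algebraMap,
    Localization.mk_mul, Localization.mk_eq_mk_iff, Localization.r_iff_exists]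
  exact ⟨1, by push_cast; ring⟩

/-- Multiplication by the power of a homogeneous element on the twists of an `𝒪`-module. -/
def powMul (F : (projPlus 𝒜).Modules) {e : ℕ} {f : nonneg 𝒜} (hf : f ∈ nonnegGrading 𝒜 e) (K : ℕ)
    {i k : ℤ} (h : (K * e : ℕ) + i = k) : tw F i ⟶ tw F k :=
  twMul F ((mem_nonnegGrading 𝒜).mp (pow_mem_nonnegGrading hf K rfl)) h

theorem powMul_powMul (F : (projPlus 𝒜).Modules) {e : ℕ} {f : nonneg 𝒜}
    (hf : f ∈ nonnegGrading 𝒜 e) {K K' L : ℕ} (hL : K + K' = L) {i k l : ℤ}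
    (h : (K * e : ℕ) + i = k) (h' : (K' * e : ℕ) + k = l) (h'' : (L * e : ℕ) + i = l)
    {U : (projPlus 𝒜).Opens} (t : Γ(tw F i, U)) :
    (powMul F hf K' h').app U ((powMul F hf K h).app U t) = (powMul F hf L h'').app U t :=
  twMul_twMul F _ _ _ _ _ _ (by subst hL; push_cast; ring) t

variable {F : (projPlus 𝒜).Modules}

/-- The elements `f ^ n` and `g ^ m` have equal degree, so `r = f ^ n / g ^ m` is a function on
`D(g)`, and `D(r) = D(g) ∩ D(f)`. The localization property for `r` becomes a statement about powers
of `f` through `g ^ (mN) r ^ N = f ^ (nN)`. All exponents beyond a bound are allowed, so that one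
exponent serves a finite covering. -/
theorem exists_powMul_eq_res (hF : isQCoh (projPlus 𝒜) F) {d n : ℕ}
    (hd : 0 < d) {g : nonneg 𝒜} {u v : A} (H : IsUnitCover (𝒜 := 𝒜) d n g u v) {m : ℕ}
    {f : nonneg 𝒜} (hf : f ∈ nonnegGrading 𝒜 (d * m)) (i : ℤ) :
    (∀ t : Γ(tw F (d * i), dOpen 𝒜 g ⊓ dOpen 𝒜 f), ∃ K, ∀ K', K ≤ K' →
      ∀ (k : ℤ) (h : (K' * (d * m) : ℕ) + d * i = k), ∃ t' : Γ(tw F k, dOpen 𝒜 g),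
        res _ inf_le_left t' = (powMul F hf K' h).app _ t) ∧
    (∀ t : Γ(tw F (d * i), dOpen 𝒜 g),
      res (V := dOpen 𝒜 g ⊓ dOpen 𝒜 f) (tw F (d * i)) inf_le_left t = 0 → ∃ K, ∀ K', K ≤ K' →
      ∀ (k : ℤ) (h : (K' * (d * m) : ℕ) + d * i = k), (powMul F hf K' h).app _ t = 0) := by
  have hfn : f ^ n ∈ nonnegGrading 𝒜 (n * (d * m)) := pow_mem_nonnegGrading hf n rfl
  have hgm : g ^ m ∈ nonnegGrading 𝒜 (n * (d * m)) := pow_mem_nonnegGrading H.mem m (by ring)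
  let r := fracFun hfn hgm (basicOpen g) (basicOpen_le_pow g m)
  have hr := mul_fracFun_val hfn hgm (basicOpen g) (basicOpen_le_pow g m)
  have hW : basicOpen g ⊓ basicOpen f = (projPlus 𝒜).basicOpen (U := basicOpen g) r := by
    rw [← scheme_basicOpen_eq (k := m) (a := f ^ n) r fun x => by rw [← map_pow]; exact hr x.1 x.2,
      basicOpen_mul]
    congr 1
    exact (ProjectiveSpectrum.basicOpen_pow _ f n H.pos).symm
  have hloc : IsLocalizingOn (tw F (d * i)) (U := dOpen 𝒜 g) (V := dOpen 𝒜 g)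
      (W := dOpen 𝒜 g ⊓ dOpen 𝒜 f) le_rfl inf_le_left r :=
    isLocalizingOn_congr (isLocalizingOn_tw hF hd H i r) rfl hW.symm le_rfl inf_le_left
  have hrN : ∀ (N : ℕ) (x : ProjectiveSpectrum (nonnegGrading 𝒜)) (hx : x ∈ basicOpen g),
      algebraMap (nonneg 𝒜) (Localization (compl x)) (g ^ (m * N)) *
        ((r ^ N).1 ⟨x, hx⟩).val = algebraMap (nonneg 𝒜) (Localization (compl x)) (f ^ (n * N)) :=
    fun N x hx => by
      rw [val_pow_apply r N x hx, pow_mul, pow_mul, map_pow _ _ N, map_pow _ _ N, ← mul_pow,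
        hr x hx]
  have hfN : ∀ N, f ^ (n * N) ∈ nonnegGrading 𝒜 (n * N * (d * m)) := fun N =>
    pow_mem_nonnegGrading hf _ rfl
  have hgN : ∀ N, g ^ (m * N) ∈ nonnegGrading 𝒜 (n * N * (d * m)) := fun N =>
    pow_mem_nonnegGrading H.mem _ (by ring)
  constructor
  · intro t
    obtain ⟨N, t', ht'⟩ := hloc.exists_extension t
    refine ⟨n * N, fun K' hK k h => ?_⟩
    obtain ⟨K, rfl⟩ := Nat.exists_eq_add_of_le hK
    have h2 : ((K * (d * m) : ℕ) : ℤ) + ((n * N * (d * m) : ℕ) + d * i) = k := by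
      rw [← h]; push_cast; ring
    -- Since `t'` restricts to `r ^ N t`, the section `g ^ (mN) t'` restricts to `f ^ (nN) t`; the
    -- remaining factor `f ^ K` brings the exponent up to the prescribed one.
    refine ⟨(powMul F hf K h2).app _
      ((twMul F ((mem_nonnegGrading 𝒜).mp (hgN N)) rfl).app _ t'), ?_⟩
    rw [res_app, res_app, ht']
    refine (congrArg ((powMul F hf K h2).app _) (twMul_smul_eq F _
      ((mem_nonnegGrading 𝒜).mp (hfN N)) rfl _ (fun x hx => ?_) t)).trans ?_
    · exact hrN N x hx.1
    · exact powMul_powMul F hf rfl rfl h2 h t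
  · intro t ht
    obtain ⟨N, hN⟩ := hloc.exists_pow_smul_eq_zero t ht
    refine ⟨n * N, fun K' hK k h => ?_⟩
    obtain ⟨K, rfl⟩ := Nat.exists_eq_add_of_le hK
    have h2 : ((K * (d * m) : ℕ) : ℤ) + ((n * N * (d * m) : ℕ) + d * i) = k := by
      rw [← h]; push_cast; ring
    rw [← powMul_powMul F hf rfl rfl h2 h t]
    have e1 := twMul_smul_eq F ((mem_nonnegGrading 𝒜).mp (hgN N))
      ((mem_nonnegGrading 𝒜).mp (hfN N)) (i := d * i) rfl
      (rres (le_refl (dOpen 𝒜 g)) r ^ N) (fun x hx => hrN N x hx) t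
    rw [hN, map_zero] at e1
    exact (congrArg ((powMul F hf K h2).app _) e1.symm).trans (map_zero _)

/-- Gives local units on the overlap `D(g) ∩ D(g') = D(g g')`, where the extension lemma is applied
to differences of local extensions. -/
theorem IsUnitCover.mul {d n n' : ℕ} {g g' : nonneg 𝒜} {u v u' v' : A}
    (H : IsUnitCover (𝒜 := 𝒜) d n g u v) (H' : IsUnitCover (𝒜 := 𝒜) d n' g' u' v') :
    IsUnitCover (𝒜 := 𝒜) d (n + n') (g * g') (u * g') (v * g') where
  pos := Nat.add_pos_left H.pos _
  mem := mul_mem_nonnegGrading H.mem H'.mem (by ring)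
  mem_left := by
    have := SetLike.GradedMul.mul_mem H.mem_left ((mem_nonnegGrading 𝒜).mp H'.mem)
    convert! this using 2
    push_cast
    ring
  mem_right := by
    have := SetLike.GradedMul.mul_mem H.mem_right ((mem_nonnegGrading 𝒜).mp H'.mem)
    convert! this using 2
    push_cast
    ring
  mul_eq := by
    push_cast
    linear_combination (g' : A) ^ 2 * H.mul_eq

theorem exists_finite_unitCover [IsNoetherianRing (nonneg 𝒜)] {d : ℕ} (hd : 0 < d)
    (hC : IsPositivelyCartier 𝒜 d) : ∃ (ι : Type u) (_ : Finite ι) (n : ι → ℕ) (g : ι → nonneg 𝒜)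
      (u v : ι → A), (∀ a, IsUnitCover (𝒜 := 𝒜) d (n a) (g a) (u a) (v a)) ∧
        ∀ x : top 𝒜, ∃ a, x ∈ dOpen 𝒜 (g a) := by
  have hc : NoetherianSpace (top 𝒜) := noetherianSpace_top
  choose n g u v hg H using exists_isUnitCover hd hC
  obtain ⟨t, -, ht⟩ := (isCompact_univ (X := top 𝒜)).elim_nhds_subcover
    (fun x => (basicOpen (g x) : Set (top 𝒜))) fun x _ =>
      (basicOpen (g x)).2.mem_nhds (mem_basicOpen.mpr (hg x))
  refine ⟨t, inferInstance, fun a => n a.1, fun a => g a.1, fun a => u a.1, fun a => v a.1,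
    fun a => H a.1, fun x => ?_⟩
  obtain ⟨a, ha, hxa⟩ := Set.mem_iUnion₂.mp (ht (Set.mem_univ x))
  exact ⟨⟨a, ha⟩, hxa⟩

theorem exists_forall_ge {ι : Type*} [Finite ι] {p : ι → ℕ → Prop}
    (h : ∀ a, ∃ K, ∀ K' ≥ K, p a K') : ∃ K, ∀ a, ∀ K' ≥ K, p a K' := by
  choose K hK using h
  obtain ⟨M, hM⟩ := (Set.finite_range K).bddAbove
  exact ⟨M, fun a K' h => hK a K' ((hM ⟨a, rfl⟩).trans h)⟩

variable [IsNoetherianRing (nonneg 𝒜)] {d : ℕ} {m : ℕ} {f : nonneg 𝒜}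

/-- A global section of `F ⊗ Ã(di)` which vanishes on `D(f)` is killed by a power of `f`. -/
theorem exists_powMul_eq_zero (hF : isQCoh (projPlus 𝒜) F) (hd : 0 < d)
    (hC : IsPositivelyCartier 𝒜 d) (hf : f ∈ nonnegGrading 𝒜 (d * m)) {i j : ℤ}
    (hj : j = d * i) (y : Γ(tw F j, ⊤)) (hy : res (V := dOpen 𝒜 f) (tw F j) le_top y = 0) :
    ∃ K : ℕ, ∀ (k : ℤ) (h : (K * (d * m) : ℕ) + j = k), (powMul F hf K h).app _ y = 0 := by
  subst hj
  obtain ⟨ι, _, n, g, u, v, H, hcov⟩ := exists_finite_unitCover hd hC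
  have hloc := fun a => (exists_powMul_eq_res hF hd (H a) hf i).2 (res _ le_top y) (by
    have := congrArg (res (V := dOpen 𝒜 (g a) ⊓ dOpen 𝒜 f) (tw F (d * i)) inf_le_right) hy
    rw [map_zero, res_res] at this
    rw [res_res]
    exact this)
  obtain ⟨K, hK⟩ := exists_forall_ge hloc
  refine ⟨K, fun k h => section_ext _ fun x _ => ?_⟩
  obtain ⟨a, hx⟩ := hcov x
  exact ⟨dOpen 𝒜 (g a), le_top, hx, by rw [res_app, hK a K le_rfl, map_zero]⟩

/-- A section of `F ⊗ Ã(di)` over `D(f)` extends after multiplication by a power of `f`. -/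
theorem exists_res_eq_powMul (hF : isQCoh (projPlus 𝒜) F) (hd : 0 < d)
    (hC : IsPositivelyCartier 𝒜 d) (hf : f ∈ nonnegGrading 𝒜 (d * m)) {i j : ℤ}
    (hj : j = d * i) (t : Γ(tw F j, dOpen 𝒜 f)) :
    ∃ (K : ℕ) (k : ℤ) (h : (K * (d * m) : ℕ) + j = k) (y : Γ(tw F k, ⊤)),
      res _ le_top y = (powMul F hf K h).app _ t := by
  subst hj
  obtain ⟨ι, _, n, g, u, v, H, hcov⟩ := exists_finite_unitCover hd hC
  obtain ⟨K, hK⟩ := exists_forall_ge fun a =>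
    (exists_powMul_eq_res hF hd (H a) hf i).1 (res _ inf_le_right t)
  have hk : ((K * (d * m) : ℕ) : ℤ) + d * i = d * (K * m + i) := by push_cast; ring
  choose t' ht' using fun a => hK a K le_rfl _ hk
  -- On an overlap two local extensions agree on `D(f)`, both being `f ^ K t` there; so their
  -- difference is killed by a further power of `f`, after which they glue.
  have hglue : ∀ ab : ι × ι, ∃ L, ∀ L' ≥ L, ∀ (k : ℤ)
      (h : (L' * (d * m) : ℕ) + d * (K * m + i) = k),
      res _ inf_le_left ((powMul F hf L' h).app _ (t' ab.1)) =
        res (V := dOpen 𝒜 (g ab.1) ⊓ dOpen 𝒜 (g ab.2)) _ inf_le_right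
          ((powMul F hf L' h).app _ (t' ab.2)) := by
    intro ⟨a, b⟩
    have hab : dOpen 𝒜 (g a * g b) = dOpen 𝒜 (g a) ⊓ dOpen 𝒜 (g b) := basicOpen_mul _ _
    have h1 : dOpen 𝒜 (g a * g b) ≤ dOpen 𝒜 (g a) := hab ▸ inf_le_left
    have h2 : dOpen 𝒜 (g a * g b) ≤ dOpen 𝒜 (g b) := hab ▸ inf_le_right
    obtain ⟨L, hL⟩ := (exists_powMul_eq_res hF hd ((H a).mul (H b)) hf (K * m + i)).2
      (res _ h1 (t' a) - res _ h2 (t' b)) (by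
        have e1 := congrArg (res (V := dOpen 𝒜 (g a * g b) ⊓ dOpen 𝒜 f) _
          (inf_le_inf_right _ h1)) (ht' a)
        have e2 := congrArg (res (V := dOpen 𝒜 (g a * g b) ⊓ dOpen 𝒜 f) _
          (inf_le_inf_right _ h2)) (ht' b)
        rw [res_res, res_app, res_res] at e1 e2
        rw [map_sub, res_res, res_res, sub_eq_zero, e1, e2])
    refine ⟨L, fun L' hL' k h => ?_⟩
    have := hL L' hL' k h
    rw [map_sub, sub_eq_zero, ← res_app, ← res_app] at this
    have h3 := hab.ge
    have e := congrArg (res _ h3) this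
    rwa [res_res, res_res] at e
  obtain ⟨L, hL⟩ := exists_forall_ge hglue
  have hkl : ((L * (d * m) : ℕ) : ℤ) + d * (K * m + i) = (((K + L) * (d * m) : ℕ) : ℤ) + d * i := by
    push_cast; ring
  obtain ⟨y, hy⟩ := exists_glue (tw F _) (fun a => dOpen 𝒜 (g a)) ⊤ (fun _ => le_top)
    (fun x _ => hcov x) (fun a => (powMul F hf L hkl).app _ (t' a))
    fun a b => hL (a, b) L le_rfl _ hkl
  refine ⟨K + L, _, rfl, y, section_ext _ fun x hx => ?_⟩
  obtain ⟨a, hxa⟩ := hcov x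
  refine ⟨dOpen 𝒜 (g a) ⊓ dOpen 𝒜 f, inf_le_right, ⟨hxa, hx⟩, ?_⟩
  have e1 := congrArg (res (V := dOpen 𝒜 (g a) ⊓ dOpen 𝒜 f) _ inf_le_left) (hy a)
  rw [res_res, res_app, ht', powMul_powMul F hf rfl hk hkl rfl, ← res_app] at e1
  rw [res_res, e1]

end Extension

/-! ### From the sheaf associated with `⨁ᵢ H⁰(F ⊗ Ã(i))` to `F` -/

section Counit

variable {A : Type u} [CommRing A] {𝒜 : ℤ → AddSubgroup A} [GradedRing 𝒜]

/-- Multiplication by a homogeneous element of `A_{≥ 0}` on the twists of an `𝒪`-module. -/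
def nMul (F : (projPlus 𝒜).Modules) {n : ℕ} {b : nonneg 𝒜} (hb : b ∈ nonnegGrading 𝒜 n)
    {i k : ℤ} (h : n + i = k) : tw F i ⟶ tw F k :=
  twMul F ((mem_nonnegGrading 𝒜).mp hb) h

theorem nMul_nMul (F : (projPlus 𝒜).Modules) {n n' n'' : ℕ} {a b c : nonneg 𝒜}
    (ha : a ∈ nonnegGrading 𝒜 n) (hb : b ∈ nonnegGrading 𝒜 n') (hc : c ∈ nonnegGrading 𝒜 n'')
    {i k l : ℤ} (h : n + i = k) (h' : n' + k = l) (h'' : n'' + i = l) (e : b * a = c)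
    {U : (projPlus 𝒜).Opens} (t : Γ(tw F i, U)) :
    (nMul F hb h').app U ((nMul F ha h).app U t) = (nMul F hc h'').app U t :=
  twMul_twMul F _ _ _ _ _ _ (congrArg Subtype.val e) t

/-- Valid whether or not `d` divides `n`: over `D(b)` the element `b` is a unit of degree `n`. It
allows `y / g` to be evaluated for denominators of every degree. -/
theorem nMul_bijective (F : (projPlus 𝒜).Modules) {n : ℕ} {b : nonneg 𝒜}
    (hb : b ∈ nonnegGrading 𝒜 n) {i k : ℤ} (h : n + i = k) {U : (projPlus 𝒜).Opens}
    (hU : U ≤ dOpen 𝒜 b) : Function.Bijective ((nMul F hb h).app U) :=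
  twMul_bijective F _ h hb (mul_one _) U hU

theorem GammaStar.nonneg_smul_of (F : (projPlus 𝒜).Modules) {n : ℕ} {b : nonneg 𝒜}
    (hb : b ∈ nonnegGrading 𝒜 n) {i k : ℤ} (h : n + i = k) (y : Γ(tw F i, ⊤)) :
    b • (show (gammaStar F).carrier from GammaStar.of F i y) =
      GammaStar.of F k ((nMul F hb h).app ⊤ y) := by
  subst h
  exact GammaStar.smul_of F ⟨(b : A), hb⟩ y

theorem GammaStar.of_injective (F : (projPlus 𝒜).Modules) (i : ℤ) :
    Function.Injective (GammaStar.of F i) :=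
  DirectSum.of_injective (β := twistedSections F) i

/-- The section `y / g` of the sheaf associated with `⨁ᵢ H⁰(F ⊗ Ã(i))`. -/
def gammaFrac (F : (projPlus 𝒜).Modules) {n : ℕ} {g : nonneg 𝒜} (hg : g ∈ nonnegGrading 𝒜 n)
    (y : Γ(tw F n, ⊤)) (W : (projPlus 𝒜).Opens) (hW : W ≤ dOpen 𝒜 g) :
    Γ(tilde (gammaStar F), W) :=
  fracSection (gammaStar F) (n := n) (m := GammaStar.of F n y) ⟨y, rfl⟩ hg W hW

/-- Near a point, `y / g = y' / g'` means `c g' y = c g y'` with `c` homogeneous and nonzero there.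
From `g t = y` follows `c g (g' t) = c g' y = c g y'`, and `c g` cancels on `D(c g)`. -/
theorem nMul_eq_of_gammaFrac_eq (F : (projPlus 𝒜).Modules) {n n' : ℕ} {g g' : nonneg 𝒜}
    (hg : g ∈ nonnegGrading 𝒜 n) (hg' : g' ∈ nonnegGrading 𝒜 n') {y : Γ(tw F n, ⊤)}
    {y' : Γ(tw F n', ⊤)} {W : (projPlus 𝒜).Opens} (hW : W ≤ dOpen 𝒜 g) (hW' : W ≤ dOpen 𝒜 g')
    (e : gammaFrac F hg y W hW = gammaFrac F hg' y' W hW') {t : Γ(tw F 0, W)}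
    (ht : (nMul F hg (add_zero _)).app W t = res _ le_top y) :
    (nMul F hg' (add_zero _)).app W t = res _ le_top y' := by
  refine section_ext _ fun x hx => ?_
  have ex : (LocalizedModule.mk (GammaStar.of F n y : (gammaStar F).carrier) ⟨g, hW hx⟩ :
      Loc (gammaStar F) x) =
      LocalizedModule.mk (GammaStar.of F n' y' : (gammaStar F).carrier) ⟨g', hW' hx⟩ :=
    congrFun (congrArg Subtype.val e) (⟨x, hx⟩ : (show Opens (top 𝒜) from W))
  obtain ⟨w, hw⟩ := LocalizedModule.mk_eq.mp ex
  have hw' : w.1 • (GammaStar.of F (n' + n) ((nMul F hg' rfl).app ⊤ y) -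
      GammaStar.of F (n' + n) ((nMul F hg (add_comm _ _)).app ⊤ y') : (gammaStar F).carrier) = 0 := by
    rw [smul_sub, sub_eq_zero]
    have e1 := GammaStar.nonneg_smul_of F hg' (k := n' + n) rfl y
    have e2 := GammaStar.nonneg_smul_of F hg (k := n' + n) (add_comm _ _) y'
    exact (congrArg (w.1 • ·) e1).symm.trans (hw.trans (congrArg (w.1 • ·) e2))
  obtain ⟨k, c, hc, hcx, hce⟩ := exists_homogeneous_smul_eq_zero (M := gammaStar F)
    (sub_mem ⟨_, rfl⟩ ⟨_, rfl⟩) w.2 hw'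
  have hce' : (nMul F hc rfl).app ⊤ ((nMul F hg' (k := n' + n) rfl).app ⊤ y) =
      (nMul F hc rfl).app ⊤ ((nMul F hg (k := n' + n) (add_comm _ _)).app ⊤ y') := by
    have hce := sub_eq_zero.mp ((smul_sub c (M := nonneg 𝒜) (A := (gammaStar F).carrier)
      _ _).symm.trans hce)
    have e1 := GammaStar.nonneg_smul_of F hc rfl ((nMul F hg' (k := n' + n) rfl).app ⊤ y)
    have e2 := GammaStar.nonneg_smul_of F hc rfl
      ((nMul F hg (k := n' + n) (add_comm _ _)).app ⊤ y')
    exact GammaStar.of_injective F _ (e1.symm.trans (hce.trans e2))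
  have hcg : c * g ∈ nonnegGrading 𝒜 (k + n) := mul_mem_nonnegGrading hc hg rfl
  have hcg' : c * g' ∈ nonnegGrading 𝒜 (k + n') := mul_mem_nonnegGrading hc hg' rfl
  have hV : W ⊓ dOpen 𝒜 c ≤ dOpen 𝒜 (c * g) := fun z hz =>
    (compl (𝒜 := 𝒜) z).mul_mem hz.2 (hW hz.1)
  have h1 : ((k + n : ℕ) : ℤ) + n' = k + (n' + n) := by push_cast; ring
  have h2 : ((k + n' : ℕ) : ℤ) + n = k + (n' + n) := by push_cast; ring
  refine ⟨W ⊓ dOpen 𝒜 c, inf_le_left, ⟨hx, hcx⟩, (nMul_bijective F hcg h1 hV).1 ?_⟩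
  have hcgg : c * g * g' ∈ nonnegGrading 𝒜 (k + n + n') := mul_mem_nonnegGrading hcg hg' rfl
  have e1 := congrArg (res (V := W ⊓ dOpen 𝒜 c) _ le_top) hce'
  rw [res_app, res_app, res_app, res_app, nMul_nMul F hg' hc hcg' rfl rfl h2 rfl,
    nMul_nMul F hg hc hcg (add_comm _ _) rfl h1 rfl,
    ← res_res _ le_top (inf_le_left : W ⊓ dOpen 𝒜 c ≤ W), ← ht, res_app,
    nMul_nMul F hg hcg' hcgg (add_zero _) h2 (by push_cast; ring) (by ring)] at e1
  rw [res_res, ← e1, res_app,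
    nMul_nMul F hg' hcg hcgg (add_zero _) h1 (by push_cast; ring) rfl]

/-- The section `t` of `F ⊗ Ã(0)` is the value of the section `s` of the sheaf associated with
`⨁ᵢ H⁰(F ⊗ Ã(i))`: locally, `s = y / g` and `g t = y`. -/
def IsValue (F : (projPlus 𝒜).Modules) {V : (projPlus 𝒜).Opens} (s : Γ(tilde (gammaStar F), V))
    (t : Γ(tw F 0, V)) : Prop :=
  ∀ x ∈ V, ∃ (n : ℕ) (g : nonneg 𝒜) (hg : g ∈ nonnegGrading 𝒜 n) (y : Γ(tw F n, ⊤))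
    (W : (projPlus 𝒜).Opens) (hW : W ≤ dOpen 𝒜 g) (hWV : W ≤ V), x ∈ W ∧
    res _ hWV s = gammaFrac F hg y W hW ∧
    (nMul F hg (add_zero _)).app W (res _ hWV t) = res _ le_top y

variable {F : (projPlus 𝒜).Modules} {V : (projPlus 𝒜).Opens}

theorem IsValue.res {s : Γ(tilde (gammaStar F), V)} {t : Γ(tw F 0, V)} (h : IsValue F s t)
    {W : (projPlus 𝒜).Opens} (hW : W ≤ V) :
    IsValue F (res _ hW s) (GradedProj.res _ hW t) := fun x hx => by
  obtain ⟨n, g, hg, y, W', hW', hWV', hxW', e, e'⟩ := h x (hW hx)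
  refine ⟨n, g, hg, y, W' ⊓ W, inf_le_left.trans hW', inf_le_right, ⟨hxW', hx⟩, ?_, ?_⟩
  · have := congrArg (GradedProj.res _ (inf_le_left : W' ⊓ W ≤ W')) e
    rw [res_res] at this
    rw [res_res]
    exact this
  · have := congrArg (GradedProj.res _ (inf_le_left : W' ⊓ W ≤ W')) e'
    rw [res_app, res_res, res_res] at this
    rw [res_res]
    exact this

theorem IsValue.unique {s : Γ(tilde (gammaStar F), V)} {t t' : Γ(tw F 0, V)} (h : IsValue F s t)
    (h' : IsValue F s t') : t = t' := by
  refine section_ext _ fun x hx => ?_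
  obtain ⟨n, g, hg, y, W, hW, hWV, hxW, e, e'⟩ := h x hx
  obtain ⟨n', g', hg', y', W', hW', hWV', hxW', e1, e1'⟩ := h' x hx
  refine ⟨W ⊓ W', inf_le_left.trans hWV, ⟨hxW, hxW'⟩, ?_⟩
  have a := congrArg (GradedProj.res _ (inf_le_left : W ⊓ W' ≤ W)) e
  have a' := congrArg (GradedProj.res _ (inf_le_left : W ⊓ W' ≤ W)) e'
  have b := congrArg (GradedProj.res _ (inf_le_right : W ⊓ W' ≤ W')) e1
  have b' := congrArg (GradedProj.res _ (inf_le_right : W ⊓ W' ≤ W')) e1'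
  rw [res_res] at a b
  rw [res_app, res_res, res_res] at a' b'
  refine (nMul_bijective F hg' (add_zero _) (inf_le_right.trans hW' : W ⊓ W' ≤ _)).1 ?_
  refine Eq.trans ?_ b'.symm
  exact nMul_eq_of_gammaFrac_eq F hg hg' (inf_le_left.trans hW) (inf_le_right.trans hW')
    (a.symm.trans b) a'

theorem IsValue.of_locally {s : Γ(tilde (gammaStar F), V)} {t : Γ(tw F 0, V)}
    (h : ∀ x ∈ V, ∃ (W : (projPlus 𝒜).Opens) (hW : W ≤ V), x ∈ W ∧
      IsValue F (GradedProj.res _ hW s) (GradedProj.res _ hW t)) : IsValue F s t := fun x hx => by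
  obtain ⟨W, hW, hxW, h'⟩ := h x hx
  obtain ⟨n, g, hg, y, W', hW', hWV', hxW', e, e'⟩ := h' x hxW
  refine ⟨n, g, hg, y, W', hW', hWV'.trans hW, hxW', ?_, ?_⟩
  · rwa [res_res] at e
  · rwa [res_res] at e'

/-- Where `s = y / g`, multiplication by `g` is invertible and `t = g⁻¹ y`; uniqueness of values
glues these. -/
theorem exists_isValue (s : Γ(tilde (gammaStar F), V)) : ∃ t, IsValue F s t := by
  obtain ⟨t, ht⟩ := exists_of_locally (tw F 0) V (fun W hW t => IsValue F (res _ hW s) t)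
    (fun W W' hW h t ht => by rw [← res_res _ hW h]; exact ht.res h)
    (fun W hW t t' h h' => h.unique h') (fun x hx => by
      obtain ⟨n, m, ⟨y, hm⟩, g, hg, W, hW, hWV, hxW, e⟩ := exists_eq_fracSection _
        (show sections (gammaStar F) V from s) x hx
      subst hm
      obtain ⟨t, ht⟩ := (nMul_bijective F hg (add_zero _) (U := W) hW).2 (res _ le_top y)
      refine ⟨W, hWV, t, hxW, fun z hz => ⟨n, g, hg, y, W, hW, le_rfl, hz, ?_, ?_⟩⟩
      · exact (res_self _ _ _).trans e
      · exact (congrArg _ (res_self _ _ _)).trans ht)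
  exact ⟨t, IsValue.of_locally ht⟩

theorem IsValue.add {s s' : Γ(tilde (gammaStar F), V)} {t t' : Γ(tw F 0, V)} (h : IsValue F s t)
    (h' : IsValue F s' t') : IsValue F (s + s') (t + t') := fun x hx => by
  obtain ⟨n, g, hg, y, W, hW, hWV, hxW, e, e'⟩ := h x hx
  obtain ⟨n', g', hg', y', W', hW', hWV', hxW', e1, e1'⟩ := h' x hx
  have h1 : (n' : ℤ) + n = (n + n' : ℕ) := by push_cast; ring
  have h2 : (n : ℤ) + n' = (n + n' : ℕ) := by push_cast; ring
  have hgg : g * g' ∈ nonnegGrading 𝒜 (n + n') := mul_mem_nonnegGrading hg hg' rfl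
  refine ⟨n + n', g * g', hgg,
    (nMul F hg' h1).app ⊤ y + (nMul F hg h2).app ⊤ y', W ⊓ W', fun z hz =>
      (compl (𝒜 := 𝒜) z).mul_mem (hW hz.1) (hW' hz.2), inf_le_left.trans hWV, ⟨hxW, hxW'⟩, ?_, ?_⟩
  · have a := congrArg (GradedProj.res _ (inf_le_left : W ⊓ W' ≤ W)) e
    have b := congrArg (GradedProj.res _ (inf_le_right : W ⊓ W' ≤ W')) e1
    rw [res_res] at a b
    rw [map_add, a, b]
    refine Subtype.ext (funext fun z => ?_)
    refine (LocalizedModule.mk_add_mk (S := compl (𝒜 := 𝒜) z.1) (M := (gammaStar F).carrier)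
      (m1 := GammaStar.of F n y) (m2 := GammaStar.of F n' y') (s1 := ⟨g, hW z.2.1⟩)
      (s2 := ⟨g', hW' z.2.2⟩)).trans ?_
    refine congrArg (fun m => (LocalizedModule.mk m _ : Loc (gammaStar F) z.1)) ?_
    exact (congrArg₂ (· + ·) (GammaStar.nonneg_smul_of F hg' h1 y)
      (GammaStar.nonneg_smul_of F hg h2 y')).trans (map_add (GammaStar.of F _) _ _).symm
  · have a := congrArg (GradedProj.res _ (inf_le_left : W ⊓ W' ≤ W)) e'
    have b := congrArg (GradedProj.res _ (inf_le_right : W ⊓ W' ≤ W')) e1'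
    rw [res_app, res_res, res_res] at a b
    rw [map_add, map_add, map_add, res_app, res_app, ← a, ← b,
      nMul_nMul F hg hg' hgg (add_zero _) h1 (add_zero _) (mul_comm _ _),
      nMul_nMul F hg' hg hgg (add_zero _) h2 (add_zero _) rfl]

theorem IsValue.smul {s : Γ(tilde (gammaStar F), V)} {t : Γ(tw F 0, V)} (h : IsValue F s t)
    (r : Γ(projPlus 𝒜, V)) : IsValue F (r • s) (r • t) := fun x hx => by
  obtain ⟨n, g, hg, y, W, hW, hWV, hxW, e, e'⟩ := h x hx
  obtain ⟨W', hxW', i, n', ⟨a, ha⟩, ⟨b, hb⟩, hbW, hr⟩ := (show structureSections 𝒜 V from r).2 ⟨x, hx⟩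
  have hW'V : W' ≤ V := leOfHom i
  have h1 : (n' : ℤ) + n = (n' + n : ℕ) := by push_cast; ring
  have hbg : b * g ∈ nonnegGrading 𝒜 (n' + n) := mul_mem_nonnegGrading hb hg rfl
  have hag : a * g ∈ nonnegGrading 𝒜 (n' + n) := mul_mem_nonnegGrading ha hg rfl
  have hval : ∀ (z : ProjectiveSpectrum (nonnegGrading 𝒜)) (hz : z ∈ W'),
      ((show structureSections 𝒜 V from r).1 ⟨z, hW'V hz⟩).val =
        Localization.mk a ⟨b, hbW ⟨z, hz⟩⟩ := fun z hz =>
    (congrArg HomogeneousLocalization.val (hr ⟨z, hz⟩)).trans (HomogeneousLocalization.val_mk _)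
  let W₂ : (projPlus 𝒜).Opens := W ⊓ W'
  have hW₂ : W₂ ≤ W := inf_le_left
  refine ⟨n' + n, b * g, hbg, (nMul F ha h1).app ⊤ y, W₂, fun z hz =>
    (compl (𝒜 := 𝒜) z).mul_mem (hbW ⟨z, hz.2⟩) (hW hz.1), hW₂.trans hWV, ⟨hxW, hxW'⟩, ?_, ?_⟩
  · have e2 := congrArg (GradedProj.res _ hW₂) e
    rw [res_res] at e2
    rw [res_smul, e2]
    refine Subtype.ext (funext fun z => ?_)
    refine (congrArg (· • (LocalizedModule.mk (GammaStar.of F n y : (gammaStar F).carrier)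
      ⟨g, hW z.2.1⟩ : Loc (gammaStar F) z.1)) (hval z.1 z.2.2)).trans ?_
    refine (LocalizedModule.mk_smul_mk (S := compl (𝒜 := 𝒜) z.1) (M := (gammaStar F).carrier)
      a (GammaStar.of F n y) ⟨b, hbW ⟨z.1, z.2.2⟩⟩ ⟨g, hW z.2.1⟩).trans ?_
    exact congrArg (fun m => (LocalizedModule.mk m _ : Loc (gammaStar F) z.1))
      (GammaStar.nonneg_smul_of F ha h1 y)
  · have e2 := congrArg (GradedProj.res _ hW₂) e'
    rw [res_app, res_res, res_res] at e2
    rw [res_smul, res_app, ← e2,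
      nMul_nMul F hg ha hag (add_zero _) h1 (add_zero _) rfl]
    refine twMul_smul_eq F ((mem_nonnegGrading 𝒜).mp hbg) ((mem_nonnegGrading 𝒜).mp hag)
      (add_zero _) _ (fun z hz => ?_) _
    refine (congrArg (algebraMap (nonneg 𝒜) (Localization (compl z)) (b * g) * ·)
      (hval z hz.2)).trans ?_
    rw [← Localization.mk_one_eq_algebraMap, ← Localization.mk_one_eq_algebraMap,
      Localization.mk_mul, Localization.mk_eq_mk_iff, Localization.r_iff_exists]
    exact ⟨1, by push_cast; ring⟩

/-- The map `F ⊗ Ã(i) ⟶ G ⊗ Ã(i)` induced by a morphism `F ⟶ G`. -/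
abbrev twMap {F G : (projPlus 𝒜).Modules} (φ : F ⟶ G) (i : ℤ) : tw F i ⟶ tw G i :=
  ((tensorFunctor (projPlus 𝒜)).map φ).app (tilde (GrMod.twist 𝒜 i))

theorem twMap_nMul {F G : (projPlus 𝒜).Modules} (φ : F ⟶ G) {n : ℕ} {b : nonneg 𝒜}
    (hb : b ∈ nonnegGrading 𝒜 n) {i k : ℤ} (h : n + i = k) {U : (projPlus 𝒜).Opens}
    (t : Γ(tw F i, U)) : (nMul G hb h).app U ((twMap φ i).app U t) =
      (twMap φ k).app U ((nMul F hb h).app U t) :=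
  (congrArg (fun ψ : tw F i ⟶ tw G k => ψ.app U t)
    (((tensorFunctor (projPlus 𝒜)).map φ).naturality (tildeMap (GrMod.twistMap h
      (⟨b, (mem_nonnegGrading 𝒜).mp hb⟩ : 𝒜 n))))).symm

theorem IsValue.map {G : (projPlus 𝒜).Modules} (φ : F ⟶ G) {s : Γ(tilde (gammaStar F), V)}
    {t : Γ(tw F 0, V)} (h : IsValue F s t) :
    IsValue G ((tildeMap ((gammaStarFunctor 𝒜).map φ)).app V s)
      ((twMap φ 0).app V t) :=
  fun x hx => by
  obtain ⟨n, g, hg, y, W, hW, hWV, hxW, e, e'⟩ := h x hx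
  refine ⟨n, g, hg, (twMap φ n).app ⊤ y, W, hW, hWV, hxW, ?_, ?_⟩
  · refine (res_app (tildeMap ((gammaStarFunctor 𝒜).map φ)) hWV s).trans
      ((congrArg ((tildeMap ((gammaStarFunctor 𝒜).map φ)).app W) e).trans ?_)
    refine Subtype.ext (funext fun z => ?_)
    refine (locMap_mk ((gammaStarFunctor 𝒜).map φ) z.1 (GammaStar.of F n y) _).trans ?_
    exact congrArg (fun m => (LocalizedModule.mk m _ : Loc (gammaStar G) z.1))
      (gammaStarMapAdd_of φ n y)
  · rw [res_app, twMap_nMul, e', res_app]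

/-- The value of a section of the sheaf associated with `⨁ᵢ H⁰(F ⊗ Ã(i))`. -/
def value (s : Γ(tilde (gammaStar F), V)) : Γ(tw F 0, V) := (exists_isValue s).choose

theorem isValue_value (s : Γ(tilde (gammaStar F), V)) : IsValue F s (value s) :=
  (exists_isValue s).choose_spec

theorem IsValue.eq_value {s : Γ(tilde (gammaStar F), V)} {t : Γ(tw F 0, V)} (h : IsValue F s t) :
    value s = t := (isValue_value s).unique h

variable (F) in
/-- The morphism from the sheaf associated with `⨁ᵢ H⁰(F ⊗ Ã(i))` to `F ⊗ Ã(0)`. -/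
def valueMap : tilde (gammaStar F) ⟶ tw F 0 where
  val :=
    { app := fun U => ModuleCat.ofHom (R := Γ(projPlus 𝒜, U.unop))
        (X := Γ(tilde (gammaStar F), U.unop)) (Y := Γ(tw F 0, U.unop))
        { toFun := value
          map_add' := fun s t => ((isValue_value s).add (isValue_value t)).eq_value
          map_smul' := fun r s => ((isValue_value s).smul r).eq_value }
      naturality := fun {U U'} f => by
        ext s
        exact ((isValue_value (V := U.unop) s).res (leOfHom f.unop)).eq_value }

theorem valueMap_naturality {G : (projPlus 𝒜).Modules} (φ : F ⟶ G) :
    tildeMap ((gammaStarFunctor 𝒜).map φ) ≫ valueMap G = valueMap F ≫ twMap φ 0 :=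
  Scheme.Modules.hom_ext _ _ fun U => by
    ext s
    exact ((isValue_value (V := U) s).map φ).eq_value

theorem isValue_gammaFrac {n : ℕ} {g : nonneg 𝒜} (hg : g ∈ nonnegGrading 𝒜 n)
    {y : Γ(tw F n, ⊤)} {W : (projPlus 𝒜).Opens} (hW : W ≤ dOpen 𝒜 g) {t : Γ(tw F 0, W)}
    (ht : (nMul F hg (add_zero _)).app W t = res _ le_top y) :
    IsValue F (gammaFrac F hg y W hW) t := fun z hz =>
  ⟨n, g, hg, y, W, hW, le_rfl, hz, res_self _ _ _, by rw [res_self, ht]⟩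

/-- If `y / g` has value `0`, then `y` vanishes on `D(g)`, so `g ^ K y = 0` and `y / g = 0`.
Conversely, for `t` over `D(g)` some `g ^ K t` extends to a global `y`, and `t` is the value of `y /
g ^ K`. Denominators are taken of degree divisible by `d`, where the extension lemma applies. -/
theorem valueMap_bijective [IsNoetherianRing (nonneg 𝒜)] (hF : isQCoh (projPlus 𝒜) F) {d : ℕ}
    (hd : 0 < d) (hC : IsPositivelyCartier 𝒜 d) (U : (projPlus 𝒜).Opens) :
    Function.Bijective ((valueMap F).app U) := by
  refine bijective_of_locally (valueMap F) ⊤ (fun U _ s hs x hx => ?_) (fun U _ t x hx => ?_) U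
    le_top
  · obtain ⟨n, hn, m, ⟨y, rfl⟩, g, hg, hgU, hxg, e⟩ := exists_eq_fracSection_of_pos
      (gammaStar F) hd (show sections (gammaStar F) U from s) x hx
    have e' : res _ (show dOpen 𝒜 g ≤ U from hgU) s = gammaFrac F hg y (dOpen 𝒜 g) le_rfl := e
    obtain ⟨t, ht⟩ := (nMul_bijective F hg (add_zero _) (U := dOpen 𝒜 g) le_rfl).2
      (res _ le_top y)
    have h1 : IsValue F s 0 := hs ▸ isValue_value s
    have h2 := h1.res (show dOpen 𝒜 g ≤ U from hgU)
    rw [map_zero, e'] at h2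
    rw [(isValue_gammaFrac hg le_rfl ht).unique h2, map_zero] at ht
    obtain ⟨K, hK⟩ := exists_powMul_eq_zero (F := F) hF hd hC hg (i := n) (Nat.cast_mul d n) y
      ht.symm
    refine ⟨dOpen 𝒜 g, hgU, hxg, ?_⟩
    rw [e']
    refine fracSection_eq_zero (gammaStar F) _ hg _ _ (basicOpen_le_pow g K) ?_
    refine (GammaStar.nonneg_smul_of F (pow_mem_nonnegGrading hg K rfl) rfl y).trans ?_
    exact (congrArg (GammaStar.of F _) (hK _ rfl)).trans (map_zero _)
  · obtain ⟨n, g, hn, hg, hxg, hgU⟩ := exists_basicOpen_le hd (U := U) hx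
    have hgU' : dOpen 𝒜 g ≤ U := hgU
    obtain ⟨K, k, h, y, hy⟩ := exists_res_eq_powMul (F := F) hF hd hC hg (i := 0)
      (mul_zero _).symm (res _ hgU' t)
    obtain rfl : k = ((K * (d * n) : ℕ) : ℤ) := by rw [← h, add_zero]
    refine ⟨dOpen 𝒜 g, hgU', gammaFrac F (pow_mem_nonnegGrading hg K rfl) y _
      (basicOpen_le_pow g K), hxg, ?_⟩
    exact (isValue_gammaFrac (pow_mem_nonnegGrading hg K rfl) (basicOpen_le_pow g K)
      hy.symm).eq_value

end Counit

/-! ### The pairing of localized modules `M_S × A_S → M_S` -/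

section Pairing

variable {R A M : Type*} [CommRing R] [CommRing A] [AddCommGroup M] [Algebra R A] [Module R M]
  [Module A M] [IsScalarTower R A M] {S : Submonoid R}

/-- The multiplication by a fraction `a / t ∈ A_S`, on `M_S`. -/
def locPairLeft (q : A × S) (z : LocalizedModule S M) : LocalizedModule S M :=
  LocalizedModule.liftOn z (fun p => LocalizedModule.mk (q.1 • p.1) (p.2 * q.2)) (by
    obtain ⟨a, t⟩ := q
    rintro ⟨m, s⟩ ⟨m', s'⟩ ⟨e, he⟩
    refine LocalizedModule.mk_eq.mpr ⟨e, ?_⟩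
    simp only [Submonoid.smul_def, Submonoid.coe_mul] at he ⊢
    have h (c : R) (x : M) : e.1 • (c * t.1) • a • x = (t.1 • a) • e.1 • c • x := by
      simp only [← algebraMap_smul A (_ : R) (_ : M), Algebra.smul_def, smul_smul, map_mul]
      congr 1
      ring
    rw [h, h, he])

theorem locPairLeft_mk (q : A × S) (m : M) (s : S) :
    locPairLeft q (LocalizedModule.mk m s) = LocalizedModule.mk (q.1 • m) (s * q.2) :=
  LocalizedModule.liftOn_mk ..

/-- The pairing `M_S × A_S → M_S`. -/
def locPair (z : LocalizedModule S M) (w : LocalizedModule S A) : LocalizedModule S M :=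
  LocalizedModule.liftOn w (fun q => locPairLeft q z) (by
    induction z using LocalizedModule.induction_on with
    | h m s =>
      rintro ⟨a, t⟩ ⟨a', t'⟩ ⟨e, he⟩
      rw [locPairLeft_mk, locPairLeft_mk]
      refine LocalizedModule.mk_eq.mpr ⟨e, ?_⟩
      simp only [Submonoid.smul_def, Submonoid.coe_mul] at he ⊢
      have h (c : R) (b : A) : e.1 • (s.1 * c) • b • m = (e.1 • c • b) • s.1 • m := by
        simp only [← algebraMap_smul A (_ : R) (_ : M), Algebra.smul_def, smul_smul, map_mul]
        congr 1
        ring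
      rw [h, h, he])

theorem locPair_mk (m : M) (s : S) (a : A) (t : S) :
    locPair (LocalizedModule.mk m s) (LocalizedModule.mk a t) = LocalizedModule.mk (a • m) (s * t) :=
  (LocalizedModule.liftOn_mk ..).trans (locPairLeft_mk ..)

theorem locPair_add_left (z z' : LocalizedModule S M) (w : LocalizedModule S A) :
    locPair (z + z') w = locPair z w + locPair z' w := by
  induction z, z' using LocalizedModule.induction_on₂ with
  | h m m' s s' =>
    induction w using LocalizedModule.induction_on with
    | h a t =>
      rw [LocalizedModule.mk_add_mk, locPair_mk, locPair_mk, locPair_mk, LocalizedModule.mk_add_mk]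
      refine LocalizedModule.mk_eq.mpr ⟨1, ?_⟩
      simp only [Submonoid.smul_def, Submonoid.coe_mul, smul_add,
        ← algebraMap_smul A (_ : R) (_ : M), smul_smul, map_mul, Submonoid.coe_one, map_one]
      congr 2 <;> ring

theorem locPair_add_right (z : LocalizedModule S M) (w w' : LocalizedModule S A) :
    locPair z (w + w') = locPair z w + locPair z w' := by
  induction w, w' using LocalizedModule.induction_on₂ with
  | h a a' t t' =>
    induction z using LocalizedModule.induction_on with
    | h m s =>
      rw [LocalizedModule.mk_add_mk, locPair_mk, locPair_mk, locPair_mk, LocalizedModule.mk_add_mk]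
      refine LocalizedModule.mk_eq.mpr ⟨1, ?_⟩
      simp only [Submonoid.smul_def, Submonoid.coe_mul, smul_add, add_smul, Algebra.smul_def,
        ← algebraMap_smul A (_ : R) (_ : M), smul_smul, map_mul, Submonoid.coe_one, map_one]
      congr 2 <;> ring

theorem locPair_smul_left (c : Localization S) (z : LocalizedModule S M) (w : LocalizedModule S A) :
    locPair (c • z) w = c • locPair z w := by
  induction c using Localization.induction_on with
  | H c =>
    induction z using LocalizedModule.induction_on with
    | h m s =>
      induction w using LocalizedModule.induction_on with
      | h a t =>
        rw [LocalizedModule.mk_smul_mk, locPair_mk, locPair_mk, LocalizedModule.mk_smul_mk,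
          smul_comm, mul_assoc]

theorem locPair_smul_right (c : Localization S) (z : LocalizedModule S M)
    (w : LocalizedModule S A) : locPair z (c • w) = c • locPair z w := by
  induction c using Localization.induction_on with
  | H c =>
    induction z using LocalizedModule.induction_on with
    | h m s =>
      induction w using LocalizedModule.induction_on with
      | h a t =>
        rw [LocalizedModule.mk_smul_mk, locPair_mk, locPair_mk, LocalizedModule.mk_smul_mk,
          smul_assoc, mul_left_comm]

end Pairing

/-! ### Shifts of graded modules -/

section Shift

variable {A : Type u} [CommRing A] {𝒜 : ℤ → AddSubgroup A}

namespace GrMod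

/-- The shift `M(i)` of a graded module, with `M(i)_n = M_{n + i}`. -/
def shift (M : GrMod 𝒜) (i : ℤ) : GrMod 𝒜 where
  carrier := M.carrier
  deg n := M.deg (n + i)
  smul_mem {j k a m} ha hm := by
    rw [add_assoc]
    exact M.smul_mem ha hm
  isInternal := isInternal_of_projections (fun n => M.proj (n + i)) (fun n m => M.proj_mem _ m)
    (fun n m hm => M.proj_same _ hm) (fun n k h m hm => M.proj_ne (by simpa using h) hm)
    fun m => by
      obtain ⟨s, hs⟩ := M.proj_sum m
      refine ⟨s.map (Equiv.subRight i).toEmbedding, ?_⟩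
      rw [Finset.sum_map]
      simpa using hs

/-- Multiplication by a homogeneous element `a ∈ A_j`, as a morphism `M(i) ⟶ M(k)` for
`k = j + i`. -/
def shiftMap (M : GrMod 𝒜) {i j k : ℤ} (h : j + i = k) (a : 𝒜 j) : M.shift i ⟶ M.shift k where
  toLin := LinearMap.lsmul A M.carrier (a : A)
  map_deg {n m} hm := by
    have := M.smul_mem a.2 hm
    rwa [show j + (n + i) = n + k by omega] at this

/-- The morphism `M(i) ⟶ N(i)` induced by a morphism `M ⟶ N`. -/
def mapShift {M N : GrMod 𝒜} (φ : M ⟶ N) (i : ℤ) : M.shift i ⟶ N.shift i where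
  toLin := φ.toLin
  map_deg hm := φ.map_deg hm

end GrMod

end Shift

/-! ### The comparison `M̃ ⊗ Ã(i) → M(i)~` -/

section Multiplication

theorem app_app_of_comm {X : Scheme.{u}} {F G G' H : X.Modules} {φ : F ⟶ G} {ψ : G ⟶ H}
    {φ' : F ⟶ G'} {ψ' : G' ⟶ H} (h : φ ≫ ψ = φ' ≫ ψ') (U : X.Opens) (t : Γ(F, U)) :
    ψ.app U (φ.app U t) = ψ'.app U (φ'.app U t) :=
  congrArg (fun χ : F ⟶ H => χ.app U t) h

variable {A : Type u} [CommRing A] {𝒜 : ℤ → AddSubgroup A} [GradedRing 𝒜]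

instance (M : GrMod 𝒜) : IsScalarTower (nonneg 𝒜) A M.carrier :=
  ⟨fun r a m => mul_smul (r : A) a m⟩

/-- The product of a section of `M̃` and a section of `Ã(i)`, a section of `M(i)~`. -/
def sectionsPair (M : GrMod 𝒜) (i : ℤ) (U : Opens (top 𝒜)) (f : sections M U)
    (g : sections (GrMod.twist 𝒜 i) U) : sections (M.shift i) U :=
  ⟨fun x => locPair (S := compl x.1) (A := A) (f.1 x) (g.1 x), fun x => by
    obtain ⟨V, hxV, k, n, m, s, w⟩ := f.2 x
    obtain ⟨V', hxV', k', n', m', s', w'⟩ := g.2 x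
    refine ⟨V ⊓ V', ⟨hxV, hxV'⟩, Opens.infLELeft _ _ ≫ k, n + n',
      ⟨(show A from m'.1) • m.1, ?_⟩,
      ⟨s * s', SetLike.GradedMul.mul_mem s.2 s'.2⟩, fun y => ?_⟩
    · have hm : (show A from m'.1) ∈ 𝒜 (n' + i) := m'.2
      have := M.smul_mem hm m.2
      rwa [show (n' + i) + (n : ℤ) = ((n + n' : ℕ) : ℤ) + i by push_cast; ring] at this
    · obtain ⟨h, e⟩ := w ⟨y.1, y.2.1⟩
      obtain ⟨h', e'⟩ := w' ⟨y.1, y.2.2⟩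
      refine ⟨mul_mem h h', ?_⟩
      exact (congrArg₂ (locPair (S := compl y.1) (A := A) (M := M.carrier)) e e').trans
        (locPair_mk (S := compl y.1) (A := A) (M := M.carrier) _ _ _ _)⟩

/-- The multiplication `M̃ ⊗ Ã(i) ⟶ M(i)~`. -/
def tensToShift (M : GrMod 𝒜) (i : ℤ) : tw (tilde M) i ⟶ tilde (M.shift i) :=
  tensDesc (fun U => LinearMap.mk₂ Γ(projPlus 𝒜, U)
    (fun (m : Γ(tilde M, U)) e => (sectionsPair M i U m e : Γ(tilde (M.shift i), U)))
    (fun _ _ _ => Subtype.ext (funext fun x => locPair_add_left (S := compl (𝒜 := 𝒜) x.1)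
      (A := A) (M := M.carrier) _ _ _))
    (fun _ _ _ => Subtype.ext (funext fun x => locPair_smul_left (S := compl (𝒜 := 𝒜) x.1)
      (A := A) (M := M.carrier) _ _ _))
    (fun _ _ _ => Subtype.ext (funext fun x => locPair_add_right (S := compl (𝒜 := 𝒜) x.1)
      (A := A) (M := M.carrier) _ _ _))
    (fun _ _ _ => Subtype.ext (funext fun x => locPair_smul_right (S := compl (𝒜 := 𝒜) x.1)
      (A := A) (M := M.carrier) _ _ _))) fun _ _ _ _ _ => rfl

theorem tensToShift_tmulSection (M : GrMod 𝒜) (i : ℤ) {U : (projPlus 𝒜).Opens}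
    (m : Γ(tilde M, U)) (e : Γ(tilde (GrMod.twist 𝒜 i), U)) :
    (tensToShift M i).app U (tmulSection m e) =
      (sectionsPair M i (show Opens (top 𝒜) from U) m e : sections _ (show Opens (top 𝒜) from U)) :=
  tensDesc_tmulSection _ _ _ _

theorem locMap_shiftMap_locPair (M : GrMod 𝒜) {i j k : ℤ} (h : j + i = k) (a : 𝒜 j)
    (x : ProjectiveSpectrum (nonnegGrading 𝒜)) (z : Loc M x) (w : Loc (GrMod.twist 𝒜 i) x) :
    locPair (S := compl x) (A := A) z (locMap (GrMod.twistMap h a) x w) =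
      locMap (M.shiftMap h a) x (locPair (S := compl x) (A := A) z w) := by
  induction z using LocalizedModule.induction_on with
  | h m s =>
    induction w using LocalizedModule.induction_on with
    | h b t =>
      rw [locMap_mk]
      refine (locPair_mk (A := A) m s ((a : A) * (show A from b)) t).trans ?_
      refine Eq.trans ?_ (congrArg (locMap (M.shiftMap h a) x)
        (locPair_mk (A := A) m s (show A from b) t)).symm
      refine Eq.trans ?_ (locMap_mk (M.shiftMap h a) x ((show A from b) • m) (s * t)).symm
      exact congrArg (fun m => (LocalizedModule.mk m (s * t) : Loc M x)) (mul_smul _ _ _)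

theorem locMap_mapShift_locPair {M N : GrMod 𝒜} (φ : M ⟶ N) {i : ℤ}
    (x : ProjectiveSpectrum (nonnegGrading 𝒜)) (z : Loc M x) (w : Loc (GrMod.twist 𝒜 i) x) :
    locPair (S := compl x) (A := A) (locMap φ x z) w =
      locMap (GrMod.mapShift φ i) x (locPair (S := compl x) (A := A) z w) := by
  induction z using LocalizedModule.induction_on with
  | h m s =>
    induction w using LocalizedModule.induction_on with
    | h b t =>
      rw [locMap_mk]
      refine (locPair_mk (A := A) (φ.toLin m) s (show A from b) t).trans ?_
      refine Eq.trans ?_ (congrArg (locMap (GrMod.mapShift φ i) x)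
        (locPair_mk (A := A) m s (show A from b) t)).symm
      refine Eq.trans ?_ (locMap_mk (GrMod.mapShift φ i) x ((show A from b) • m) (s * t)).symm
      exact congrArg (fun m => (LocalizedModule.mk m (s * t) : Loc N x)) (φ.toLin.map_smul _ _).symm

theorem twMul_tensToShift (M : GrMod 𝒜) {i j k : ℤ} {a : A} (ha : a ∈ 𝒜 j) (h : j + i = k) :
    twMul (tilde M) ha h ≫ tensToShift M k =
      tensToShift M i ≫ tildeMap (M.shiftMap h ⟨a, ha⟩) :=
  tens_hom_ext fun V m e => by
    refine (congrArg ((tensToShift M k).app V) (tens_map_tmulSection _ m e)).trans ?_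
    refine (tensToShift_tmulSection M k m _).trans ?_
    refine Eq.trans ?_ (congrArg ((tildeMap (M.shiftMap h ⟨a, ha⟩)).app V)
      (tensToShift_tmulSection M i m e)).symm
    exact Subtype.ext (funext fun x => locMap_shiftMap_locPair M h ⟨a, ha⟩ x.1 _ _)

theorem twMap_tensToShift {M N : GrMod 𝒜} (φ : M ⟶ N) (i : ℤ) :
    twMap (tildeMap φ) i ≫ tensToShift N i = tensToShift M i ≫ tildeMap (GrMod.mapShift φ i) :=
  tens_hom_ext fun V m e => by
    refine (congrArg ((tensToShift N i).app V) (tens_map_tmulSection_left _ m e)).trans ?_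
    refine (tensToShift_tmulSection N i _ e).trans ?_
    refine Eq.trans ?_ (congrArg ((tildeMap (GrMod.mapShift φ i)).app V)
      (tensToShift_tmulSection M i m e)).symm
    exact Subtype.ext (funext fun x => locMap_mapShift_locPair φ x.1 _ _)

theorem locPair_one (M : GrMod 𝒜) (x : ProjectiveSpectrum (nonnegGrading 𝒜)) (z : Loc M x) :
    locPair (S := compl x) (A := A) z (LocalizedModule.mk (1 : A) 1) = z := by
  induction z using LocalizedModule.induction_on with
  | h m s => rw [locPair_mk, one_smul, mul_one]

/-- `Ã(0)` is free on the unit section, and pairing with that section is the map induced by the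
identity `M → M(0)`. -/
theorem tensToShift_zero_bijective (M : GrMod 𝒜) (U : (projPlus 𝒜).Opens) :
    Function.Bijective ((tensToShift M 0).app U) :=
  tensDesc_bijective _ _ ⊤ (fun V _ => bijective_lift_of_generator (smul_unitSection_bijective V) _ (by
    let φ : M ⟶ M.shift 0 := ⟨LinearMap.id, fun {n m} hm => by
      change m ∈ M.deg (n + 0)
      rwa [add_zero]⟩
    have h := tildeMap_bijective φ ⊤ (fun x _ _ m _ _ _ _ h0 => ⟨1, one_mem _, by
      rw [one_smul]; exact h0⟩) (fun x _ _ m _ _ _ _ =>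
        ⟨0, 1, m, (SetLike.GradedOne.one_mem : (1 : A) ∈ 𝒜 0), one_mem _, (one_smul (nonneg 𝒜) m).symm⟩) V le_top
    convert! h using 1
    funext m
    refine Subtype.ext (funext fun x => (locPair_one M x.1 _).trans ?_)
    exact (locMap_id M x.1 _).symm)) U le_top

theorem shiftMap_bijective (M : GrMod 𝒜) {i j k : ℤ} (h : j + i = k) (a : 𝒜 j) {b : A} {n : ℕ}
    {s : nonneg 𝒜} (hs : s ∈ nonnegGrading 𝒜 n) (hab : (a : A) * b = s) :
    ∀ U ≤ basicOpen s, Function.Bijective ((tildeMap (M.shiftMap h a)).app U) :=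
  tildeMap_bijective_of_mul (M.shiftMap h a) (LinearMap.lsmul A M.carrier b) hs
    (fun m : M.carrier => by
      change b • (a : A) • m = (s : A) • m
      rw [smul_smul, mul_comm, hab])
    (fun m : M.carrier => by
      change (a : A) • b • m = (s : A) • m
      rw [smul_smul, hab])

/-- In the square formed with multiplication by `a`, both multiplication maps are invertible over
`D(s)`, so the two comparison maps are bijective together. -/
theorem tensToShift_bijective_iff (M : GrMod 𝒜) {i j k : ℤ} {a b : A} (ha : a ∈ 𝒜 j)
    (h : j + i = k) {n : ℕ} {s : nonneg 𝒜} (hs : s ∈ nonnegGrading 𝒜 n) (hab : a * b = s)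
    {U : (projPlus 𝒜).Opens} (hU : U ≤ dOpen 𝒜 s) :
    Function.Bijective ((tensToShift M k).app U) ↔
      Function.Bijective ((tensToShift M i).app U) := by
  have e : (tensToShift M k).app U ∘ (twMul (tilde M) ha h).app U =
      (tildeMap (M.shiftMap h ⟨a, ha⟩)).app U ∘ (tensToShift M i).app U :=
    funext (app_app_of_comm (twMul_tensToShift M ha h) U)
  rw [← Function.Bijective.of_comp_iff _ (twMul_bijective (tilde M) ha h hs hab U hU), e,
    Function.Bijective.of_comp_iff' (shiftMap_bijective M h ⟨a, ha⟩ hs hab U hU)]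

/-- Over a `D(g)` carrying a unit of degree `d`, the degree `di` is linked to `0` through `d(nl +
i)`: multiplication by `g ^ l` starts from `di`, multiplication by `w` from `0`. -/
theorem tensToShift_bijective (M : GrMod 𝒜) {d : ℕ} (hd : 0 < d) (hC : IsPositivelyCartier 𝒜 d)
    (i : ℤ) (U : (projPlus 𝒜).Opens) : Function.Bijective ((tensToShift M (d * i)).app U) := by
  have key : ∀ x : ProjectiveSpectrum (nonnegGrading 𝒜), ∃ g ∈ compl x, ∀ U ≤ dOpen 𝒜 g,
      Function.Bijective ((tensToShift M (d * i)).app U) := fun x => by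
    obtain ⟨n, g, u, v, hg, H⟩ := exists_isUnitCover hd hC x
    obtain ⟨l, w, w', hw, hw', e⟩ := H.exists_mul_eq i
    refine ⟨g, hg, fun U hU => ?_⟩
    have hgl := pow_mem_nonnegGrading H.mem l rfl
    refine (tensToShift_bijective_iff M (a := (g ^ l : nonneg 𝒜)) (b := 1) (n := l * (d * n))
      (k := d * (n * l + i)) hgl (by push_cast; ring) hgl (mul_one _)
      (hU.trans (basicOpen_le_pow g l))).mp ?_
    refine (tensToShift_bijective_iff M (a := w) (b := w') (i := 0) hw (add_zero _)
      (pow_mem_nonnegGrading H.mem (2 * l) rfl) (by push_cast; exact e)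
      (hU.trans (basicOpen_le_pow g _))).mpr ?_
    exact tensToShift_zero_bijective M U
  refine bijective_of_locally _ ⊤ (fun U _ s hs x hx => ?_) (fun U _ t x hx => ?_) U le_top
  · obtain ⟨g, hg, h⟩ := key x
    refine ⟨U ⊓ dOpen 𝒜 g, inf_le_left, ⟨hx, hg⟩, (h _ inf_le_right).1 ?_⟩
    rw [← res_app, hs, map_zero, map_zero]
  · obtain ⟨g, hg, h⟩ := key x
    obtain ⟨s, hs⟩ := (h (U ⊓ dOpen 𝒜 g) inf_le_right).2 (res _ inf_le_left t)
    exact ⟨U ⊓ dOpen 𝒜 g, inf_le_left, s, ⟨hx, hg⟩, hs⟩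

end Multiplication

/-! ### Graded modules and morphisms given degree by degree -/

section GradedModuleMaps

open DirectSum

variable {A : Type u} [CommRing A] {𝒜 : ℤ → AddSubgroup A}

namespace GrMod

theorem hom_ext_deg {M N : GrMod 𝒜} {φ ψ : M ⟶ N}
    (h : ∀ (i : ℤ), ∀ m ∈ M.deg i, φ.toLin m = ψ.toLin m) : φ = ψ :=
  hom_ext fun m => by
    obtain ⟨s, hs⟩ := M.proj_sum m
    rw [← hs, map_sum, map_sum]
    exact Finset.sum_congr rfl fun i _ => h i _ (M.proj_mem i m)

variable [GradedRing 𝒜]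

theorem map_smul_of_homogeneous {M N : GrMod 𝒜} (f : M.carrier →+ N.carrier)
    (h : ∀ (j i : ℤ), ∀ a ∈ 𝒜 j, ∀ m ∈ M.deg i, f (a • m) = a • f m) (a : A) (m : M.carrier) :
    f (a • m) = a • f m := by
  induction a using DirectSum.Decomposition.inductionOn 𝒜 with
  | zero => rw [zero_smul, zero_smul, map_zero]
  | add a b ha hb => rw [add_smul, add_smul, map_add, ha, hb]
  | homogeneous a =>
    obtain ⟨s, hs⟩ := M.proj_sum m
    rw [← hs, Finset.smul_sum, map_sum, map_sum, Finset.smul_sum]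
    exact Finset.sum_congr rfl fun i _ => h _ i _ a.2 _ (M.proj_mem i m)

/-- A morphism of graded modules, given on the homogeneous components. -/
def homOfDeg {M N : GrMod 𝒜} (f : ∀ i, M.deg i →+ N.carrier)
    (hdeg : ∀ i m, f i m ∈ N.deg i)
    (hsmul : ∀ {j i k : ℤ} (_ : j + i = k) {a : A} (_ : a ∈ 𝒜 j) {m : M.carrier} (hm : m ∈ M.deg i)
      (ham : a • m ∈ M.deg k), f k ⟨a • m, ham⟩ = a • f i ⟨m, hm⟩) : M ⟶ N :=
  letI := M.isInternal.chooseDecomposition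
  let F : M.carrier →+ N.carrier :=
    (DirectSum.toAddMonoid f).comp (DirectSum.decomposeAddEquiv M.deg).toAddMonoidHom
  have hF : ∀ {i : ℤ} {m : M.carrier} (hm : m ∈ M.deg i), F m = f i ⟨m, hm⟩ := fun {i m} hm => by
    change DirectSum.toAddMonoid f (DirectSum.decompose M.deg m) = _
    rw [DirectSum.decompose_of_mem M.deg hm, DirectSum.toAddMonoid_of]
  { toLin :=
      { F with
        map_smul' := map_smul_of_homogeneous F fun j i a ha m hm => by
          rw [hF (M.smul_mem ha hm), hF hm]
          exact hsmul rfl ha hm _ }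
    map_deg := fun {i m} hm => by
      change F m ∈ _
      rw [hF hm]
      exact hdeg _ _ }

theorem homOfDeg_apply {M N : GrMod 𝒜} (f : ∀ i, M.deg i →+ N.carrier)
    (hdeg : ∀ i m, f i m ∈ N.deg i)
    (hsmul : ∀ {j i k : ℤ} (_ : j + i = k) {a : A} (_ : a ∈ 𝒜 j) {m : M.carrier} (hm : m ∈ M.deg i)
      (ham : a • m ∈ M.deg k), f k ⟨a • m, ham⟩ = a • f i ⟨m, hm⟩) {i : ℤ} {m : M.carrier}
    (hm : m ∈ M.deg i) : (homOfDeg f hdeg hsmul).toLin m = f i ⟨m, hm⟩ := by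
  let _ := M.isInternal.chooseDecomposition
  change DirectSum.toAddMonoid f (DirectSum.decompose M.deg m) = _
  rw [DirectSum.decompose_of_mem M.deg hm, DirectSum.toAddMonoid_of]

section OfGmodule

variable (E : ℤ → Type u) [∀ i, AddCommGroup (E i)] [Gmodule (fun j => 𝒜 j) E]

/-- The graded module with homogeneous components `E i`. -/
def ofGmodule : GrMod 𝒜 :=
  letI : Module A (⨁ i, E i) :=
    Module.compHom (R := ⨁ i, 𝒜 i) _ (DirectSum.decomposeRingEquiv 𝒜).toRingHom
  { carrier := ⨁ i, E i
    deg := fun i => (DirectSum.of E i).range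
    smul_mem := fun {i j a m} ha hm => by
      obtain ⟨y, rfl⟩ := hm
      have h : DirectSum.decomposeRingEquiv 𝒜 a = DirectSum.of (fun i => 𝒜 i) i ⟨a, ha⟩ :=
        DirectSum.decompose_coe 𝒜 (⟨a, ha⟩ : 𝒜 i)
      have key := DirectSum.Gmodule.of_smul_of (fun j => 𝒜 j) E ⟨a, ha⟩ y
      rw [← h] at key
      exact ⟨_, key.symm⟩
    isInternal := isInternal_range_of E }

/-- The inclusion of a homogeneous component. -/
def ofGmoduleOf (i : ℤ) : E i →+ (ofGmodule (𝒜 := 𝒜) E).carrier := DirectSum.of E i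

theorem ofGmoduleOf_injective (i : ℤ) : Function.Injective (ofGmoduleOf (𝒜 := 𝒜) E i) :=
  DirectSum.of_injective (β := E) i

theorem smul_ofGmoduleOf {i j : ℤ} (a : 𝒜 j) (m : E i) : (a : A) • ofGmoduleOf (𝒜 := 𝒜) E i m =
    ofGmoduleOf E (j + i) (GradedMonoid.GSMul.smul (A := fun j => 𝒜 j) (M := E) a m) := by
  have h : DirectSum.decomposeRingEquiv 𝒜 (a : A) = DirectSum.of (fun i => 𝒜 i) j a :=
    DirectSum.decompose_coe 𝒜 a
  have key := DirectSum.Gmodule.of_smul_of (fun j => 𝒜 j) E a m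
  rw [← h] at key
  exact key

variable {E}

/-- A morphism out of a graded module with given homogeneous components. -/
def homOfGmodule {N : GrMod 𝒜} (f : ∀ i, E i →+ N.carrier) (hdeg : ∀ i m, f i m ∈ N.deg i)
    (hsmul : ∀ {j i : ℤ} (a : 𝒜 j) (m : E i),
      f (j + i) (GradedMonoid.GSMul.smul (A := fun j => 𝒜 j) (M := E) a m) = (a : A) • f i m) :
    ofGmodule (𝒜 := 𝒜) E ⟶ N :=
  let F : (ofGmodule (𝒜 := 𝒜) E).carrier →+ N.carrier := DirectSum.toAddMonoid f
  have hF : ∀ {i : ℤ} (m : E i), F (ofGmoduleOf E i m) = f i m := fun {i} m =>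
    DirectSum.toAddMonoid_of f i m
  { toLin :=
      { F with
        map_smul' := map_smul_of_homogeneous F fun j i a ha m hm => by
          obtain ⟨y, rfl⟩ := hm
          refine (congrArg F (smul_ofGmoduleOf E ⟨a, ha⟩ y)).trans ?_
          exact (hF _).trans ((hsmul ⟨a, ha⟩ y).trans (congrArg (a • ·) (hF y)).symm) }
    map_deg := by
      rintro i _ ⟨y, rfl⟩
      exact (hF y).symm ▸ hdeg i y }

end OfGmodule

end GrMod

end GradedModuleMaps

/-! ### The graded module `⨁ᵢ H⁰(M(i)~)` -/

section ShiftSections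

open DirectSum

variable {A : Type u} [CommRing A] {𝒜 : ℤ → AddSubgroup A} [GradedRing 𝒜]

theorem sectionsMap_id (M : GrMod 𝒜) {U : Opens (top 𝒜)} (s : sections M U) :
    sectionsMap (𝟙 M) U s = s :=
  Subtype.ext (funext fun x => locMap_id M x.1 (s.1 x))

theorem sectionsMap_comp {M N P : GrMod 𝒜} (φ : M ⟶ N) (ψ : N ⟶ P) {U : Opens (top 𝒜)}
    (s : sections M U) : sectionsMap (φ ≫ ψ) U s = sectionsMap ψ U (sectionsMap φ U s) :=
  Subtype.ext (funext fun x => locMap_comp φ ψ x.1 (s.1 x))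

theorem sectionsMap_add {M N : GrMod 𝒜} (φ ψ χ : M ⟶ N)
    (h : ∀ m, χ.toLin m = φ.toLin m + ψ.toLin m) {U : Opens (top 𝒜)} (s : sections M U) :
    sectionsMap χ U s = sectionsMap φ U s + sectionsMap ψ U s :=
  Subtype.ext (funext fun x => locMap_add φ ψ χ h x.1 (s.1 x))

/-- The group `H⁰(M(i)~)`. -/
def shiftSections (M : GrMod 𝒜) (i : ℤ) : Type u := sections (M.shift i) ⊤

instance (M : GrMod 𝒜) (i : ℤ) : AddCommGroup (shiftSections M i) :=
  inferInstanceAs (AddCommGroup (sections (M.shift i) ⊤))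

/-- Multiplication by `a ∈ A_j`, as a map `H⁰(M(i)~) → H⁰(M(k)~)` where `k = j + i`. -/
def shiftMul (M : GrMod 𝒜) {i j k : ℤ} (h : j + i = k) (a : 𝒜 j) :
    shiftSections M i →+ shiftSections M k :=
  (sectionsMap (M.shiftMap h a) ⊤).toAddMonoidHom

theorem shiftMul_add (M : GrMod 𝒜) {i j k : ℤ} (h : j + i = k) (a b : 𝒜 j)
    (s : shiftSections M i) : shiftMul M h (a + b) s = shiftMul M h a s + shiftMul M h b s :=
  sectionsMap_add (M.shiftMap h a) (M.shiftMap h b) (M.shiftMap h (a + b))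
    (fun m : M.carrier => add_smul (a : A) (b : A) m) s

theorem shiftMul_zero (M : GrMod 𝒜) {i j k : ℤ} (h : j + i = k) (s : shiftSections M i) :
    shiftMul M h (0 : 𝒜 j) s = 0 := by
  have := shiftMul_add M h (0 : 𝒜 j) 0 s
  rwa [add_zero, left_eq_add] at this

theorem shiftMul_one (M : GrMod 𝒜) {i k : ℤ} (h : 0 + i = k) (s : shiftSections M i) :
    (⟨k, shiftMul M h ⟨1, SetLike.GradedOne.one_mem⟩ s⟩ : Σ n, shiftSections M n) = ⟨i, s⟩ := by
  obtain rfl : i = k := by omega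
  have : M.shiftMap h (⟨1, SetLike.GradedOne.one_mem⟩ : 𝒜 0) = 𝟙 (M.shift i) :=
    GrMod.hom_ext fun m : M.carrier => one_smul A m
  refine congrArg (Sigma.mk i) ?_
  exact (congrArg (fun φ => sectionsMap φ ⊤ s) this).trans (sectionsMap_id (M.shift i) s)

theorem shiftMul_mul (M : GrMod 𝒜) {i j j' k k' l : ℤ} (h : j' + i = k') (h' : j + k' = k)
    (h'' : j + j' + i = l) (a : 𝒜 j) (b : 𝒜 j') (s : shiftSections M i) :
    (⟨l, shiftMul M h'' ⟨a * b, SetLike.GradedMul.mul_mem a.2 b.2⟩ s⟩ :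
      Σ n, shiftSections M n) = ⟨k, shiftMul M h' a (shiftMul M h b s)⟩ := by
  obtain rfl : k = l := by omega
  have : M.shiftMap h'' (⟨a * b, SetLike.GradedMul.mul_mem a.2 b.2⟩ : 𝒜 (j + j')) =
      M.shiftMap h b ≫ M.shiftMap h' a :=
    GrMod.hom_ext fun m : M.carrier => mul_smul (a : A) b m
  refine congrArg (Sigma.mk k) ?_
  exact (congrArg (fun φ => sectionsMap φ ⊤ s) this).trans (sectionsMap_comp _ _ s)

/-- The graded action of `A` on `⨁ᵢ H⁰(M(i)~)`. -/
instance (M : GrMod 𝒜) : Gmodule (fun j => 𝒜 j) (shiftSections M) where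
  smul a s := shiftMul M rfl a s
  one_smul := fun ⟨_, s⟩ => shiftMul_one M _ s
  mul_smul := fun ⟨_, a⟩ ⟨_, b⟩ ⟨_, s⟩ => shiftMul_mul M _ _ _ a b s
  smul_add _ s t := map_add _ s t
  smul_zero _ := map_zero _
  add_smul a b s := shiftMul_add M _ a b s
  zero_smul s := shiftMul_zero M _ s

/-- The graded module `⨁ᵢ H⁰(M(i)~)`. -/
def shiftGamma (M : GrMod 𝒜) : GrMod 𝒜 := GrMod.ofGmodule (shiftSections M)

/-- The inclusion of the summand `H⁰(M(i)~)`. -/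
def shiftGammaOf (M : GrMod 𝒜) (i : ℤ) : shiftSections M i →+ (shiftGamma M).carrier :=
  GrMod.ofGmoduleOf (shiftSections M) i

theorem smul_shiftGammaOf (M : GrMod 𝒜) {i j k : ℤ} (h : j + i = k) {a : A} (ha : a ∈ 𝒜 j)
    (s : shiftSections M i) :
    a • shiftGammaOf M i s = shiftGammaOf M k (shiftMul M h ⟨a, ha⟩ s) := by
  subst h
  exact GrMod.smul_ofGmoduleOf (shiftSections M) ⟨a, ha⟩ s

/-- The map `H⁰(M(i)~) → H⁰(N(i)~)` induced by a morphism `M ⟶ N`. -/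
def shiftSectionsMap {M N : GrMod 𝒜} (φ : M ⟶ N) (i : ℤ) : shiftSections M i →+ shiftSections N i :=
  (sectionsMap (GrMod.mapShift φ i) ⊤).toAddMonoidHom

theorem shiftSectionsMap_shiftMul {M N : GrMod 𝒜} (φ : M ⟶ N) {i j k : ℤ} (h : j + i = k)
    (a : 𝒜 j) (s : shiftSections M i) : shiftSectionsMap φ k (shiftMul M h a s) =
      shiftMul N h a (shiftSectionsMap φ i s) := by
  have e : M.shiftMap h a ≫ GrMod.mapShift φ k = GrMod.mapShift φ i ≫ N.shiftMap h a :=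
    GrMod.hom_ext fun m : M.carrier => φ.toLin.map_smul (a : A) m
  exact (sectionsMap_comp _ _ s).symm.trans
    ((congrArg (fun φ => sectionsMap φ ⊤ s) e).trans (sectionsMap_comp _ _ s))

/-- The map `⨁ᵢ H⁰(M(i)~) ⟶ ⨁ᵢ H⁰(N(i)~)` induced by a morphism `M ⟶ N`. -/
def shiftGammaMap {M N : GrMod 𝒜} (φ : M ⟶ N) : shiftGamma M ⟶ shiftGamma N :=
  GrMod.homOfGmodule (fun i => (shiftGammaOf N i).comp (shiftSectionsMap φ i))
    (fun i s => ⟨shiftSectionsMap φ i s, rfl⟩) fun a s =>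
      (congrArg (shiftGammaOf N _) (shiftSectionsMap_shiftMul φ rfl a s)).trans
        (smul_shiftGammaOf N rfl a.2 _).symm

theorem shiftGammaMap_of {M N : GrMod 𝒜} (φ : M ⟶ N) {i : ℤ} (s : shiftSections M i) :
    (shiftGammaMap φ).toLin (shiftGammaOf M i s) = shiftGammaOf N i (shiftSectionsMap φ i s) :=
  DirectSum.toAddMonoid_of (fun i => (shiftGammaOf N i).comp (shiftSectionsMap φ i)) i s

variable (𝒜) in
/-- The functor `M ↦ ⨁ᵢ H⁰(M(i)~)`. -/
def shiftGammaFunctor : GrMod 𝒜 ⥤ GrMod 𝒜 where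
  obj := shiftGamma
  map := shiftGammaMap
  map_id M := GrMod.hom_ext_deg fun i m hm => by
    obtain ⟨s, rfl⟩ := hm
    refine (shiftGammaMap_of (𝟙 M) s).trans ?_
    exact congrArg (shiftGammaOf M i) (sectionsMap_id (M.shift i) s)
  map_comp {M N P} φ ψ := GrMod.hom_ext_deg fun i m hm => by
    obtain ⟨s, rfl⟩ := hm
    refine (shiftGammaMap_of (φ ≫ ψ) s).trans (Eq.trans ?_
      (congrArg (shiftGammaMap ψ).toLin (shiftGammaMap_of φ s)).symm)
    refine Eq.trans ?_ (shiftGammaMap_of ψ _).symm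
    exact congrArg (shiftGammaOf P i)
      (sectionsMap_comp (GrMod.mapShift φ i) (GrMod.mapShift ψ i) s)

/-- The map `H⁰(M̃ ⊗ Ã(i)) ⟶ H⁰(M(i)~)`. -/
def twistedToShift (M : GrMod 𝒜) (i : ℤ) : twistedSections (tilde M) i →+ shiftSections M i :=
  ((tensToShift M i).app ⊤).hom

theorem twistedToShift_bijective (M : GrMod 𝒜) {d : ℕ} (hd : 0 < d)
    (hC : IsPositivelyCartier 𝒜 d) (i : ℤ) : Function.Bijective (twistedToShift M (d * i)) :=
  tensToShift_bijective M hd hC i ⊤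

theorem twistedToShift_twistedMul (M : GrMod 𝒜) {i j k : ℤ} (h : j + i = k) (a : 𝒜 j)
    (s : twistedSections (tilde M) i) : twistedToShift M k (twistedMul (tilde M) h a s) =
      shiftMul M h a (twistedToShift M i s) :=
  app_app_of_comm (twMul_tensToShift M a.2 h) ⊤ s

theorem twistedToShift_naturality {M N : GrMod 𝒜} (φ : M ⟶ N) (i : ℤ)
    (s : twistedSections (tilde M) i) :
    twistedToShift N i (twistedSectionsMap (tildeMap φ) i s) =
      shiftSectionsMap φ i (twistedToShift M i s) :=
  app_app_of_comm (twMap_tensToShift φ i) ⊤ s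

/-- The map `⨁ᵢ H⁰(M̃ ⊗ Ã(i)) ⟶ ⨁ᵢ H⁰(M(i)~)`. -/
def gammaStarToShiftGamma (M : GrMod 𝒜) : gammaStar (tilde M) ⟶ shiftGamma M :=
  GrMod.homOfGmodule (E := twistedSections (tilde M)) (N := shiftGamma M)
    (fun i => (shiftGammaOf M i).comp (twistedToShift M i)) (fun _ _ => ⟨_, rfl⟩) fun {j i} a s =>
      (congrArg (shiftGammaOf M (j + i)) (twistedToShift_twistedMul M rfl a s)).trans
        (smul_shiftGammaOf M rfl a.2 _).symm

theorem gammaStarToShiftGamma_of (M : GrMod 𝒜) {i : ℤ} (s : twistedSections (tilde M) i) :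
    (gammaStarToShiftGamma M).toLin (GammaStar.of (tilde M) i s) =
      shiftGammaOf M i (twistedToShift M i s) :=
  DirectSum.toAddMonoid_of (fun i => (shiftGammaOf M i).comp (twistedToShift M i)) i s

theorem gammaStarToShiftGamma_naturality {M N : GrMod 𝒜} (φ : M ⟶ N) :
    (gammaStarFunctor 𝒜).map (tildeMap φ) ≫ gammaStarToShiftGamma N =
      gammaStarToShiftGamma M ≫ shiftGammaMap φ := GrMod.hom_ext_deg fun i m hm => by
  obtain ⟨s, rfl⟩ := hm
  refine (congrArg (gammaStarToShiftGamma N).toLin (gammaStarMapAdd_of (tildeMap φ) i s)).trans ?_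
  refine (gammaStarToShiftGamma_of N _).trans (Eq.trans ?_
    (congrArg (shiftGammaMap φ).toLin (gammaStarToShiftGamma_of M s)).symm)
  refine Eq.trans ?_ (shiftGammaMap_of φ _).symm
  exact congrArg (shiftGammaOf N i) (twistedToShift_naturality φ i s)

/-- The map is bijective in degrees divisible by `d`, the only ones that the torsion condition
tests, so the exponent `0` suffices. -/
theorem torPlusIso_gammaStarToShiftGamma (M : GrMod 𝒜) {d : ℕ} (hd : 0 < d)
    (hC : IsPositivelyCartier 𝒜 d) : torPlusIso 𝒜 d (gammaStarToShiftGamma M) := by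
  refine torPlusIso_of_homogeneous _ (fun i x hx h0 _ _ _ _ => ⟨0, ?_⟩)
    (fun i y hy _ _ _ _ => ⟨0, ?_⟩)
  · obtain ⟨s, rfl⟩ := hx
    have h := (gammaStarToShiftGamma_of M s).symm.trans h0
    have h1 : twistedToShift M (d * i) s = 0 :=
      GrMod.ofGmoduleOf_injective (𝒜 := 𝒜) (shiftSections M) (d * i) (h.trans (map_zero _).symm)
    have h2 : GammaStar.of (tilde M) (d * i) s = 0 := by
      rw [(map_eq_zero_iff _ (twistedToShift_bijective M hd hC i).1).mp h1, map_zero]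
    exact (congrArg (_ • ·) h2).trans (smul_zero (A := (gammaStar (tilde M)).carrier) _)
  · obtain ⟨t, rfl⟩ := hy
    obtain ⟨s, rfl⟩ := (twistedToShift_bijective M hd hC i).2 t
    exact ⟨GammaStar.of _ _ s, (gammaStarToShiftGamma_of M s).trans
      ((congrArg (· • _) (pow_zero _)).trans (one_smul A (shiftGammaOf M _ _))).symm⟩

end ShiftSections

/-! ### `M → ⨁ᵢ H⁰(M(i)~)` is an isomorphism up to torsion -/

section ToShiftGamma

variable {A : Type u} [CommRing A] {𝒜 : ℤ → AddSubgroup A} [GradedRing 𝒜]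

/-- The global section `m / 1` of `M(i)~`, for `m` homogeneous of degree `i`. -/
def toShiftSection (M : GrMod 𝒜) (i : ℤ) : M.deg i →+ shiftSections M i where
  toFun m := fracSection (M.shift i) (n := 0) (m := m.1) (by
    change m.1 ∈ M.deg ((0 : ℕ) + i)
    rw [Nat.cast_zero, zero_add]
    exact m.2) (s := 1) (SetLike.GradedOne.one_mem : (1 : A) ∈ 𝒜 0) ⊤ fun _ _ => one_mem (compl _)
  map_zero' := Subtype.ext (funext fun _ => LocalizedModule.zero_mk _)
  map_add' m m' := Subtype.ext (funext fun x => by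
    refine Eq.trans ?_ (LocalizedModule.mk_add_mk (S := compl (𝒜 := 𝒜) x.1) (M := M.carrier)
      (m1 := m.1) (m2 := m'.1) (s1 := 1) (s2 := 1)).symm
    rw [one_smul, one_smul, mul_one]
    rfl)

theorem shiftMul_toShiftSection (M : GrMod 𝒜) {i j k : ℤ} (h : j + i = k) {a : A} (ha : a ∈ 𝒜 j)
    {m : M.carrier} (hm : m ∈ M.deg i) (ham : a • m ∈ M.deg k) :
    shiftMul M h ⟨a, ha⟩ (toShiftSection M i ⟨m, hm⟩) = toShiftSection M k ⟨a • m, ham⟩ :=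
  Subtype.ext (funext fun x => locMap_mk (M.shiftMap h ⟨a, ha⟩) x.1 m 1)

theorem smul_shiftGammaOf_toShiftSection (M : GrMod 𝒜) {i j k : ℤ} (h : j + i = k) {a : A}
    (ha : a ∈ 𝒜 j) {m : M.carrier} (hm : m ∈ M.deg i) (ham : a • m ∈ M.deg k) :
    shiftGammaOf M k (toShiftSection M k ⟨a • m, ham⟩) =
      a • shiftGammaOf M i (toShiftSection M i ⟨m, hm⟩) :=
  (congrArg (shiftGammaOf M _) (shiftMul_toShiftSection M h ha hm ham)).symm.trans
    (smul_shiftGammaOf M h ha _).symm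

/-- Multiplication by a homogeneous element of `A_{≥ 0}`, as a map `H⁰(M(i)~) → H⁰(M(k)~)`. -/
def nonnegShiftMul (M : GrMod 𝒜) {n : ℕ} {b : nonneg 𝒜} (hb : b ∈ nonnegGrading 𝒜 n) {i k : ℤ}
    (h : n + i = k) : shiftSections M i →+ shiftSections M k :=
  shiftMul M h ⟨b, hb⟩

theorem nonnegShiftMul_apply (M : GrMod 𝒜) {n : ℕ} {b : nonneg 𝒜} (hb : b ∈ nonnegGrading 𝒜 n)
    {i k : ℤ} (h : n + i = k) (s : shiftSections M i) (x : (⊤ : Opens (top 𝒜))) :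
    (nonnegShiftMul M hb h s).1 x = b • (show Loc M x.1 from s.1 x) := by
  change locMap (M.shiftMap h ⟨b, hb⟩) x.1 (s.1 x) = _
  generalize s.1 x = z
  induction z using LocalizedModule.induction_on with
  | h m t => exact (locMap_mk _ _ _ _).trans (loc_smul_mk (M := M) b m t).symm

theorem nonneg_smul_shiftGammaOf (M : GrMod 𝒜) {n : ℕ} {b : nonneg 𝒜}
    (hb : b ∈ nonnegGrading 𝒜 n) {i k : ℤ} (h : n + i = k) (s : shiftSections M i) :
    b • shiftGammaOf M i s = shiftGammaOf M k (nonnegShiftMul M hb h s) :=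
  smul_shiftGammaOf M h hb s

/-- The map `M ⟶ ⨁ᵢ H⁰(M(i)~)`. -/
def toShiftGamma (M : GrMod 𝒜) : M ⟶ shiftGamma M :=
  GrMod.homOfDeg (N := shiftGamma M) (fun i => (shiftGammaOf M i).comp (toShiftSection M i))
    (fun _ _ => ⟨_, rfl⟩) (smul_shiftGammaOf_toShiftSection M)

theorem toShiftGamma_apply (M : GrMod 𝒜) {i : ℤ} {m : M.carrier} (hm : m ∈ M.deg i) :
    (toShiftGamma M).toLin m = shiftGammaOf M i (toShiftSection M i ⟨m, hm⟩) :=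
  GrMod.homOfDeg_apply (N := shiftGamma M)
    (fun i => (shiftGammaOf M i).comp (toShiftSection M i)) (fun _ _ => ⟨_, rfl⟩)
    (smul_shiftGammaOf_toShiftSection M) hm

theorem toShiftGamma_naturality {M N : GrMod 𝒜} (φ : M ⟶ N) :
    φ ≫ toShiftGamma N = toShiftGamma M ≫ shiftGammaMap φ := GrMod.hom_ext_deg fun i m hm => by
  refine (toShiftGamma_apply N (φ.map_deg hm)).trans (Eq.trans ?_
    (congrArg (shiftGammaMap φ).toLin (toShiftGamma_apply M hm)).symm)
  refine Eq.trans ?_ (shiftGammaMap_of φ _).symm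
  exact congrArg (shiftGammaOf N i)
    (Subtype.ext (funext fun x => (locMap_mk (GrMod.mapShift φ i) x.1 m 1).symm))

theorem exists_nonneg_eq {d : ℕ} (hd : 0 < d) {m : ℤ} (hm : 0 < m) {f : A} (hf : f ∈ 𝒜 (d * m)) :
    ∃ (n : ℕ) (g : nonneg 𝒜), 0 < n ∧ g ∈ nonnegGrading 𝒜 n ∧ (g : A) = f := by
  lift m to ℕ using hm.le
  refine ⟨d * m, ⟨f, mem_supportedSubring_of_mem 𝒜 (n := d * m) ?_ hf⟩,
    Nat.mul_pos hd (by exact_mod_cast hm), ?_, rfl⟩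
  · exact AddSubmonoid.mem_nonneg.mpr (by positivity)
  · rw [mem_nonnegGrading]
    push_cast
    exact hf

/-- A global section of `Ñ` which vanishes on `D(f)` is killed by a power of `f`. -/
theorem exists_pow_smul_section_eq_zero [IsNoetherianRing (nonneg 𝒜)] {d : ℕ} (hd : 0 < d)
    (hC : IsPositivelyCartier 𝒜 d) (N : GrMod 𝒜) {p : ℕ} {f : nonneg 𝒜}
    (hf : f ∈ nonnegGrading 𝒜 p) (s : sections N ⊤)
    (hs : ∀ x ∈ basicOpen f, s.1 ⟨x, trivial⟩ = 0) :
    ∃ K : ℕ, ∀ x : (⊤ : Opens (top 𝒜)), f ^ K • (s.1 x : Loc N x.1) = 0 := by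
  obtain ⟨ι, _, n, g, u, v, H, hcov⟩ := exists_finite_unitCover hd hC
  have hloc : ∀ a, ∃ K, ∀ K' ≥ K, ∀ x : ProjectiveSpectrum (nonnegGrading 𝒜), x ∈ basicOpen (g a) →
      f ^ K' • (s.1 ⟨x, trivial⟩ : Loc N x) = 0 := fun a => by
    have hn : 0 < d * n a := Nat.mul_pos hd (H a).pos
    obtain ⟨k, m, hm, e⟩ := exists_pow_smul_eq_mk N hn (H a).mem rfl (sectionsRes N le_top s)
    -- On `D(g_a)` the section is `m / g_a ^ k`. Its vanishing on `D(g_a f)` gives `(g_a f) ^ j m =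
    -- 0`, so `f ^ j` kills it where `g_a` is invertible.
    obtain ⟨j, hj⟩ := exists_pow_smul_eq_zero hm (n := d * n a + p) (by omega)
      (mul_mem_nonnegGrading (H a).mem hf rfl) fun x hx => by
        have hx' := basicOpen_mul (g a) f ▸ hx
        refine loc_mk_eq_zero.mp ((e ⟨x, hx'.1⟩).symm.trans ?_)
        exact (congrArg (g a ^ k • ·) (hs x hx'.2)).trans (smul_zero _)
    refine ⟨j, fun K' hK' x hx => ?_⟩
    have hgx : g a ∈ compl x := hx
    refine loc_smul_cancel (pow_mem hgx k) ?_
    rw [smul_zero, smul_comm]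
    refine (congrArg (f ^ K' • ·) (e ⟨x, hx⟩)).trans ?_
    refine (loc_smul_mk _ _ _).trans (loc_mk_eq_zero.mpr ⟨g a ^ j, pow_mem hgx j, ?_⟩)
    obtain ⟨c, rfl⟩ := Nat.exists_eq_add_of_le hK'
    rw [smul_smul, pow_add, ← mul_assoc, ← mul_pow, mul_comm, mul_smul, hj, smul_zero]
  obtain ⟨K, hK⟩ := exists_forall_ge hloc
  refine ⟨K, fun x => ?_⟩
  obtain ⟨a, hx⟩ := hcov x.1
  exact hK a K le_rfl x.1 hx

/-- On `D(f)` one has `f ^ k s = m / 1`. The global section `f ^ k s - m / 1` vanishes on `D(f)`, so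
it is killed by some `f ^ K`, and `f ^ (K + k) s` comes from `f ^ K m`. -/
theorem exists_toShiftGamma_eq_pow_smul [IsNoetherianRing (nonneg 𝒜)] (M : GrMod 𝒜) {d : ℕ}
    (hd : 0 < d) (hC : IsPositivelyCartier 𝒜 d) {n : ℕ} (hn : 0 < n) {f : nonneg 𝒜}
    (hf : f ∈ nonnegGrading 𝒜 n) {i : ℤ} (s : shiftSections M i) :
    ∃ (k : ℕ) (m : M.carrier), (toShiftGamma M).toLin m = f ^ k • shiftGammaOf M i s := by
  obtain ⟨k, m, hm, e⟩ := exists_pow_smul_eq_mk (M.shift i) hn hf rfl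
    (sectionsRes (M.shift i) le_top s)
  have hfk : f ^ k ∈ nonnegGrading 𝒜 (k * n) := pow_mem_nonnegGrading hf k rfl
  let t : shiftSections M ((k * n : ℕ) + i) := nonnegShiftMul M hfk rfl s -
    toShiftSection M _ ⟨m, hm⟩
  have ht0 : ∀ x ∈ basicOpen f, t.1 ⟨x, trivial⟩ = 0 := fun x hx =>
    sub_eq_zero.mpr ((nonnegShiftMul_apply M hfk rfl s ⟨x, trivial⟩).trans (e ⟨x, hx⟩))
  obtain ⟨K, hK⟩ := exists_pow_smul_section_eq_zero hd hC (M.shift ((k * n : ℕ) + i)) hf t ht0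
  have hfK : f ^ K ∈ nonnegGrading 𝒜 (K * n) := pow_mem_nonnegGrading hf K rfl
  have ht : f ^ K • shiftGammaOf M _ t = 0 := by
    refine (nonneg_smul_shiftGammaOf M hfK rfl t).trans ((congrArg _ ?_).trans (map_zero _))
    exact Subtype.ext (funext fun x => (nonnegShiftMul_apply M hfK rfl t x).trans (hK x))
  refine ⟨K + k, f ^ K • m, ?_⟩
  have h1 : (toShiftGamma M).toLin (f ^ K • m) = f ^ K • (toShiftGamma M).toLin m :=
    (toShiftGamma M).toLin.map_smul ((f ^ K : nonneg 𝒜) : A) m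
  rw [map_sub, smul_sub, sub_eq_zero] at ht
  rw [h1, toShiftGamma_apply M hm, pow_add, mul_smul, nonneg_smul_shiftGammaOf M hfk rfl s]
  exact ht.symm

/-- An element of the kernel satisfies `m / 1 = 0` at every point, hence is killed by a power of
each homogeneous `f` of positive degree; the cokernel is torsion because global sections become
fractions `m / 1` after multiplication by a power of `f`. -/
theorem torPlusIso_toShiftGamma [IsNoetherianRing (nonneg 𝒜)] (M : GrMod 𝒜) {d : ℕ} (hd : 0 < d)
    (hC : IsPositivelyCartier 𝒜 d) : torPlusIso 𝒜 d (toShiftGamma M) := by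
  refine torPlusIso_of_homogeneous _ (fun i x hx h0 m hm f hf => ?_) (fun i y hy m hm f hf => ?_)
  · obtain ⟨n, f, hn, hfn, rfl⟩ := exists_nonneg_eq hd hm hf
    have h := (toShiftGamma_apply M hx).symm.trans h0
    have h1 : toShiftSection M (d * i) ⟨x, hx⟩ = 0 :=
      GrMod.ofGmoduleOf_injective (𝒜 := 𝒜) (shiftSections M) (d * i) (h.trans (map_zero _).symm)
    obtain ⟨l, hl⟩ := exists_pow_smul_eq_zero hx hn hfn fun z _ =>
      loc_mk_eq_zero.mp (congrFun (congrArg Subtype.val h1) ⟨z, trivial⟩)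
    exact ⟨l, hl⟩
  · obtain ⟨n, f, hn, hfn, rfl⟩ := exists_nonneg_eq hd hm hf
    obtain ⟨s, rfl⟩ := hy
    obtain ⟨k, x, e⟩ := exists_toShiftGamma_eq_pow_smul M hd hC hn hfn s
    exact ⟨k, x, e⟩

end ToShiftGamma

/-! ### Unit, counit and the equivalence -/

section Equivalence

variable {A : Type u} [CommRing A] {𝒜 : ℤ → AddSubgroup A} [GradedRing 𝒜]

theorem tildeMap_valueMap_rightUnit {F G : (projPlus 𝒜).Modules} (φ : F ⟶ G) :
    tildeMap ((gammaStarFunctor 𝒜).map φ) ≫ valueMap G ≫ rightUnit G =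
      (valueMap F ≫ rightUnit F) ≫ φ := by
  refine (Category.assoc _ _ _).symm.trans ?_
  refine (congrArg (· ≫ rightUnit G) (valueMap_naturality φ)).trans ?_
  refine (Category.assoc _ _ _).trans (Eq.trans ?_ (Category.assoc _ _ _).symm)
  exact congrArg (valueMap F ≫ ·) (rightUnit_naturality φ)

variable [IsNoetherianRing (nonneg 𝒜)] {d : ℕ}

variable (𝒜) in
/-- The natural map `M ⟶ ⨁ᵢ H⁰(M(i)~)`. -/
def toShiftGammaNat : 𝟭 (GrMod 𝒜) ⟶ shiftGammaFunctor 𝒜 where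
  app := toShiftGamma
  naturality _ _ φ := toShiftGamma_naturality φ

variable (𝒜) in
/-- The natural map `⨁ᵢ H⁰(M̃ ⊗ Ã(i)) ⟶ ⨁ᵢ H⁰(M(i)~)`. -/
def gammaStarToShiftGammaNat : tildeFunctor 𝒜 ⋙ gammaStarFunctor 𝒜 ⟶ shiftGammaFunctor 𝒜 where
  app := gammaStarToShiftGamma
  naturality _ _ φ := gammaStarToShiftGamma_naturality φ

/-- A natural transformation of functors to `Gr(A)` which is componentwise an isomorphism up to
torsion induces an isomorphism of functors to the Serre quotient. -/
def quotIso {F G : GrMod 𝒜 ⥤ GrMod 𝒜} (τ : F ⟶ G) (h : ∀ M, torPlusIso 𝒜 d (τ.app M)) :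
    F ⋙ (torPlusIso 𝒜 d).Q ≅ G ⋙ (torPlusIso 𝒜 d).Q :=
  NatIso.ofComponents
    (fun M => Localization.isoOfHom (torPlusIso 𝒜 d).Q (torPlusIso 𝒜 d) (τ.app M) (h M))
    fun φ => ((torPlusIso 𝒜 d).Q.map_comp _ _).symm.trans
      ((congrArg (torPlusIso 𝒜 d).Q.map (τ.naturality φ)).trans ((torPlusIso 𝒜 d).Q.map_comp _ _))

/-- In the Serre quotient, `M` and `⨁ᵢ H⁰(M̃ ⊗ Ã(i))` are naturally isomorphic. -/
def quotIsoGammaStar (hd : 0 < d) (hC : IsPositivelyCartier 𝒜 d) : (torPlusIso 𝒜 d).Q ≅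
    (tildeFunctor 𝒜 ⋙ gammaStarFunctor 𝒜) ⋙ (torPlusIso 𝒜 d).Q :=
  -- The zigzag `M → ⨁ᵢ H⁰(M(i)~) ← ⨁ᵢ H⁰(M̃ ⊗ Ã(i))`: both arrows are inverted in the quotient, so
  -- the second can be reversed there.
  (Functor.leftUnitor _).symm ≪≫
    quotIso (toShiftGammaNat 𝒜) (fun M => torPlusIso_toShiftGamma M hd hC) ≪≫
    (quotIso (gammaStarToShiftGammaNat 𝒜) fun M => torPlusIso_gammaStarToShiftGamma M hd hC).symm

variable (hq : ∀ M : GrMod 𝒜, isQCoh (projPlus 𝒜) (tilde M))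
  (hT : (torPlusIso 𝒜 d).IsInvertedBy (tildeQCoh 𝒜 hq))

/-- The functor `tildeQuot` extends `tildeQCoh`. -/
def tildeQuotFac : (torPlusIso 𝒜 d).Q ⋙ tildeQuot 𝒜 d hq hT ≅ tildeQCoh 𝒜 hq :=
  eqToIso (Localization.Construction.fac _ hT)

/-- The unit of the equivalence between the Serre quotient and quasi-coherent sheaves. -/
def unitIso (hd : 0 < d) (hC : IsPositivelyCartier 𝒜 d) :
    𝟭 (QGr 𝒜 d) ≅ tildeQuot 𝒜 d hq hT ⋙ gammaStarQuot 𝒜 d :=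
  letI : Localization.Lifting (torPlusIso 𝒜 d).Q (torPlusIso 𝒜 d) (torPlusIso 𝒜 d).Q
      (tildeQuot 𝒜 d hq hT ⋙ gammaStarQuot 𝒜 d) :=
    ⟨(Functor.associator _ _ _).symm ≪≫
      Functor.isoWhiskerRight (tildeQuotFac hq hT) (gammaStarQuot 𝒜 d) ≪≫
      (quotIsoGammaStar hd hC).symm⟩
  -- Functors out of the localization are compared after composition with `Q`, where the isomorphism
  -- is the one between `M` and `⨁ᵢ H⁰(M̃ ⊗ Ã(i))`.
  Localization.liftNatIso (torPlusIso 𝒜 d).Q (torPlusIso 𝒜 d) (torPlusIso 𝒜 d).Q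
    (torPlusIso 𝒜 d).Q _ _ (Iso.refl _)

/-- The isomorphism from the sheaf associated with `⨁ᵢ H⁰(F ⊗ Ã(i))` to `F`, for `F`
quasi-coherent. -/
def tildeGammaStarObjIso (hd : 0 < d) (hC : IsPositivelyCartier 𝒜 d) {F : (projPlus 𝒜).Modules}
    (hF : isQCoh (projPlus 𝒜) F) : tilde (gammaStar F) ≅ F :=
  have := isIso_of_bijective _ (valueMap_bijective hF hd hC)
  have := isIso_of_bijective _ (rightUnit_bijective F)
  asIso (valueMap F) ≪≫ asIso (rightUnit F)

/-- The natural isomorphism from the sheaf associated with `⨁ᵢ H⁰(F ⊗ Ã(i))` to `F`. -/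
def tildeGammaStarIso (hd : 0 < d) (hC : IsPositivelyCartier 𝒜 d) :
    (isQCoh (projPlus 𝒜)).ι ⋙ gammaStarFunctor 𝒜 ⋙ tildeQCoh 𝒜 hq ≅ 𝟭 (QCoh (projPlus 𝒜)) :=
  NatIso.ofComponents
    (fun F => (isQCoh (projPlus 𝒜)).fullyFaithfulι.preimageIso
      (X := (tildeQCoh 𝒜 hq).obj (gammaStar F.obj)) (Y := F)
      (tildeGammaStarObjIso hd hC F.property))
    fun {F G} φ => (isQCoh (projPlus 𝒜)).ι.map_injective (by
      exact tildeMap_valueMap_rightUnit φ.hom)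

/-- The counit of the equivalence between the Serre quotient and quasi-coherent sheaves. -/
def counitIso (hd : 0 < d) (hC : IsPositivelyCartier 𝒜 d) :
    gammaStarQuot 𝒜 d ⋙ tildeQuot 𝒜 d hq hT ≅ 𝟭 (QCoh (projPlus 𝒜)) :=
  Functor.isoWhiskerLeft ((isQCoh (projPlus 𝒜)).ι ⋙ gammaStarFunctor 𝒜) (tildeQuotFac hq hT) ≪≫
    tildeGammaStarIso hq hd hC

/-- The Serre quotient of graded modules by positively torsion modules is equivalent to the
category of quasi-coherent sheaves. -/
def quotEquivalence (hd : 0 < d) (hC : IsPositivelyCartier 𝒜 d) :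
    QGr 𝒜 d ≌ QCoh (projPlus 𝒜) :=
  CategoryTheory.Equivalence.mk (tildeQuot 𝒜 d hq hT) (gammaStarQuot 𝒜 d) (unitIso hq hT hd hC)
    (counitIso hq hT hd hC)

end Equivalence

end GradedProj

end

theorem theorem3 {A : Type u} [CommRing A] (𝒜 : ℤ → AddSubgroup A) [GradedRing 𝒜]
    [IsNoetherianRing (GradedProj.nonneg 𝒜)] (d : ℕ) (hd : 0 < d)
    (hC : GradedProj.IsPositivelyCartier 𝒜 d) :
    ∃ (hq : ∀ M : GradedProj.GrMod 𝒜,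
        GradedProj.isQCoh (GradedProj.projPlus 𝒜) (GradedProj.tilde M))
      (hT : (GradedProj.torPlusIso 𝒜 d).IsInvertedBy (GradedProj.tildeQCoh 𝒜 hq)),
      ∃ e : GradedProj.QGr 𝒜 d ≌ GradedProj.QCoh (GradedProj.projPlus 𝒜),
        e.functor = GradedProj.tildeQuot 𝒜 d hq hT ∧
        e.inverse = GradedProj.gammaStarQuot 𝒜 d := by
  -- `Equivalence.mk` corrects only the unit to obtain the triangle identities, so the two functors
  -- are the given ones by definition.
  exact ⟨GradedProj.isQCoh_tilde, GradedProj.tildeQCoh_isInvertedBy hd _,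
    GradedProj.quotEquivalence _ _ hd hC, rfl, rfl⟩
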